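/- **Setting.** An instance of (splittable) Capacitated Vehicle Routing on a tree consists of a finite tree $G=(V,E)$ with a depot $r\in V$, edge lengths $l:E\to\mathbb Z_{\ge 0}$, demands $d:V\to\mathbb Z_{\ge 0}$ (with $d(v)=0$ if there is no client at $v$), and an integer capacity $Q\ge 1$. A tour is a closed walk in $G$ starting and ending at $r$, together with an amount $x(v)\in\mathbb Z_{\ge 0}$ of demand covered at each vertex $v$ of the walk (and $0$ elsewhere) with $\sum_v x(v)\le Q$; its length is the sum of $l(e)$ over all traversals of edges. A feasible solution is a finite multiset of tours that together cover exactly $d(v)$ at every vertex $v$, where the demand of a vertex may be split among several tours; its cost is the total length of its tours, and $OPT$ is the minimum cost of a feasible solution. For $v\ne r$ let $T_v$ be the subtree rooted at $v$ (the vertices whose path to $r$ passes through $v$) and $d(T_v)=\sum_{w\in T_v}d(w)$. The Hamaguchi–Katoh lower bound is $$LB=\sum_{e=(u,v)\in E} 2\, l(e)\left\lceil \frac{d(T_v)}{Q}\right\rceil ,$$ where $u$ is the parent of $v$. **Theorem.** 1. There is a deterministic algorithm that, for every instance as above, with all numbers written in binary, runs in time polynomial in the size of the input and outputs a feasible solution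 (as a list of tours with multiplicities, multiplicities written in binary) whose cost is at most $\frac43 LB$ and at most $\frac43 OPT$. 2. $LB\le OPT$ for every instance. Thus the algorithm is a polynomial-time $\frac43$-approximation for Capacitated Vehicle Routing on trees. 3. The ratio is tight with respect to $LB$: for every real $\alpha<\frac43$ there is an instance with $LB>0$ and $OPT>\alpha\cdot LB$. -/

import Mathlib

namespace CVRP

/-! ### The machine model: structured programs on binary trees whose leaves carry numbers -/

/-- The data on which programs act: binary trees with natural numbers at the leaves. -/
inductive Data : Type
  | nat (n : ℕ) : Data
  | pair (a b : Data) : Data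
  deriving DecidableEq

namespace Data

/-- The size of a datum: numbers are measured by their length in binary. -/
def size : Data → ℕ
  | nat n => Nat.size n + 1
  | pair a b => a.size + b.size + 1

/-- A list of data as a right-nested tuple that ends in `0`. -/
def ofList : List Data → Data
  | [] => nat 0
  | x :: xs => pair x (ofList xs)

/-- A truth value as a datum. -/
def ofBool (b : Bool) : Data := if b then nat 1 else nat 0

end Data

/-- The elementary operations. -/
inductive Op : Type
  | id
  | const (d : Data)
  | fst
  | snd
  | isPair
  | eq
  | le
  | add
  | sub
  | mul
  | div

/-- The result of an elementary operation (`0` where the argument has the wrong shape);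
subtraction is truncated, division is rounded down. -/
def Op.eval : Op → Data → Data
  | .id, x => x
  | .const d, _ => d
  | .fst, .pair a _ => a
  | .snd, .pair _ b => b
  | .isPair, .pair _ _ => .nat 1
  | .eq, .pair a b => .ofBool (decide (a = b))
  | .le, .pair (.nat a) (.nat b) => .ofBool (decide (a ≤ b))
  | .add, .pair (.nat a) (.nat b) => .nat (a + b)
  | .sub, .pair (.nat a) (.nat b) => .nat (a - b)
  | .mul, .pair (.nat a) (.nat b) => .nat (a * b)
  | .div, .pair (.nat a) (.nat b) => .nat (a / b)
  | _, _ => .nat 0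

/-- Programs: elementary operations, composition (`comp p q` runs `q` first), formation of pairs,
branching, and unbounded loops. -/
inductive Prog : Type
  | op (o : Op)
  | comp (p q : Prog)
  | pair (p q : Prog)
  | ite (c p q : Prog)
  | loop (c p : Prog)

/-- `p.Runs x y t`: on input `x` the program `p` halts with output `y` and running time `t`.
An elementary operation is charged for all the bits that it reads and writes (logarithmic cost).
A test succeeds when its result is not the number `0`; `loop c p` repeats `p` while the test `c`
succeeds. -/
inductive Prog.Runs : Prog → Data → Data → ℕ → Prop
  | op (o : Op) (x : Data) : Runs (.op o) x (o.eval x) (x.size + (o.eval x).size + 1)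
  | comp {p q : Prog} {x y z : Data} {s t : ℕ} :
      Runs q x y s → Runs p y z t → Runs (.comp p q) x z (s + t + 1)
  | pair {p q : Prog} {x y z : Data} {s t : ℕ} :
      Runs p x y s → Runs q x z t → Runs (.pair p q) x (.pair y z) (s + t + 1)
  | iteTrue {c p q : Prog} {x b y : Data} {s t : ℕ} :
      Runs c x b s → b ≠ .nat 0 → Runs p x y t → Runs (.ite c p q) x y (s + t + 1)
  | iteFalse {c p q : Prog} {x y : Data} {s t : ℕ} :
      Runs c x (.nat 0) s → Runs q x y t → Runs (.ite c p q) x y (s + t + 1)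
  | loopStop {c p : Prog} {x : Data} {s : ℕ} :
      Runs c x (.nat 0) s → Runs (.loop c p) x x (s + 1)
  | loopStep {c p : Prog} {x b y z : Data} {s t u : ℕ} :
      Runs c x b s → b ≠ .nat 0 → Runs p x y t → Runs (.loop c p) y z u →
      Runs (.loop c p) x z (s + t + u + 1)

/-! ### Capacitated vehicle routing on trees, with splittable demand -/

/-- An instance of capacitated vehicle routing on a tree with vertices `0, …, n - 1`. Only the
values of `len` on edges matter. A vertex is a client with the given demand; a vertex at which there
is no client has demand `0`. -/
structure Inst : Type where
  n : ℕ
  G : SimpleGraph (Fin n)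
  isTree : G.IsTree
  depot : Fin n
  len : Sym2 (Fin n) → ℕ
  demand : Fin n → ℕ
  Q : ℕ
  Q_pos : 0 < Q

namespace Inst

/-- The unique path between two vertices. -/
noncomputable def path (I : Inst) (u v : Fin I.n) : I.G.Walk u v :=
  (I.isTree.existsUnique_path u v).choose

/-- The parent of a vertex: the next vertex on the path to the depot (junk at the depot). -/
noncomputable def parent (I : Inst) (v : Fin I.n) : Fin I.n :=
  (I.path v I.depot).snd

/-- The subtree rooted at `v`: the vertices whose path to the depot passes through `v`. -/
noncomputable def subtree (I : Inst) (v : Fin I.n) : Finset (Fin I.n) :=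
  Finset.univ.filter fun w => v ∈ (I.path w I.depot).support

/-- The total demand in the subtree rooted at `v`. -/
noncomputable def subtreeDemand (I : Inst) (v : Fin I.n) : ℕ :=
  ∑ w ∈ I.subtree v, I.demand w

/-- The traffic on the edge between `v` and its parent. -/
noncomputable def traffic (I : Inst) (v : Fin I.n) : ℕ :=
  ⌈(I.subtreeDemand v : ℚ) / (I.Q : ℚ)⌉₊

/-- The Hamaguchi–Katoh lower bound. The edges are indexed by their lower ends: each edge is
`{parent v, v}` for exactly one vertex `v` other than the depot. -/
noncomputable def LB (I : Inst) : ℕ :=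
  ∑ v ∈ Finset.univ.erase I.depot, 2 * I.len s(I.parent v, v) * I.traffic v

/-- A tour: a closed walk from the depot, with the amounts of demand that it covers at vertices
along the walk, in total at most the capacity. -/
structure Tour (I : Inst) : Type where
  walk : I.G.Walk I.depot I.depot
  load : Fin I.n → ℕ
  mem_walk : ∀ v, load v ≠ 0 → v ∈ walk.support
  load_le : ∑ v, load v ≤ I.Q

/-- The length of a tour: every traversal of an edge counts. -/
def Tour.cost {I : Inst} (T : I.Tour) : ℕ := (T.walk.edges.map I.len).sum

/-- A finite collection of tours with multiplicities: the entry `(k, T)` stands for `k` vehicles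
that all perform the tour `T`. -/
abbrev Schedule (I : Inst) : Type := List (ℕ × I.Tour)

/-- The tours collectively cover all demand. -/
def Schedule.Feasible {I : Inst} (S : I.Schedule) : Prop :=
  ∀ v, (S.map fun e => e.1 * e.2.load v).sum = I.demand v

/-- The total length of the tours. -/
def Schedule.cost {I : Inst} (S : I.Schedule) : ℕ :=
  (S.map fun e => e.1 * e.2.cost).sum

/-- The optimal cost. -/
noncomputable def opt (I : Inst) : ℕ :=
  sInf {c | ∃ S : I.Schedule, S.Feasible ∧ S.cost = c}

/-! ### Inputs and outputs of programs -/

open Classical in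
/-- The entry of the length matrix at `(u, v)`: the list `[length]` for an edge, and the empty list
for a pair that is not adjacent. -/
noncomputable def encodeEntry (I : Inst) (u v : Fin I.n) : Data :=
  if I.G.Adj u v then .ofList [.nat (I.len s(u, v))] else .ofList []

/-- An instance as a datum: the number of vertices, the depot, the capacity, the list of demands,
and the matrix of edge lengths. -/
noncomputable def encode (I : Inst) : Data :=
  .ofList [.nat I.n, .nat I.depot, .nat I.Q,
    .ofList (List.ofFn fun v => .nat (I.demand v)),
    .ofList (List.ofFn fun u => .ofList (List.ofFn fun v => I.encodeEntry u v))]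

/-- A tour as a datum: the list of the vertices along the walk, and the list of the amounts covered
at the vertices `0, …, n - 1`. -/
def Tour.encode {I : Inst} (T : I.Tour) : Data :=
  .pair (.ofList (T.walk.support.map fun v => .nat v)) (.ofList (List.ofFn fun v => .nat (T.load v)))

/-- A schedule as a datum. -/
def Schedule.encode {I : Inst} (S : I.Schedule) : Data :=
  .ofList (S.map fun e => .pair (.nat e.1) e.2.encode)

end Inst

end CVRP

/-! Every vertex first sends out `demand / Q` full vehicles, which also count fully in `LB`; only
the remainders below `Q` matter. They are swept from the leaves of the tree to the depot in bundles
(`Elem`). A bundle keeps three alternative packings of its demand into vehicles. In each packing one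
vehicle is open and carries at most `x`, while the demand of the bundle is exactly `full * Q + x`.
Thus `Q - x` is the capacity it wastes. A bundle is either a leaf (one vehicle, the same load in all
packings) or composite, in which case its three packings together use at most `4 * full + 2`
vehicles.

Before the sweep leaves a vertex, the bundles there are merged until they waste less than `Q` in
total. Then `N`, the sum of `full + 1`, is the least number of vehicles for the remaining demand of
the subtree. Merging takes a minimal set of bundles wasting at least `Q`, say `L` leaves and `C`
composites. One vehicle is saved in `6 - L - 2 * C` of the three packings (in all three if this
exceeds 3), which is just enough to restore the bound on the count. A saving packing fills vehicles
one after the other and thereby splits all bundles but two. The split bundles are leaves, and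
rotating the order ensures that no leaf is split in more than one packing (`savings_split_le`).

This is measured by a potential relative to a vertex set `T`: a leaf counts 4 if it meets `T`, a
composite counts the vehicles of its three packings that meet `T`. The fourth unit of a leaf pays
for its only split, so merging never increases the potential (`Mergeable.pot_merge`). When the sweep
leaves `v`, the potential for the subtree of `v` is at most `4 * N` (`Packed.pot_le`), and it stays
so to the end (`sweep_pot`). Hence the three packings together use each edge at most four times as
often as `LB` charges it (`sum_modeCost_le`), and the cheapest of the three schedules costs at most
a third of `4 * LB`.

`LB` is below the optimum because a tour with load in a subtree crosses the edge above it twice and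
carries at most `Q` (`LB_le_cost`). Tightness comes from stars whose clients demand slightly more
than `Q / 2`: a tour can serve at most one of them completely (`IsStar.le_cost`).

For the running time, `PT` collects families of data that one program computes in polynomial time.
It is closed under the list operations that the algorithm uses (`PT.foldlData` is the only loop),
provided that the intermediate states stay of polynomial size. For bundles this holds because
merging never increases the total number of vehicles, which starts at no more than `3 * n`. -/

namespace CVRP

/-! ### Polynomial-time computability: elementary operations and the basic loop. -/

open Data

/-- `PT x y`: some program computes `y i` from `x i` for every index `i`, in polynomial time. -/
def PT {ι : Type*} (x y : ι → Data) : Prop :=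
  ∃ (p : Prog) (P : Polynomial ℕ), ∀ i, ∃ t, p.Runs (x i) (y i) t ∧ t ≤ P.eval (x i).size

theorem polynomial_eval_mono (P : Polynomial ℕ) {a b : ℕ} (h : a ≤ b) : P.eval a ≤ P.eval b := by
  rw [Polynomial.eval_eq_sum, Polynomial.eval_eq_sum]
  exact Finset.sum_le_sum fun i _ => Nat.mul_le_mul_left _ (Nat.pow_le_pow_left h i)

theorem Data.size_pos (d : Data) : 0 < d.size := by cases d <;> simp [Data.size]

/-- Elementary operations pay for every bit read or written, so time dominates both input and
output. The bound on the input is needed in the induction, since a loop that stops at once returns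
its input. -/
theorem Prog.Runs.size_le {p : Prog} {x y : Data} {t : ℕ} (h : p.Runs x y t) :
    x.size + y.size ≤ 2 * t ∧ y.size ≤ t ∧ x.size ≤ t := by
  induction h with
  | op o x => omega
  | comp _ _ ih1 ih2 => omega
  | pair _ _ ih1 ih2 => simp only [Data.size]; omega
  | iteTrue _ _ _ ih1 ih2 => omega
  | iteFalse _ _ ih1 ih2 => omega
  | loopStop _ ih => omega
  | loopStep _ _ _ _ ih1 ih2 ih3 => omega

namespace PT

variable {ι : Type*} {x y z : ι → Data}

theorem size_le (h : PT x y) : ∃ P : Polynomial ℕ, ∀ i, (y i).size ≤ P.eval (x i).size := by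
  obtain ⟨p, P, h⟩ := h
  refine ⟨P, fun i => ?_⟩
  obtain ⟨t, ht, hP⟩ := h i
  exact ht.size_le.2.1.trans hP

theorem of_op (o : Op) (h : ∀ i, o.eval (x i) = y i) (P : Polynomial ℕ)
    (hP : ∀ i, (y i).size ≤ P.eval (x i).size) : PT x y := by
  refine ⟨.op o, Polynomial.X + P + 1, fun i => ⟨_, h i ▸ Prog.Runs.op o (x i), ?_⟩⟩
  simp only [Polynomial.eval_add, Polynomial.eval_X, Polynomial.eval_one]
  have := hP i
  omega

theorem of_op_le (o : Op) (h : ∀ i, o.eval (x i) = y i)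
    (hP : ∀ i, (y i).size ≤ (x i).size + 3) : PT x y :=
  of_op o h (Polynomial.X + 3) fun i => by simpa using hP i

theorem refl (x : ι → Data) : PT x x := of_op_le .id (fun _ => rfl) fun _ => by omega

theorem const (x : ι → Data) (d : Data) : PT x fun _ => d :=
  of_op (.const d) (fun _ => rfl) (Polynomial.C d.size) fun _ => by simp

theorem trans (h1 : PT x y) (h2 : PT y z) : PT x z := by
  obtain ⟨p, P, hp⟩ := h1
  obtain ⟨q, R, hq⟩ := h2
  refine ⟨.comp q p, P + R.comp P + 1, fun i => ?_⟩
  obtain ⟨s, hs, hsP⟩ := hp i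
  obtain ⟨t, ht, htR⟩ := hq i
  refine ⟨_, .comp hs ht, ?_⟩
  have := polynomial_eval_mono R (hs.size_le.2.1.trans hsP)
  simp only [Polynomial.eval_add, Polynomial.eval_comp, Polynomial.eval_one]
  omega

theorem pair (h1 : PT x y) (h2 : PT x z) : PT x fun i => .pair (y i) (z i) := by
  obtain ⟨p, P, hp⟩ := h1
  obtain ⟨q, R, hq⟩ := h2
  refine ⟨.pair p q, P + R + 1, fun i => ?_⟩
  obtain ⟨s, hs, hsP⟩ := hp i
  obtain ⟨t, ht, htR⟩ := hq i
  refine ⟨_, .pair hs ht, ?_⟩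
  simp only [Polynomial.eval_add, Polynomial.eval_one]
  omega

theorem fst (h : PT x fun i => .pair (y i) (z i)) : PT x y :=
  h.trans (of_op_le .fst (fun _ => rfl) fun i => by simp only [Data.size]; omega)

theorem snd (h : PT x fun i => .pair (y i) (z i)) : PT x z :=
  h.trans (of_op_le .snd (fun _ => rfl) fun i => by simp only [Data.size]; omega)

/-- One program serves all indices, so it also serves any other family that factors through them.
Taking a subtype for `κ` is how side conditions on the input are imposed. -/
theorem reindex {κ : Type*} (h : PT x y) (g : κ → ι) : PT (fun j => x (g j)) fun j => y (g j) := by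
  obtain ⟨p, P, h⟩ := h
  exact ⟨p, P, fun j => h (g j)⟩

theorem congr {y' : ι → Data} (h : PT x y) (e : ∀ i, y i = y' i) : PT x y' := by
  rwa [← funext e]

theorem congr₂ {x' y' : ι → Data} (h : PT x y) (hx : ∀ i, x i = x' i) (hy : ∀ i, y i = y' i) :
    PT x' y' := by
  rwa [← funext hx, ← funext hy]

theorem of_comp_op {m n k : ι → Data} (o : Op) (hm : PT x m) (hn : PT x n)
    (h : ∀ i, o.eval (.pair (m i) (n i)) = k i)
    (hk : ∀ i, (k i).size ≤ (m i).size + (n i).size + 3) : PT x k :=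
  (hm.pair hn).trans (of_op_le o h fun i => by have := hk i; simp only [Data.size]; omega)

theorem size_ofBool (b : Bool) : (ofBool b).size ≤ 2 := by cases b <;> decide

theorem eq (hy : PT x y) (hz : PT x z) : PT x fun i => ofBool (decide (y i = z i)) :=
  of_comp_op .eq hy hz (fun _ => rfl) fun i => (size_ofBool _).trans (by omega)

variable {m n : ι → ℕ}

theorem le (hm : PT x fun i => nat (m i)) (hn : PT x fun i => nat (n i)) :
    PT x fun i => ofBool (decide (m i ≤ n i)) :=
  of_comp_op .le hm hn (fun _ => rfl) fun i => (size_ofBool _).trans (by omega)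

theorem size_add_le (a b : ℕ) : Nat.size (a + b) ≤ Nat.size a + Nat.size b + 1 := by
  rw [Nat.size_le]
  have ha := Nat.lt_size_self a
  have hb := Nat.lt_size_self b
  have h1 : 2 ^ Nat.size a ≤ 2 ^ (Nat.size a + Nat.size b) :=
    Nat.pow_le_pow_right (by omega) (by omega)
  have h2 : 2 ^ Nat.size b ≤ 2 ^ (Nat.size a + Nat.size b) :=
    Nat.pow_le_pow_right (by omega) (by omega)
  rw [pow_succ]
  omega

theorem size_mul_le (a b : ℕ) : Nat.size (a * b) ≤ Nat.size a + Nat.size b := by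
  rw [Nat.size_le, pow_add]
  exact Nat.mul_lt_mul'' (Nat.lt_size_self a) (Nat.lt_size_self b)

theorem add (hm : PT x fun i => nat (m i)) (hn : PT x fun i => nat (n i)) :
    PT x fun i => nat (m i + n i) :=
  of_comp_op .add hm hn (fun _ => rfl) fun i => by
    have := size_add_le (m i) (n i)
    simp only [Data.size]; omega

theorem mul (hm : PT x fun i => nat (m i)) (hn : PT x fun i => nat (n i)) :
    PT x fun i => nat (m i * n i) :=
  of_comp_op .mul hm hn (fun _ => rfl) fun i => by
    have := size_mul_le (m i) (n i)
    simp only [Data.size]; omega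

theorem sub (hm : PT x fun i => nat (m i)) (hn : PT x fun i => nat (n i)) :
    PT x fun i => nat (m i - n i) :=
  of_comp_op .sub hm hn (fun _ => rfl) fun i => by
    have := Nat.size_le_size (Nat.sub_le (m i) (n i))
    simp only [Data.size]; omega

theorem div (hm : PT x fun i => nat (m i)) (hn : PT x fun i => nat (n i)) :
    PT x fun i => nat (m i / n i) :=
  of_comp_op .div hm hn (fun _ => rfl) fun i => by
    have := Nat.size_le_size (Nat.div_le_self (m i) (n i))
    simp only [Data.size]; omega

theorem mod (hm : PT x fun i => nat (m i)) (hn : PT x fun i => nat (n i)) :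
    PT x fun i => nat (m i % n i) :=
  (hm.sub ((hm.div hn).mul hn)).congr fun i => by
    congr 1
    have := Nat.div_add_mod' (m i) (n i)
    omega

theorem nat_const (k : ℕ) : PT x fun _ => nat k := const x _

theorem nat_eq (hm : PT x fun i => nat (m i)) (hn : PT x fun i => nat (n i)) :
    PT x fun i => ofBool (decide (m i = n i)) :=
  (hm.eq hn).congr fun i => by simp

/-- Branching. -/
theorem ite {c : ι → Prop} [∀ i, Decidable (c i)] (hc : PT x fun i => ofBool (decide (c i)))
    (hy : PT (fun i : {i // c i} => x i) fun i => y i)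
    (hz : PT (fun i : {i // ¬ c i} => x i) fun i => z i) :
    PT x fun i => if c i then y i else z i := by
  obtain ⟨p, P, hp⟩ := hc
  obtain ⟨q, R, hq⟩ := hy
  obtain ⟨r, S, hr⟩ := hz
  refine ⟨.ite p q r, P + R + S + 1, fun i => ?_⟩
  obtain ⟨s, hs, hsP⟩ := hp i
  simp only [Polynomial.eval_add, Polynomial.eval_one]
  by_cases h : c i
  · obtain ⟨t, ht, htR⟩ := hq ⟨i, h⟩
    refine ⟨_, .iteTrue hs (by simp [h, ofBool]) (by simpa [h] using ht), ?_⟩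
    dsimp only at htR
    omega
  · obtain ⟨t, ht, htR⟩ := hr ⟨i, h⟩
    refine ⟨_, .iteFalse (by simpa [h, ofBool] using hs) (by simpa [h] using ht), ?_⟩
    dsimp only at htR
    omega

theorem ite' {c : ι → Prop} [∀ i, Decidable (c i)] (hc : PT x fun i => ofBool (decide (c i)))
    (hy : PT x y) (hz : PT x z) : PT x fun i => if c i then y i else z i :=
  ite hc (hy.reindex _) (hz.reindex _)

theorem bool_ite {c : ι → Prop} [∀ i, Decidable (c i)] {k l : ι → ℕ}
    (hc : PT x fun i => ofBool (decide (c i)))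
    (hy : PT x fun i => nat (k i)) (hz : PT x fun i => nat (l i)) :
    PT x fun i => nat (if c i then k i else l i) :=
  (ite' hc hy hz).congr fun i => by split <;> rfl

theorem not {c : ι → Prop} [∀ i, Decidable (c i)] (hc : PT x fun i => ofBool (decide (c i))) :
    PT x fun i => ofBool (decide (¬ c i)) :=
  (ite' hc (nat_const 0) (nat_const 1)).congr fun i => by
    by_cases h : c i <;> simp [h, ofBool]

theorem and {c d : ι → Prop} [∀ i, Decidable (c i)] [∀ i, Decidable (d i)]
    (hc : PT x fun i => ofBool (decide (c i))) (hd : PT x fun i => ofBool (decide (d i))) :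
    PT x fun i => ofBool (decide (c i ∧ d i)) :=
  (ite' hc hd (nat_const 0)).congr fun i => by
    by_cases h : c i <;> simp [h, ofBool]

/-- A truth value that is stored as a datum. -/
theorem bool_eq_true {b : ι → Bool} (hb : PT x fun i => ofBool (b i)) :
    PT x fun i => ofBool (decide (b i = true)) :=
  hb.congr fun i => by simp

theorem lt (hm : PT x fun i => nat (m i)) (hn : PT x fun i => nat (n i)) :
    PT x fun i => ofBool (decide (m i < n i)) :=
  (hn.le hm).not.congr fun i => by simp

theorem min (hm : PT x fun i => nat (m i)) (hn : PT x fun i => nat (n i)) :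
    PT x fun i => nat (min (m i) (n i)) :=
  (hm.sub (hm.sub hn)).congr fun i => by congr 1; omega

theorem isPair {c : ι → Prop} [∀ i, Decidable (c i)] (hy : PT x y)
    (h1 : ∀ i, c i → ∃ a b, y i = .pair a b) (h2 : ∀ i, ¬ c i → ∃ k, y i = nat k) :
    PT x fun i => ofBool (decide (c i)) :=
  hy.trans (of_op_le .isPair (fun i => by
    by_cases h : c i
    · obtain ⟨a, b, e⟩ := h1 i h
      simp [e, h, Op.eval, ofBool]
    · obtain ⟨k, e⟩ := h2 i h
      simp [e, h, Op.eval, ofBool]) fun i => (size_ofBool _).trans (by omega))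

/-! ### Loops over lists -/

theorem size_ofList_append (l₁ l₂ : List Data) :
    (ofList (l₁ ++ l₂)).size + 1 = (ofList l₁).size + (ofList l₂).size := by
  induction l₁ with
  | nil => simp [ofList, Data.size, Nat.size_zero]; omega
  | cons a l ih => simp only [List.cons_append, ofList, Data.size]; omega

theorem length_lt_size (l : List Data) : l.length < (ofList l).size := by
  induction l with
  | nil => simp [ofList, Data.size]
  | cons a l ih => simp only [List.length_cons, ofList, Data.size]; omega

theorem size_ofList_le {l : List Data} {B : ℕ} (h : ∀ d ∈ l, d.size ≤ B) :
    (ofList l).size ≤ l.length * (B + 1) + 1 := by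
  induction l with
  | nil => simp [ofList, Data.size]
  | cons a l ih =>
    have h1 := h a (by simp)
    have h2 := ih fun d hd => h d (by simp [hd])
    simp only [List.length_cons, ofList, Data.size, Nat.add_mul]
    omega

theorem size_le_ofList {l : List Data} {d : Data} (h : d ∈ l) : d.size < (ofList l).size := by
  induction l with
  | nil => simp at h
  | cons a l ih =>
    simp only [ofList, Data.size]
    rcases List.mem_cons.1 h with rfl | h
    · omega
    · have := ih h; omega

theorem size_ofList_drop (l : List Data) (k : ℕ) : (ofList (l.drop k)).size ≤ (ofList l).size := by
  have := size_ofList_append (l.take k) (l.drop k)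
  rw [List.take_append_drop] at this
  have := Data.size_pos (ofList (l.take k))
  omega

theorem cons (hy : PT x y) {l : ι → List Data} (hl : PT x fun i => ofList (l i)) :
    PT x fun i => ofList (y i :: l i) := hy.pair hl

theorem nil : PT x fun _ => ofList [] := nat_const 0

theorem isNil {l : ι → List Data} (hl : PT x fun i => ofList (l i)) :
    PT x fun i => ofBool (decide (l i = [])) :=
  (hl.isPair (c := fun i => l i ≠ []) (fun i h => by
    obtain ⟨a, t, e⟩ := List.exists_cons_of_ne_nil h
    exact ⟨a, ofList t, by rw [e]; rfl⟩) (fun i h => ⟨0, by simp at h; rw [h]; rfl⟩)).not.congr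
    fun i => by simp

/-- The central loop: a fold over a list, run on states of polynomially bounded size. -/
theorem foldlData {x : ι → Data} {l : ι → List Data} {s : ι → ℕ → Data}
    (hl : PT x fun i => ofList (l i)) (h0 : PT x fun i => s i 0)
    (hs : PT (fun j : Σ i, Fin (l i).length =>
        Data.pair (x j.1) (.pair (s j.1 j.2) (l j.1)[j.2])) fun j => s j.1 (j.2 + 1))
    (B : Polynomial ℕ) (hB : ∀ i, ∀ k ≤ (l i).length, (s i k).size ≤ B.eval (x i).size) :
    PT x fun i => s i (l i).length := by
  obtain ⟨pl, Pl, hl⟩ := hl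
  obtain ⟨p0, P0, h0⟩ := h0
  obtain ⟨ps, Ps, hs⟩ := hs
  -- the loop runs on `(x, (state, remaining list))`
  let fstP : Prog := .op .fst
  let sndP : Prog := .op .snd
  let test : Prog := .comp (.op .isPair) (.comp sndP sndP)
  let arg : Prog := .pair fstP (.pair (.comp fstP sndP) (.comp fstP (.comp sndP sndP)))
  let body : Prog := .pair fstP (.pair (.comp ps arg) (.comp sndP (.comp sndP sndP)))
  -- `M` bounds the size of every loop state `st k`, and `T` bounds the time of one round. The
  -- number of rounds is less than the size of the list, hence the factor `Pl + 1` below.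
  let M : Polynomial ℕ := Polynomial.X + B + Pl + 3
  let T : Polynomial ℕ := 100 * M + 100 + Ps.comp M
  refine ⟨.comp (.comp (.comp fstP sndP) (.loop test body))
    (.pair (.op .id) (.pair p0 pl)), 50 + 50 * M + P0 + Pl + (Pl + 1) * (T + 1), fun i => ?_⟩
  obtain ⟨tl, hl, htl⟩ := hl i
  obtain ⟨t0, h0, ht0⟩ := h0 i
  have hlsize : (ofList (l i)).size ≤ Pl.eval (x i).size := hl.size_le.2.1.trans htl
  have hM : M.eval (x i).size = (x i).size + B.eval (x i).size + Pl.eval (x i).size + 3 := by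
    simp [M]
  let st : ℕ → Data := fun k => .pair (x i) (.pair (s i k) (ofList ((l i).drop k)))
  have hst : ∀ k ≤ (l i).length, (st k).size ≤ M.eval (x i).size := fun k hk => by
    have h1 := hB i k hk
    have h2 := size_ofList_drop (l i) k
    rw [hM]
    simp only [st, Data.size]
    omega
  have hpart : ∀ k ≤ (l i).length, (x i).size ≤ (st k).size ∧ (s i k).size ≤ (st k).size ∧
      (ofList ((l i).drop k)).size ≤ (st k).size ∧
      (Data.pair (s i k) (ofList ((l i).drop k))).size ≤ (st k).size := fun k _ => by
    simp only [st, Data.size]; omega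
  have htest : ∀ k ≤ (l i).length, ∃ t, test.Runs (st k)
      (ofBool (decide (k < (l i).length))) t ∧ t ≤ 10 * M.eval (x i).size + 10 := by
    intro k hk
    have h1 := hst k hk
    obtain ⟨h2, h3, h4, h5⟩ := hpart k hk
    have e : Op.isPair.eval (ofList ((l i).drop k)) = ofBool (decide (k < (l i).length)) := by
      by_cases h : k < (l i).length
      · rw [List.drop_eq_getElem_cons h]; simp [h, ofList, Op.eval, ofBool]
      · rw [List.drop_eq_nil_of_le (by omega)]; simp [h, ofList, Op.eval, ofBool]
    have r : Prog.Runs (.op .isPair) (ofList ((l i).drop k)) _ _ := .op .isPair _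
    rw [e] at r
    have r' : (Prog.comp sndP sndP).Runs (st k) (ofList ((l i).drop k)) _ :=
      .comp (.op .snd (st k)) (.op .snd (.pair (s i k) _))
    refine ⟨_, .comp r' r, ?_⟩
    have h6 := size_ofBool (decide (k < (l i).length))
    simp only [st, Op.eval] at *
    omega
  have hbody : ∀ k < (l i).length, ∃ t, body.Runs (st k) (st (k + 1)) t ∧
      t ≤ 80 * M.eval (x i).size + 80 + Ps.eval (M.eval (x i).size) := by
    intro k hk
    have h1 := hst k hk.le
    have h1' := hst (k + 1) hk
    obtain ⟨h2, h3, h4, h5⟩ := hpart k hk.le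
    obtain ⟨h2', h3', h4', h5'⟩ := hpart (k + 1) hk
    obtain ⟨t, ht, htP⟩ := hs ⟨i, ⟨k, hk⟩⟩
    have ed : ofList ((l i).drop k) = .pair (l i)[k] (ofList ((l i).drop (k + 1))) := by
      rw [List.drop_eq_getElem_cons hk]; rfl
    have hst' : st k = .pair (x i) (.pair (s i k)
      (.pair (l i)[k] (ofList ((l i).drop (k + 1))))) := by simp only [st, ed]
    have hel : ((l i)[k]).size ≤ (ofList ((l i).drop k)).size := by
      rw [ed]; simp only [Data.size]; omega
    have harg : (Data.pair (x i) (.pair (s i k) (l i)[k])).size ≤ M.eval (x i).size := by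
      have : (st k).size ≤ _ := h1
      rw [hst'] at this
      simp only [Data.size] at this ⊢
      omega
    have htP' := htP.trans (polynomial_eval_mono Ps harg)
    have hsz : (st k).size = (Data.pair (x i) (.pair (s i k)
      (.pair (l i)[k] (ofList ((l i).drop (k + 1)))))).size := by rw [hst']
    have r1 : fstP.Runs (st k) (x i) _ := .op .fst (st k)
    have r2 : (Prog.comp fstP sndP).Runs (st k) (s i k) _ :=
      .comp (.op .snd (st k)) (.op .fst (.pair (s i k) _))
    have r3 : (Prog.comp sndP sndP).Runs (st k) (ofList ((l i).drop k)) _ :=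
      .comp (.op .snd (st k)) (.op .snd (.pair (s i k) _))
    rw [ed] at r3
    have r4 : (Prog.comp fstP (.comp sndP sndP)).Runs (st k) (l i)[k] _ :=
      .comp r3 (.op .fst (.pair _ _))
    have r5 : (Prog.comp sndP (.comp sndP sndP)).Runs (st k) (ofList ((l i).drop (k + 1))) _ :=
      .comp r3 (.op .snd (.pair _ _))
    refine ⟨_, .pair r1 (.pair (.comp (.pair r1 (.pair r2 r4)) ht) r5), ?_⟩
    simp only [Op.eval, ed, st, Data.size] at *
    omega
  have hloop : ∀ d k, k + d = (l i).length → ∃ t, (Prog.loop test body).Runs (st k)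
      (st (l i).length) t ∧ t ≤ (d + 1) * (T.eval (x i).size + 1) := by
    intro d
    induction d with
    | zero =>
      intro k hk
      obtain ⟨t, ht, hT⟩ := htest k (by omega)
      obtain rfl : k = (l i).length := by omega
      refine ⟨_, .loopStop (by simpa [ofBool] using ht), ?_⟩
      simp only [T, Polynomial.eval_add, Polynomial.eval_mul, Polynomial.eval_ofNat]
      omega
    | succ d ih =>
      intro k hk
      obtain ⟨t, ht, hT⟩ := htest k (by omega)
      obtain ⟨u, hu, hU⟩ := hbody k (by omega)
      obtain ⟨v, hv, hV⟩ := ih (k + 1) (by omega)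
      refine ⟨_, .loopStep ht (by simp [ofBool, show k < (l i).length by omega]) hu hv, ?_⟩
      rw [Nat.add_mul (d + 1)]
      have : t + u + 1 ≤ 1 * (T.eval (x i).size + 1) := by
        simp only [T, Polynomial.eval_add, Polynomial.eval_mul, Polynomial.eval_ofNat,
          Polynomial.eval_comp]
        omega
      omega
  obtain ⟨t, ht, hT⟩ := hloop (l i).length 0 (by omega)
  have hst0 : st 0 = .pair (x i) (.pair (s i 0) (ofList (l i))) := by simp [st]
  rw [hst0] at ht
  refine ⟨_, .comp (.pair (.op .id _) (.pair h0 hl)) (.comp ht (.comp (.op .snd _) (.op .fst _))), ?_⟩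
  have h1 := hst (l i).length le_rfl
  have h2 := length_lt_size (l i)
  have h3 : ((l i).length + 1) * (T.eval (x i).size + 1) ≤
      (Pl.eval (x i).size + 1) * (T.eval (x i).size + 1) := Nat.mul_le_mul_right _ (by omega)
  simp only [Op.eval, st, Data.size, Polynomial.eval_add, Polynomial.eval_mul,
    Polynomial.eval_ofNat, Polynomial.eval_one] at *
  omega

end PT

end CVRP

/-! ### Polynomial-time operations on lists. -/

namespace CVRP

open Data

namespace PT

/-- Written as a sum over the entries, the size is visibly invariant under permutations and monotone
under sublists. -/
theorem size_ofList (l : List Data) :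
    (ofList l).size = (l.map fun d => d.size + 1).sum + 1 := by
  induction l with
  | nil => simp [ofList, Data.size]
  | cons a l ih => simp only [ofList, Data.size, ih, List.map_cons, List.sum_cons]; omega

theorem size_ofList_perm {l₁ l₂ : List Data} (h : l₁.Perm l₂) :
    (ofList l₁).size = (ofList l₂).size := by
  rw [size_ofList, size_ofList, (h.map _).sum_eq]

theorem size_ofList_sublist {l₁ l₂ : List Data} (h : l₁.Sublist l₂) :
    (ofList l₁).size ≤ (ofList l₂).size := by
  rw [size_ofList, size_ofList]
  have := (h.map fun d => d.size + 1).sum_le_sum (fun _ _ => Nat.zero_le _)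
  omega

variable {ι : Type*} {x y z : ι → Data}

/-- Inside a loop body the input is paired with local data `w`; whatever is computable outside
remains available there. -/
theorem weaken {κ : ι → Type*} {w : (Σ i, κ i) → Data} (h : PT x y) :
    PT (fun j : Σ i, κ i => Data.pair (x j.1) (w j)) fun j => y j.1 :=
  (fst (y := fun j : Σ i, κ i => x j.1) (z := w) (refl _)).trans (h.reindex Sigma.fst)

theorem bound {κ : Type*} {x' : κ → Data} {y' : κ → Data} (h : PT x' y') (g : κ → ι)
    (Q : Polynomial ℕ) (hQ : ∀ j, (x' j).size ≤ Q.eval (x (g j)).size) :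
    ∃ P : Polynomial ℕ, ∀ j, (y' j).size ≤ P.eval (x (g j)).size := by
  obtain ⟨P, hP⟩ := h.size_le
  refine ⟨P.comp Q, fun j => (hP j).trans ?_⟩
  rw [Polynomial.eval_comp]
  exact polynomial_eval_mono P (hQ j)

variable {α β : ι → Type*}

/-- A fold over a list, run on states of polynomially bounded size. -/
theorem foldl (l : ∀ i, List (α i)) (ea : ∀ i, α i → Data) (eb : ∀ i, β i → Data)
    (f : ∀ i, β i → α i → β i) (b : ∀ i, β i)
    (hl : PT x fun i => ofList ((l i).map (ea i))) (h0 : PT x fun i => eb i (b i))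
    (hs : PT (fun j : Σ i, Fin (l i).length => Data.pair (x j.1)
        (.pair (eb j.1 (((l j.1).take j.2).foldl (f j.1) (b j.1))) (ea j.1 (l j.1)[j.2])))
      fun j => eb j.1 (f j.1 (((l j.1).take j.2).foldl (f j.1) (b j.1)) (l j.1)[j.2]))
    (B : Polynomial ℕ) (hB : ∀ i, ∀ k ≤ (l i).length,
      (eb i (((l i).take k).foldl (f i) (b i))).size ≤ B.eval (x i).size) :
    PT x fun i => eb i ((l i).foldl (f i) (b i)) := by
  refine (foldlData (s := fun i k => eb i (((l i).take k).foldl (f i) (b i))) hl (by simpa using h0)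
    ?_ B (fun i k hk => hB i k (by simpa using hk))).congr fun i => by simp
  refine (hs.reindex fun j : Σ i, Fin ((l i).map (ea i)).length =>
    ⟨j.1, ⟨j.2, by simpa using j.2.2⟩⟩).congr₂ (fun j => by simp) fun j => ?_
  have hj : (j.2 : ℕ) < (l j.1).length := by simpa using j.2.2
  rw [← List.take_concat_get' _ _ hj, List.foldl_append]
  rfl

theorem reverse {l : ι → List Data} (hl : PT x fun i => ofList (l i)) :
    PT x fun i => ofList (l i).reverse := by
  obtain ⟨P, hP⟩ := hl.size_le
  refine (foldlData (s := fun i k => ofList ((l i).take k).reverse) hl nil ?_ P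
    fun i k _ => ?_).congr fun i => by simp
  · refine (PT.cons (y := fun j : Σ i, Fin (l i).length => (l j.1)[j.2])
      (l := fun j => ((l j.1).take j.2).reverse) ?_ ?_).congr fun j => ?_
    · exact (refl _).snd.snd
    · exact (refl _).snd.fst
    · rw [← List.take_concat_get' _ _ j.2.2, List.reverse_append]; rfl
  · rw [size_ofList_perm (List.reverse_perm _)]
    exact (size_ofList_sublist (List.take_sublist _ _)).trans (hP i)

/-- Only prepending is elementary, so the loop runs over the reverse of the first list and puts its
entries in front of the second. -/
theorem append {l₁ l₂ : ι → List Data} (h₁ : PT x fun i => ofList (l₁ i))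
    (h₂ : PT x fun i => ofList (l₂ i)) : PT x fun i => ofList (l₁ i ++ l₂ i) := by
  obtain ⟨P, hP⟩ := h₁.size_le
  obtain ⟨R, hR⟩ := h₂.size_le
  refine (foldlData (s := fun i k => ofList (((l₁ i).reverse.take k).reverse ++ l₂ i)) h₁.reverse
    (by simpa using h₂) ?_ (P + R) fun i k _ => ?_).congr fun i => by
      rw [List.take_of_length_le (by simp), List.reverse_reverse]
  · refine (PT.cons (y := fun j : Σ i, Fin (l₁ i).reverse.length => (l₁ j.1).reverse[j.2])
      (l := fun j => ((l₁ j.1).reverse.take j.2).reverse ++ l₂ j.1) ?_ ?_).congr fun j => ?_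
    · exact (refl _).snd.snd
    · exact (refl _).snd.fst
    · rw [← List.take_concat_get' _ _ j.2.2]; simp
  · have h1 := size_ofList_append (((l₁ i).reverse.take k).reverse) (l₂ i)
    have h2 := hP i
    have h3 := hR i
    rw [size_ofList_perm (List.reverse_perm _)] at h1
    have h4 := size_ofList_sublist (List.take_sublist k (l₁ i).reverse)
    rw [size_ofList_perm (List.reverse_perm _)] at h4
    simp only [Polynomial.eval_add]
    omega

/-- The values of a function on the members of a list have polynomially bounded sizes. -/
theorem bound_mem {l : ∀ i, List (α i)} {ea : ∀ i, α i → Data} {g : ∀ i, α i → Data}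
    (hl : PT x fun i => ofList ((l i).map (ea i)))
    (hg : PT (fun j : Σ i, {a // a ∈ l i} => Data.pair (x j.1) (ea j.1 j.2))
      fun j => g j.1 j.2) :
    ∃ P : Polynomial ℕ, ∀ i, (∀ a ∈ l i, (g i a).size ≤ P.eval (x i).size) ∧
      (l i).length ≤ P.eval (x i).size := by
  obtain ⟨P, hP⟩ := hl.size_le
  obtain ⟨R, hR⟩ := hg.bound (x := x) (g := Sigma.fst) (Polynomial.X + P + 1) (fun j => by
    have h1 := hP j.1
    have h2 := size_le_ofList (List.mem_map_of_mem (f := ea j.1) j.2.2)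
    simp only [Data.size, Polynomial.eval_add, Polynomial.eval_X, Polynomial.eval_one]
    omega)
  refine ⟨P + R, fun i => ⟨fun a ha => ?_, ?_⟩⟩
  · have := hR ⟨i, a, ha⟩
    simp only [Polynomial.eval_add]
    dsimp only at this
    omega
  · have h1 := length_lt_size ((l i).map (ea i))
    have h2 := hP i
    simp only [List.length_map, Polynomial.eval_add] at *
    omega

theorem flatMap {l : ∀ i, List (α i)} {ea : ∀ i, α i → Data} {g : ∀ i, α i → List Data}
    (hl : PT x fun i => ofList ((l i).map (ea i)))
    (hg : PT (fun j : Σ i, {a // a ∈ l i} => Data.pair (x j.1) (ea j.1 j.2))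
      fun j => ofList (g j.1 j.2)) :
    PT x fun i => ofList ((l i).flatMap (g i)) := by
  obtain ⟨P, hP⟩ := bound_mem (g := fun i a => ofList (g i a)) hl hg
  refine (foldlData (s := fun i k => ofList (((l i).take k).flatMap (g i))) hl
    (by simpa using nil) ?_ (P * P + 1) fun i k _ => ?_).congr fun i => by simp
  · refine (append (l₁ := fun j : Σ i, Fin ((l i).map (ea i)).length =>
      ((l j.1).take j.2).flatMap (g j.1)) (l₂ := fun j => g j.1 ((l j.1)[(j.2 : ℕ)]'(by
        simpa using j.2.2))) ?_ ?_).congr fun j => ?_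
    · exact (refl _).snd.fst
    · refine trans ?_ (hg.reindex fun j : Σ i, Fin ((l i).map (ea i)).length =>
        ⟨j.1, (l j.1)[(j.2 : ℕ)]'(by simpa using j.2.2), List.getElem_mem _⟩)
      refine ((refl _).fst.pair (refl _).snd.snd).congr fun j => ?_
      simp
    · have hj : (j.2 : ℕ) < (l j.1).length := by simpa using j.2.2
      rw [← List.take_concat_get' _ _ hj, List.flatMap_append]; simp
  · have h : ∀ l' : List (α i), (∀ a ∈ l', (ofList (g i a)).size ≤ P.eval (x i).size) →
        (ofList (l'.flatMap (g i))).size ≤ l'.length * P.eval (x i).size + 1 := by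
      intro l' h'
      induction l' with
      | nil => simp [ofList, Data.size]
      | cons a l' ih =>
        have h1 := size_ofList_append (g i a) (l'.flatMap (g i))
        have h2 := h' a (by simp)
        have h3 := ih fun a ha => h' a (by simp [ha])
        simp only [List.flatMap_cons, List.length_cons, Nat.add_mul]
        omega
    refine (h _ fun a ha => (hP i).1 a (List.mem_of_mem_take ha)).trans ?_
    simp only [Polynomial.eval_add, Polynomial.eval_mul, Polynomial.eval_one]
    refine Nat.add_le_add_right (Nat.mul_le_mul_right _ ?_) 1
    exact (by simp : _ ≤ (l i).length).trans (hP i).2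

theorem map {l : ∀ i, List (α i)} {ea : ∀ i, α i → Data} {g : ∀ i, α i → Data}
    (hl : PT x fun i => ofList ((l i).map (ea i)))
    (hg : PT (fun j : Σ i, {a // a ∈ l i} => Data.pair (x j.1) (ea j.1 j.2))
      fun j => g j.1 j.2) :
    PT x fun i => ofList ((l i).map (g i)) :=
  (flatMap (g := fun i a => [g i a]) hl (hg.cons nil)).congr fun i => by
    rw [← List.map_eq_flatMap]

theorem filter {l : ∀ i, List (α i)} {ea : ∀ i, α i → Data} {p : ∀ i, α i → Bool}
    (hl : PT x fun i => ofList ((l i).map (ea i)))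
    (hp : PT (fun j : Σ i, {a // a ∈ l i} => Data.pair (x j.1) (ea j.1 j.2))
      fun j => ofBool (p j.1 j.2)) :
    PT x fun i => ofList (((l i).filter (p i)).map (ea i)) := by
  refine (flatMap (g := fun i a => if p i a = true then [ea i a] else []) hl ?_).congr fun i => ?_
  · refine (ite' (c := fun j => p j.1 j.2 = true) hp.bool_eq_true
      (PT.cons (refl _).snd nil) nil).congr fun j => ?_
    split <;> rfl
  · congr 1
    induction l i with
    | nil => rfl
    | cons a l ih => by_cases h : p i a = true <;> simp [h, ih]

theorem any {l : ∀ i, List (α i)} {ea : ∀ i, α i → Data} {p : ∀ i, α i → Prop}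
    [∀ i, DecidablePred (p i)]
    (hl : PT x fun i => ofList ((l i).map (ea i)))
    (hp : PT (fun j : Σ i, {a // a ∈ l i} => Data.pair (x j.1) (ea j.1 j.2))
      fun j => ofBool (decide (p j.1 j.2))) {c : ι → Prop} [∀ i, Decidable (c i)]
    (hc : ∀ i, c i ↔ ∃ a ∈ l i, p i a) :
    PT x fun i => ofBool (decide (c i)) :=
  (filter (p := fun i a => decide (p i a)) hl hp).isNil.not.congr fun i => by
    have : c i ↔ ¬ ((l i).filter fun a => decide (p i a)).map (ea i) = [] := by
      simp [hc, List.filter_eq_nil_iff]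
    simp only [this]

theorem sum {l : ι → List ℕ} (hl : PT x fun i => ofList ((l i).map nat)) :
    PT x fun i => nat (l i).sum := by
  obtain ⟨P, hP⟩ := hl.size_le
  have key : ∀ l : List ℕ, (nat l.sum).size ≤ (ofList (l.map nat)).size := fun l => by
    induction l with
    | nil => simp [ofList]
    | cons a l ih =>
      have := size_add_le a l.sum
      simp only [List.map_cons, List.sum_cons, ofList, Data.size] at *
      omega
  refine (foldl (β := fun _ => ℕ) l (fun _ => nat) (fun _ => nat) (fun _ a b => a + b)
    (fun _ => 0) hl (nat_const 0) ?_ P fun i k _ => ?_).congr fun i => by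
      rw [← List.sum_eq_foldl]
  · exact add (refl _).snd.fst (refl _).snd.snd
  · rw [← List.sum_eq_foldl]
    refine (key _).trans ((size_ofList_sublist ?_).trans (hP i))
    exact (List.take_sublist _ _).map _

theorem size_nat_le {a b : ℕ} (h : a ≤ b) : (nat a).size ≤ (nat b).size := by
  have := Nat.size_le_size h
  simp only [Data.size]; omega

theorem size_nat_le_self (a : ℕ) : (nat a).size ≤ a + 1 := by
  have : Nat.size a ≤ a := Nat.size_le.2 Nat.lt_two_pow_self
  simp only [Data.size]; omega

theorem length {l : ι → List Data} (hl : PT x fun i => ofList (l i)) :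
    PT x fun i => nat (l i).length :=
  (sum (l := fun i => (l i).map fun _ => 1)
    ((map (α := fun _ => Data) (l := l) (ea := fun _ d => d) (g := fun _ _ => nat 1)
      (by simpa using hl) (nat_const 1)).congr fun i => by simp)).congr fun i => by simp

/-- The range is driven by an existing list: up to a number given in binary it could be
exponentially long. -/
theorem range {l : ι → List Data} (hl : PT x fun i => ofList (l i)) :
    PT x fun i => ofList ((List.range (l i).length).map nat) := by
  obtain ⟨P, hP⟩ := hl.size_le
  refine (foldlData (s := fun i k => ofList ((List.range k).map nat).reverse) hl
    (by simpa using nil) ?_ (P * (P + 1) + 1) fun i k hk => ?_).reverse.congr fun i => by simp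
  · refine (PT.cons (y := fun j : Σ i, Fin (l i).length => nat j.2)
      (l := fun j => ((List.range j.2).map nat).reverse) ?_ ?_).congr fun j => ?_
    · refine (PT.length (l := fun j : Σ i, Fin (l i).length => ((List.range j.2).map nat).reverse)
        ?_).congr fun j => by simp
      exact (refl _).snd.fst
    · exact (refl _).snd.fst
    · simp [List.range_succ]
  · have h1 := length_lt_size (l i)
    have h2 := hP i
    have h3 : k ≤ P.eval (x i).size := by omega
    refine (size_ofList_le (B := P.eval (x i).size) fun d hd => ?_).trans ?_
    · simp only [List.mem_reverse, List.mem_map, List.mem_range] at hd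
      obtain ⟨a, ha, rfl⟩ := hd
      have := size_nat_le_self a
      omega
    · simp only [List.length_reverse, List.length_map, List.length_range, Polynomial.eval_add,
        Polynomial.eval_mul, Polynomial.eval_one]
      exact Nat.add_le_add_right (Nat.mul_le_mul_right _ h3) 1

/-- The entry of a list at a computed position. -/
theorem getElem {l : ι → List Data} {k : ι → ℕ} (hl : PT x fun i => ofList (l i))
    (hk : PT x fun i => nat (k i)) (h : ∀ i, k i < (l i).length) :
    PT x fun i => (l i)[k i]'(h i) := by
  obtain ⟨P, hP⟩ := hl.size_le
  -- the state consists of a counter and the selected entry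
  refine snd (y := fun i => nat (l i).length) ?_
  refine (foldlData (s := fun i m => .pair (nat m) (if h' : k i < m then (l i)[k i]'(h i) else
    nat 0)) hl ?_ ?_ (P + P + 3) fun i m hm => ?_).congr fun i => by simp [h i]
  · exact ((nat_const 0).pair (nat_const 0)).congr fun i => by simp
  · have hm : PT (fun j : Σ i, Fin (l i).length => Data.pair (x j.1) (.pair (.pair (nat j.2)
      (if h' : k j.1 < j.2 then (l j.1)[k j.1]'(h j.1) else nat 0)) (l j.1)[j.2]))
        fun j => nat j.2 := (refl _).snd.fst.fst
    have hk' : PT (fun j : Σ i, Fin (l i).length => Data.pair (x j.1) (.pair (.pair (nat j.2)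
      (if h' : k j.1 < j.2 then (l j.1)[k j.1]'(h j.1) else nat 0)) (l j.1)[j.2]))
        fun j => nat (k j.1) := hk.weaken
    refine ((hm.add (nat_const 1)).pair (ite' (hm.nat_eq hk') (refl _).snd.snd
      (refl _).snd.fst.snd)).congr fun j => ?_
    congr 1
    rcases lt_trichotomy (k j.1) j.2 with h1 | h1 | h1
    · rw [if_neg (by omega), dif_pos h1, dif_pos (by omega)]
    · rw [if_pos h1.symm, dif_pos (by omega)]
      simp [h1]
    · rw [if_neg (by omega), dif_neg (by omega), dif_neg (by omega)]
  · have h1 := hP i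
    have h2 := length_lt_size (l i)
    have h3 := size_nat_le_self m
    have h4 : (if h' : k i < m then (l i)[k i]'(h i) else nat 0).size ≤ (ofList (l i)).size := by
      split
      · exact (size_le_ofList (List.getElem_mem _)).le
      · have := Data.size_pos (ofList (l i)); simp [Data.size]; omega
    simp only [Data.size.eq_2, Polynomial.eval_add, Polynomial.eval_ofNat]
    omega

/-- A fold over a list of bounded length needs no bound on the states. -/
theorem foldl_of_length_le (K : ℕ) (l : ∀ i, List (α i)) (ea : ∀ i, α i → Data)
    (eb : ∀ i, β i → Data) (f : ∀ i, β i → α i → β i) (b : ∀ i, β i)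
    (hl : PT x fun i => ofList ((l i).map (ea i))) (h0 : PT x fun i => eb i (b i))
    (hK : ∀ i, (l i).length ≤ K)
    (hs : PT (fun j : Σ i, β i × {a // a ∈ l i} => Data.pair (x j.1)
      (.pair (eb j.1 j.2.1) (ea j.1 j.2.2))) fun j => eb j.1 (f j.1 j.2.1 j.2.2)) :
    PT x fun i => eb i ((l i).foldl (f i) (b i)) := by
  obtain ⟨P, hP⟩ := hl.size_le
  obtain ⟨P0, h0'⟩ := h0.size_le
  obtain ⟨R, hR⟩ := hs.size_le
  -- Each further round composes the bound with `R`, so the degree may grow with `m`; this is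
  -- harmless because `K` does not depend on `i`.
  have key : ∀ m : ℕ, ∃ B : Polynomial ℕ, ∀ i, ∀ k ≤ m, k ≤ (l i).length →
      (eb i (((l i).take k).foldl (f i) (b i))).size ≤ B.eval (x i).size := by
    intro m
    induction m with
    | zero =>
      refine ⟨P0, fun i k hk _ => ?_⟩
      obtain rfl : k = 0 := by omega
      exact h0' i
    | succ m ih =>
      obtain ⟨B, hB⟩ := ih
      refine ⟨B + R.comp (Polynomial.X + B + P + 2), fun i k hk hkl => ?_⟩
      simp only [Polynomial.eval_add, Polynomial.eval_comp, Polynomial.eval_X,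
        Polynomial.eval_ofNat]
      rcases Nat.lt_or_ge m k with h | h
      · obtain rfl : k = m + 1 := by omega
        have h1 := hB i m le_rfl (by omega)
        have h2 := hR ⟨i, ((l i).take m).foldl (f i) (b i), (l i)[m], List.getElem_mem _⟩
        have h3 := size_le_ofList (List.mem_map_of_mem (f := ea i) (List.getElem_mem hkl))
        have h4 := hP i
        rw [← List.take_concat_get' _ _ hkl, List.foldl_append]
        refine h2.trans ((polynomial_eval_mono R ?_).trans (Nat.le_add_left _ _))
        simp only [Data.size]
        omega
      · have := hB i k h hkl
        omega
  obtain ⟨B, hB⟩ := key K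
  exact foldl l ea eb f b hl h0 (hs.reindex fun j : Σ i, Fin (l i).length =>
    ⟨j.1, ((l j.1).take j.2).foldl (f j.1) (b j.1), (l j.1)[j.2], List.getElem_mem _⟩) B
    fun i k hk => hB i k (hk.trans (hK i)) hk

end PT

end CVRP

/-! ### Loads, elements and how elements are merged. -/

namespace CVRP

/-! ### Splitting and merging loads -/

variable {n : ℕ}

/-- The total amount of a load. -/
def tot (u : Fin n → ℕ) : ℕ := ∑ v, u v

theorem tot_add (u v : Fin n → ℕ) : tot (u + v) = tot u + tot v := Finset.sum_add_distrib

theorem tot_zero : tot (0 : Fin n → ℕ) = 0 := by simp [tot]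

theorem tot_list_sum (l : List (Fin n → ℕ)) : tot l.sum = (l.map tot).sum := by
  induction l with
  | nil => exact tot_zero
  | cons a l ih => simp [tot_add, ih]

/-- The amount of a load at the vertices before position `k`. -/
def pre (l : Fin n → ℕ) (k : ℕ) : ℕ := ∑ w : Fin n, if (w : ℕ) < k then l w else 0

theorem pre_succ (l : Fin n → ℕ) (v : Fin n) : pre l (v + 1) = pre l v + l v := by
  have h : l v = ∑ w : Fin n, if w = v then l w else 0 := by simp
  rw [h, pre, pre, ← Finset.sum_add_distrib]
  refine Finset.sum_congr rfl fun w _ => ?_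
  have := @Fin.ext_iff _ w v
  by_cases h1 : w = v
  · simp [h1]
  · have : (w : ℕ) ≠ v := fun h => h1 (Fin.ext h)
    simp only [h1, if_false, Nat.add_zero]
    congr 1
    simp only [eq_iff_iff]
    omega

/-- The first `c` units of a load. -/
def fill (c : ℕ) (l : Fin n → ℕ) : Fin n → ℕ := fun v => min c (pre l (v + 1)) - min c (pre l v)

theorem fill_le (c : ℕ) (l : Fin n → ℕ) : fill c l ≤ l := fun v => by
  simp only [fill, pre_succ]
  omega

/-- The values of `fill` are the increments of the monotone function `k ↦ min c (pre l k)`, so their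
sum telescopes. -/
theorem tot_fill (c : ℕ) (l : Fin n → ℕ) : tot (fill c l) = min c (tot l) := by
  have hm : Monotone fun k => min c (pre l k) := fun a b h => by
    refine min_le_min le_rfl (Finset.sum_le_sum fun w _ => ?_)
    split_ifs <;> omega
  have h := Fin.sum_univ_eq_sum_range (fun k => min c (pre l (k + 1)) - min c (pre l k)) n
  rw [Finset.sum_range_tsub hm] at h
  refine h.trans ?_
  simp [pre, tot]

theorem fill_add_sub (c : ℕ) (l : Fin n → ℕ) : fill c l + (l - fill c l) = l :=
  add_tsub_cancel_of_le (fill_le c l)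

theorem tot_sub_fill (c : ℕ) (l : Fin n → ℕ) : tot (l - fill c l) = tot l - c := by
  have h := congrArg tot (fill_add_sub c l)
  rw [tot_add, tot_fill] at h
  omega

/-- The indicator of the loads that meet a set of vertices. -/
def meets (T : Finset (Fin n)) (u : Fin n → ℕ) : ℕ := if ∃ v ∈ T, u v ≠ 0 then 1 else 0

theorem meets_le_one (T : Finset (Fin n)) (u : Fin n → ℕ) : meets T u ≤ 1 := by
  unfold meets; split <;> omega

theorem meets_mono (T : Finset (Fin n)) {u v : Fin n → ℕ} (h : u ≤ v) :
    meets T u ≤ meets T v := by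
  unfold meets
  split_ifs with h1 h2 <;> try omega
  obtain ⟨w, hw, hu⟩ := h1
  exact absurd ⟨w, hw, fun h0 => hu (by have : u w ≤ v w := h w; omega)⟩ h2

theorem meets_add_le (T : Finset (Fin n)) (u v : Fin n → ℕ) :
    meets T (u + v) ≤ meets T u + meets T v := by
  unfold meets
  split_ifs with h1 h3 h2 h2 <;> try omega
  obtain ⟨w, hw, hu⟩ := h1
  refine absurd ⟨w, hw, fun h0 => ?_⟩ h3
  exact absurd ⟨w, hw, fun h0' => hu (by simp [h0, h0'])⟩ h2

theorem meets_sum_le (T : Finset (Fin n)) (l : List (Fin n → ℕ)) :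
    meets T l.sum ≤ (l.map (meets T)).sum := by
  induction l with
  | nil => simp [meets]
  | cons a l ih =>
    have := meets_add_le T a l.sum
    simp only [List.sum_cons, List.map_cons]
    omega

/-- One step in filling vehicles one after the other: the open vehicle with load `s.1` is topped up
from the load `l`, and the rest of `l` goes into a new open vehicle. -/
def chainStep (Q : ℕ) (s : (Fin n → ℕ) × List (Fin n → ℕ)) (l : Fin n → ℕ) :
    (Fin n → ℕ) × List (Fin n → ℕ) :=
  (l - fill (Q - tot s.1) l, (s.1 + fill (Q - tot s.1) l) :: s.2)

/-- Topping up the open vehicle to `Q` leaves `tot l - (Q - tot s.1)` of `l`, so the bound on the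
open load shrinks by the waste `Q - tot l` in every step. Here `W` is the waste accumulated so far;
as long as the total waste stays within `Q`, the truncated subtractions do no harm. Each `l` ends up
in at most two vehicles, which gives the factor 2, whereas the initial open load is never split. -/
theorem chain_spec (Q : ℕ) (T : Finset (Fin n)) (ls : List (Fin n → ℕ)) :
    ∀ (s : (Fin n → ℕ) × List (Fin n → ℕ)) (W : ℕ), W + (ls.map fun l => Q - tot l).sum ≤ Q →
      tot s.1 + W ≤ Q → (∀ l ∈ ls, tot l ≤ Q) → (∀ u ∈ s.2, tot u ≤ Q) →
      tot (ls.foldl (chainStep Q) s).1 + W + (ls.map fun l => Q - tot l).sum ≤ Q ∧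
      (∀ u ∈ (ls.foldl (chainStep Q) s).2, tot u ≤ Q) ∧
      (ls.foldl (chainStep Q) s).1 + (ls.foldl (chainStep Q) s).2.sum = s.1 + s.2.sum + ls.sum ∧
      (ls.foldl (chainStep Q) s).2.length = s.2.length + ls.length ∧
      meets T (ls.foldl (chainStep Q) s).1 + ((ls.foldl (chainStep Q) s).2.map (meets T)).sum ≤
        meets T s.1 + (s.2.map (meets T)).sum + 2 * (ls.map (meets T)).sum := by
  induction ls with
  | nil => intro s W h1 h2 _ h4; simp at *; exact ⟨h2, h4⟩
  | cons l ls ih =>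
    intro s W h1 h2 h3 h4
    simp only [List.map_cons, List.sum_cons] at h1
    have hl := h3 l (by simp)
    have e1 : tot (chainStep Q s l).1 = tot l - (Q - tot s.1) := tot_sub_fill _ _
    obtain ⟨i1, i2, i3, i4, i5⟩ := ih (chainStep Q s l) (W + (Q - tot l)) (by omega) (by omega)
      (fun l hl => h3 l (by simp [hl])) (fun u hu => by
        simp only [chainStep, List.mem_cons] at hu
        rcases hu with rfl | hu
        · rw [tot_add, tot_fill]; omega
        · exact h4 u hu)
    simp only [List.foldl_cons, List.map_cons, List.sum_cons, List.length_cons]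
    refine ⟨by omega, i2, ?_, ?_, ?_⟩
    · rw [i3]
      have := fill_add_sub (Q - tot s.1) l
      simp only [chainStep, List.sum_cons]
      rw [show s.1 + s.2.sum + (l + ls.sum) = s.1 + s.2.sum + (fill (Q - tot s.1) l +
        (l - fill (Q - tot s.1) l) + ls.sum) by rw [this]]
      generalize l - fill (Q - tot s.1) l = a
      abel
    · rw [i4]; simp only [chainStep, List.length_cons]; omega
    · have m1 := meets_add_le T s.1 (fill (Q - tot s.1) l)
      have m2 := meets_mono T (fill_le (Q - tot s.1) l)
      have m3 := meets_mono T (show l - fill (Q - tot s.1) l ≤ l from tsub_le_self)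
      simp only [chainStep, List.map_cons, List.sum_cons] at i5
      simp only [chainStep] at i5 ⊢
      omega

/-! ### Elements -/

/-- A set of vehicles in three alternative packings of the same demand. In each packing one vehicle
is open, with at most `x` units of load; a leaf is a single vehicle whose load may still be split. -/
structure Elem (n : ℕ) : Type where
  leaf : Bool
  x : ℕ
  opn : Fin 3 → Fin n → ℕ
  cls : Fin 3 → List (Fin n → ℕ)

namespace Elem

/-- The demand that is covered. -/
def cov (e : Elem n) : Fin n → ℕ := e.opn 0 + (e.cls 0).sum

/-- The number of full vehicles that the demand needs besides the open one. -/
def full (Q : ℕ) (e : Elem n) : ℕ := (tot e.cov - e.x) / Q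

/-- The number of vehicles in the three packings. -/
def count (e : Elem n) : ℕ := ∑ t, ((e.cls t).length + 1)

/-- The number of vehicles of a packing that meet `T`. -/
def num (T : Finset (Fin n)) (t : Fin 3) (e : Elem n) : ℕ :=
  meets T (e.opn t) + ((e.cls t).map (meets T)).sum

/-- The potential: a leaf may be split in one of the three packings. -/
def pot (T : Finset (Fin n)) (e : Elem n) : ℕ :=
  if e.leaf then 4 * meets T e.cov else ∑ t, e.num T t

/-- The invariant of the algorithm. By `total` the demand is `full * Q + x` exactly, although the
vehicles of a single packing need not be full. In `comp_case` the bound on `count` is what limits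
the potential by `4 * (full + 1)`. The bound `Q < 2 * x` says that a composite wastes less than half
a vehicle; it carries itself through merges of two elements. -/
structure Valid (Q : ℕ) (e : Elem n) : Prop where
  x_pos : 0 < e.x
  x_le : e.x ≤ Q
  opn_le : ∀ t, tot (e.opn t) ≤ e.x
  cls_le : ∀ t, ∀ u ∈ e.cls t, tot u ≤ Q
  cov_eq : ∀ t, e.opn t + (e.cls t).sum = e.cov
  total : tot e.cov = e.full Q * Q + e.x
  leaf_case : e.leaf = true → e.full Q = 0 ∧ ∀ t, e.cls t = []
  comp_case : e.leaf = false → 1 ≤ e.full Q ∧ e.count ≤ 4 * e.full Q + 2 ∧ Q < 2 * e.x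

/-- The unused capacity of the open vehicle. -/
def waste (Q : ℕ) (e : Elem n) : ℕ := Q - e.x

end Elem

open Elem

/-- The number of packings in which merging saves a vehicle. -/
def savings (A : List (Elem n)) : ℕ :=
  6 - (A.filter (·.leaf)).length - 2 * (A.filter (!·.leaf)).length

/-- The elements in the order in which packing `t` fills vehicles from them: the first two elements
are not split. -/
def mergeOrder (A : List (Elem n)) (t : ℕ) : List (Elem n) :=
  A.filter (!·.leaf) ++ ((A.filter (·.leaf)).drop (t * (A.length - 2)) ++
    (A.filter (·.leaf)).take (t * (A.length - 2)))

/-- The open vehicle and the closed vehicles after filling vehicles in the given order. -/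
def chain (Q : ℕ) (t : Fin 3) (c : List (Fin n → ℕ)) :
    List (Elem n) → (Fin n → ℕ) × List (Fin n → ℕ)
  | p :: q :: l => (((l.map (·.opn t)).foldl (chainStep Q) (p.opn t, c)).1 + q.opn t,
      ((l.map (·.opn t)).foldl (chainStep Q) (p.opn t, c)).2)
  | _ => (0, c)

/-- All open vehicles but the first are closed. -/
def unify (t : Fin 3) (c : List (Fin n → ℕ)) : List (Elem n) → (Fin n → ℕ) × List (Fin n → ℕ)
  | e :: l => (e.opn t, c ++ l.map (·.opn t))
  | [] => (0, c)

/-- The first `savings A` packings save a vehicle at the price of splitting loads; the others split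
nothing and save nothing. -/
def mergeMode (Q : ℕ) (A : List (Elem n)) (t : Fin 3) : (Fin n → ℕ) × List (Fin n → ℕ) :=
  if (t : ℕ) < savings A then chain Q t (A.flatMap (·.cls t)) (mergeOrder A t)
  else unify t (A.flatMap (·.cls t)) A

/-- Elements whose open vehicles waste the capacity of a whole vehicle are merged into one. -/
def merge (Q : ℕ) (A : List (Elem n)) : Elem n where
  leaf := decide (A.length = 2 ∧ A.filter (!·.leaf) = [])
  x := (A.map (·.x)).sum - (A.length - 2) * Q
  opn t := (mergeMode Q A t).1
  cls t := (mergeMode Q A t).2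

theorem filter_append_filter_perm (A : List (Elem n)) :
    (A.filter (!·.leaf) ++ A.filter (·.leaf)).Perm A := by
  have := List.filter_append_perm (fun e : Elem n => !e.leaf) A
  simpa using this

theorem mergeOrder_perm (A : List (Elem n)) (t : ℕ) : (mergeOrder A t).Perm A := by
  refine List.Perm.trans (List.Perm.append_left _ ?_) (filter_append_filter_perm A)
  refine List.perm_append_comm.trans ?_
  rw [List.take_append_drop]

/-- A chain splits everything behind the first two positions. Composites come first, and the leaves
are rotated by the number of split positions from one packing to the next, so different packings
split different leaves. A positive saving leaves only finitely many shapes of `C` and `L`, which are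
checked one by one. -/
theorem savings_split_le (C L : List (Elem n)) (g : Elem n → ℕ) :
    (∑ t : Fin 3, if (t : ℕ) < 6 - L.length - 2 * C.length then
      (((C ++ (L.drop (t * (C.length + L.length - 2)) ++
        L.take (t * (C.length + L.length - 2)))).drop 2).map g).sum else 0) ≤ (L.map g).sum := by
  by_cases h : L.length + 2 * C.length < 6
  swap
  · refine (Finset.sum_eq_zero fun t _ => if_neg (by omega)).trans_le (Nat.zero_le _)
  rw [Fin.sum_univ_three]
  rcases C with _ | ⟨c1, _ | ⟨c2, _ | ⟨c3, C⟩⟩⟩ <;>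
  rcases L with _ | ⟨a, _ | ⟨b, _ | ⟨c, _ | ⟨d, _ | ⟨e, _ | ⟨f, L⟩⟩⟩⟩⟩⟩ <;>
  simp at h ⊢ <;> omega

end CVRP

/-! ### Merging a minimal list that wastes a whole vehicle preserves all invariants. -/

namespace CVRP

open Elem

variable {n : ℕ}

theorem sum_flatMap_eq {α M : Type*} [AddCommMonoid M] (A : List α) (f : α → List M) :
    (A.flatMap f).sum = (A.map fun a => (f a).sum).sum := by
  induction A with
  | nil => rfl
  | cons a A ih => simp [ih]

theorem sum_map_add_eq {α M : Type*} [AddCommMonoid M] (A : List α) (f g : α → M) :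
    (A.map fun a => f a + g a).sum = (A.map f).sum + (A.map g).sum := by
  induction A with
  | nil => simp
  | cons a A ih => simp only [List.map_cons, List.sum_cons, ih]; abel

theorem sum_map_flatMap_eq {α β M : Type*} [AddCommMonoid M] (A : List α) (f : α → List β)
    (g : β → M) : ((A.flatMap f).map g).sum = (A.map fun a => ((f a).map g).sum).sum := by
  rw [List.map_flatMap, sum_flatMap_eq]

theorem sum_map_le {α : Type*} {A : List α} {f g : α → ℕ} (h : ∀ a ∈ A, f a ≤ g a) :
    (A.map f).sum ≤ (A.map g).sum := List.sum_le_sum h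

theorem sum_map_congr {α M : Type*} [AddMonoid M] {A : List α} {f g : α → M}
    (h : ∀ a ∈ A, f a = g a) : (A.map f).sum = (A.map g).sum := by
  rw [List.map_congr_left h]

theorem sum_map_fin3 {α : Type*} (A : List α) (f : Fin 3 → α → ℕ) :
    ∑ t, (A.map (f t)).sum = (A.map fun a => ∑ t, f t a).sum := by
  simp only [Fin.sum_univ_three, ← sum_map_add_eq]

/-- The total unused capacity. -/
def wasteSum (Q : ℕ) (A : List (Elem n)) : ℕ := (A.map (waste Q)).sum

theorem wasteSum_cons (Q : ℕ) (e : Elem n) (A : List (Elem n)) :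
    wasteSum Q (e :: A) = e.waste Q + wasteSum Q A := by simp [wasteSum]

theorem wasteSum_append (Q : ℕ) (A B : List (Elem n)) :
    wasteSum Q (A ++ B) = wasteSum Q A + wasteSum Q B := by simp [wasteSum]

theorem wasteSum_perm (Q : ℕ) {A B : List (Elem n)} (h : A.Perm B) :
    wasteSum Q A = wasteSum Q B := (h.map _).sum_eq

variable {Q : ℕ}

theorem Elem.Valid.opn_eq {e : Elem n} (h : e.Valid Q) (hl : e.leaf = true) (t : Fin 3) :
    e.opn t = e.cov := by
  have := h.cov_eq t
  rwa [(h.leaf_case hl).2 t, List.sum_nil, add_zero] at this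

theorem Elem.Valid.tot_leaf {e : Elem n} (h : e.Valid Q) (hl : e.leaf = true) :
    tot e.cov = e.x := by
  have := h.total
  rw [(h.leaf_case hl).1] at this
  omega

theorem Elem.Valid.waste_add {e : Elem n} (h : e.Valid Q) : e.waste Q + e.x = Q := by
  have := h.x_le
  simp only [waste]; omega

/-- A minimal list of elements that waste the capacity of a whole vehicle. -/
structure Mergeable (Q : ℕ) (A : List (Elem n)) : Prop where
  pos : 0 < Q
  valid : ∀ e ∈ A, e.Valid Q
  le : Q ≤ wasteSum Q A
  lt : ∀ e ∈ A, wasteSum Q A < Q + e.waste Q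

namespace Mergeable

variable {A : List (Elem n)}

theorem two_le (h : Mergeable Q A) : 2 ≤ A.length := by
  rcases A with _ | ⟨a, _ | ⟨b, A⟩⟩
  · have h1 := h.le
    have h2 := h.pos
    simp only [wasteSum, List.map_nil, List.sum_nil] at h1
    omega
  · have h1 := h.le
    have h2 := (h.valid a (by simp)).waste_add
    have h3 := (h.valid a (by simp)).x_pos
    simp only [wasteSum, List.map_cons, List.map_nil, List.sum_cons, List.sum_nil] at h1
    omega
  · simp

theorem wasteSum_lt (h : Mergeable Q A) : wasteSum Q A < 2 * Q := by
  obtain ⟨e, he⟩ := List.exists_mem_of_length_pos (by have := h.two_le; omega : 0 < A.length)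
  have h1 := h.lt e he
  have h2 := (h.valid e he).waste_add
  omega

theorem sum_x_add (h : ∀ e ∈ A, e.Valid Q) : (A.map (·.x)).sum + wasteSum Q A = A.length * Q := by
  rw [wasteSum, ← sum_map_add_eq, List.map_congr_left (g := fun _ => Q), List.map_const',
    List.sum_replicate, smul_eq_mul]
  intro e he
  have := (h e he).waste_add
  omega

/-- The open loads of `m + 2` elements may total `(m + 2) * Q - wasteSum Q A`, and `m` full vehicles
absorb `m * Q` of it. Equivalently, merging lowers the total waste by exactly `Q`. -/
theorem merge_x_add (h : Mergeable Q A) : (merge Q A).x + wasteSum Q A = 2 * Q := by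
  have h1 := sum_x_add h.valid
  have h2 := h.wasteSum_lt
  obtain ⟨m, hm⟩ := Nat.exists_eq_add_of_le h.two_le
  simp only [merge]
  rw [hm] at h1 ⊢
  rw [Nat.add_mul] at h1
  rw [Nat.add_sub_cancel_left]
  omega

theorem filter_length (A : List (Elem n)) :
    (A.filter (!·.leaf)).length + (A.filter (·.leaf)).length = A.length := by
  have := (filter_append_filter_perm A).length_eq
  rwa [List.length_append] at this

/-- A saving is possible only with at most two composites. They stand at the front, so all elements
that the chain splits are leaves. -/
theorem exists_mergeOrder (h : Mergeable Q A) {t : ℕ} (ht : t < savings A) :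
    ∃ p q l, mergeOrder A t = p :: q :: l ∧ ∀ e ∈ l, e.leaf = true := by
  have h1 := filter_length A
  have h2 := h.two_le
  have hC : (A.filter (!·.leaf)).length ≤ 2 := by
    unfold savings at ht; omega
  have hl : (mergeOrder A t).length = A.length := (mergeOrder_perm A t).length_eq
  obtain ⟨p, o1, ho1⟩ := List.exists_cons_of_length_pos (l := mergeOrder A t) (by omega)
  obtain ⟨q, o2, ho2⟩ := List.exists_cons_of_length_pos (l := o1) (by
    rw [ho1, List.length_cons] at hl; omega)
  refine ⟨p, q, o2, by rw [ho1, ho2], fun e he => ?_⟩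
  have h3 : o2 = (mergeOrder A t).drop 2 := by rw [ho1, ho2]; rfl
  rw [h3, mergeOrder, List.drop_append, List.drop_eq_nil_of_le hC, List.nil_append] at he
  have h4 := List.mem_of_mem_drop he
  rw [List.mem_append] at h4
  have h5 : e ∈ A.filter (·.leaf) := h4.elim List.mem_of_mem_drop List.mem_of_mem_take
  exact (List.mem_filter.1 h5).2

/-- What packing `t` of the merged element looks like. -/
structure ModeSpec (Q : ℕ) (A : List (Elem n)) (t : Fin 3)
    (r : (Fin n → ℕ) × List (Fin n → ℕ)) : Prop where
  tot_le : tot r.1 + wasteSum Q A ≤ 2 * Q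
  cls_le : ∀ u ∈ r.2, tot u ≤ Q
  cov_eq : r.1 + r.2.sum = (A.map cov).sum
  length_eq : r.2.length + 1 + (if (t : ℕ) < savings A then 1 else 0) =
    (A.map fun e => (e.cls t).length + 1).sum
  meets_le : ∀ T, meets T r.1 + (r.2.map (meets T)).sum ≤ (A.map (num T t)).sum +
    if (t : ℕ) < savings A then
      (((mergeOrder A t).drop 2).map fun e => meets T e.cov).sum else 0

theorem unify_spec (h : Mergeable Q A) {t : Fin 3} (ht : ¬ (t : ℕ) < savings A) :
    ModeSpec Q A t (unify t (A.flatMap (·.cls t)) A) := by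
  obtain ⟨a, B, rfl⟩ := List.exists_cons_of_length_pos (l := A) (by have := h.two_le; omega)
  have ha := h.valid a (by simp)
  refine ⟨?_, ?_, ?_, ?_, ?_⟩
  -- By minimality `a` wastes more than `wasteSum Q A - Q`, so its open vehicle already obeys the
  -- bound `2 * Q - wasteSum Q A` of the merged element.
  · have h1 := h.lt a (by simp)
    have h2 := ha.opn_le t
    have h3 := ha.waste_add
    simp only [unify]
    omega
  · intro u hu
    simp only [unify, List.mem_append, List.mem_flatMap, List.mem_map] at hu
    rcases hu with ⟨e, he, hu⟩ | ⟨e, he, rfl⟩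
    · exact (h.valid e he).cls_le t u hu
    · exact ((h.valid e (by simp [he])).opn_le t).trans (h.valid e (by simp [he])).x_le
  · rw [sum_map_congr fun e he => ((h.valid e he).cov_eq t).symm, sum_map_add_eq]
    simp only [unify, List.sum_append, sum_flatMap_eq, List.map_cons, List.sum_cons]
    abel
  · rw [if_neg ht, sum_map_add_eq]
    simp only [unify, List.length_append, List.length_flatMap, List.length_map, List.map_const',
      List.sum_replicate, List.length_cons, smul_eq_mul]
    omega
  · intro T
    rw [if_neg ht]
    have : num T t = fun e : Elem n => meets T (e.opn t) + ((e.cls t).map (meets T)).sum := rfl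
    rw [this, sum_map_add_eq]
    simp only [unify, List.map_append, List.sum_append, sum_map_flatMap_eq, List.map_cons,
      List.sum_cons, List.map_map, Function.comp_def]
    omega

/-- The chain starts with `p` and runs through the leaves `l`. By minimality the elements other than
`q` waste less than `Q`, so `chain_spec` applies with `W` the waste of `p`. The open vehicle that
remains has room for the unsplit open load of `q`, because all elements together waste at least `Q`.
One closed vehicle arises per element of `l`, one vehicle fewer than without merging. -/
theorem chain_mode_spec (h : Mergeable Q A) {t : Fin 3} (ht : (t : ℕ) < savings A) :
    ModeSpec Q A t (chain Q t (A.flatMap (·.cls t)) (mergeOrder A t)) := by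
  obtain ⟨p, q, l, ho, hl⟩ := h.exists_mergeOrder ht
  have hperm := mergeOrder_perm A t
  have hmem : ∀ e ∈ p :: q :: l, e ∈ A := fun e he => hperm.mem_iff.1 (by rwa [ho])
  have hlen := hperm.length_eq
  have hsum : ∀ {M : Type} [AddCommMonoid M] (f : Elem n → M),
      (A.map f).sum = f p + (f q + (l.map f).sum) := fun f => by
    rw [← (hperm.map f).sum_eq, ho]; simp
  have hW : wasteSum Q A = p.waste Q + (q.waste Q + wasteSum Q l) := hsum _
  have hp := h.valid p (hmem p (by simp))
  have hq := h.valid q (hmem q (by simp))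
  have hlv : ∀ e ∈ l, e.Valid Q := fun e he => h.valid e (hmem e (by simp [he]))
  have hle : ∀ e ∈ l, e.opn t = e.cov := fun e he => (hlv e he).opn_eq (hl e he) t
  have hls : ((l.map (·.opn t)).map fun u => Q - tot u).sum = wasteSum Q l := by
    rw [List.map_map]
    refine sum_map_congr fun e he => ?_
    simp only [Function.comp, hle e he, (hlv e he).tot_leaf (hl e he), waste]
  rw [ho]
  simp only [chain]
  have hs := fun T => chain_spec Q T (l.map (·.opn t)) (p.opn t, A.flatMap (·.cls t)) (p.waste Q)
    (by
      rw [hls]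
      have h1 := h.lt q (hmem q (by simp))
      omega)
    (by
      have h1 := hp.opn_le t
      have h2 := hp.waste_add
      dsimp only
      omega)
    (by
      intro u hu
      obtain ⟨e, he, rfl⟩ := List.mem_map.1 hu
      exact ((hlv e he).opn_le t).trans (hlv e he).x_le)
    (by
      intro u hu
      obtain ⟨e, he, hu⟩ := List.mem_flatMap.1 hu
      exact (h.valid e he).cls_le t u hu)
  rw [hls] at hs
  generalize (l.map (·.opn t)).foldl (chainStep Q) (p.opn t, A.flatMap (·.cls t)) = r at hs ⊢
  obtain ⟨h1, h2, h3, h4, -⟩ := hs ∅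
  refine ⟨?_, h2, ?_, ?_, ?_⟩
  · have h5 := hq.opn_le t
    have h6 := hq.waste_add
    rw [tot_add]
    omega
  · rw [sum_map_congr fun e he => ((h.valid e he).cov_eq t).symm, sum_map_add_eq,
      hsum fun e => e.opn t]
    dsimp only at h3 ⊢
    rw [sum_flatMap_eq] at h3
    rw [add_right_comm, h3]
    abel
  · rw [if_pos ht, sum_map_add_eq]
    simp only [List.length_flatMap, List.length_map] at h4
    rw [ho, List.length_cons, List.length_cons] at hlen
    simp only [List.map_const', List.sum_replicate, smul_eq_mul]
    omega
  · intro T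
    obtain ⟨-, -, -, -, h5⟩ := hs T
    have h6 := meets_add_le T r.1 (q.opn t)
    have e1 : (A.map (num T t)).sum = (A.map fun e => meets T (e.opn t)).sum +
      (A.map fun e => ((e.cls t).map (meets T)).sum).sum := sum_map_add_eq _ _ _
    rw [hsum fun e => meets T (e.opn t)] at e1
    have e2 : ((l.map (·.opn t)).map (meets T)).sum = (l.map fun e => meets T e.cov).sum := by
      rw [List.map_map]
      exact sum_map_congr fun e he => by simp only [Function.comp, hle e he]
    have e3 : (l.map fun e => meets T (e.opn t)).sum = (l.map fun e => meets T e.cov).sum :=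
      sum_map_congr fun e he => by rw [hle e he]
    rw [if_pos ht, e1, ho]
    rw [sum_map_flatMap_eq, e2] at h5
    simp only [List.drop_succ_cons, List.drop_zero]
    dsimp only at h5 ⊢
    omega

theorem mode_spec (h : Mergeable Q A) (t : Fin 3) : ModeSpec Q A t (mergeMode Q A t) := by
  unfold mergeMode
  split_ifs with ht
  · exact h.chain_mode_spec ht
  · exact h.unify_spec ht

theorem cov_merge (h : Mergeable Q A) : (merge Q A).cov = (A.map cov).sum := (h.mode_spec 0).cov_eq

theorem tot_cov (h : Mergeable Q A) : tot (merge Q A).cov =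
    ((A.map (full Q)).sum + (A.length - 2)) * Q + (merge Q A).x := by
  have h1 : (A.map x).sum + wasteSum Q A = A.length * Q := sum_x_add h.valid
  have h2 := h.merge_x_add
  obtain ⟨m, hm⟩ := Nat.exists_eq_add_of_le h.two_le
  rw [h.cov_merge, tot_list_sum, List.map_map,
    sum_map_congr (f := tot ∘ cov) fun e he => (h.valid e he).total, sum_map_add_eq, List.sum_map_mul_right]
  rw [hm] at h1 ⊢
  rw [Nat.add_mul] at h1
  rw [Nat.add_sub_cancel_left, Nat.add_mul]
  omega

theorem full_merge (h : Mergeable Q A) :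
    (merge Q A).full Q = (A.map (full Q)).sum + (A.length - 2) := by
  rw [full, h.tot_cov, Nat.add_sub_cancel, Nat.mul_div_cancel _ h.pos]

theorem count_merge (h : Mergeable Q A) :
    (merge Q A).count + (∑ t : Fin 3, if (t : ℕ) < savings A then 1 else 0) =
      (A.map count).sum := by
  have : (A.map count).sum = _ := (sum_map_fin3 A fun t e => (e.cls t).length + 1).symm
  rw [this, count, ← Finset.sum_add_distrib]
  exact Finset.sum_congr rfl fun t _ => (h.mode_spec t).length_eq

theorem sum_indicator_lt (k : ℕ) :
    (∑ t : Fin 3, if (t : ℕ) < k then 1 else 0) = min k 3 := by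
  rw [Fin.sum_univ_three]
  rcases k with _ | _ | _ | k <;> simp

/-- A split leaf is met by at most one additional vehicle, and by `savings_split_le` each leaf is
split in at most one of the three packings. -/
theorem num_merge (h : Mergeable Q A) (T : Finset (Fin n)) :
    ∑ t, (merge Q A).num T t ≤ (A.map fun e => ∑ t, e.num T t).sum +
      ((A.filter (·.leaf)).map fun e => meets T e.cov).sum := by
  rw [← sum_map_fin3]
  refine (Finset.sum_le_sum fun t _ => (h.mode_spec t).meets_le T).trans ?_
  rw [Finset.sum_add_distrib]
  refine Nat.add_le_add_left ?_ _
  have h1 := savings_split_le (A.filter (!·.leaf)) (A.filter (·.leaf)) fun e => meets T e.cov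
  rw [filter_length] at h1
  exact h1

/-- A leaf that meets `T` has potential 4: three units for its vehicle in the three packings, one
for its possible split. If two leaves merge into a leaf, subadditivity of `meets` suffices. -/
theorem pot_merge (h : Mergeable Q A) (T : Finset (Fin n)) :
    (merge Q A).pot T ≤ (A.map (pot T)).sum := by
  by_cases hl : (merge Q A).leaf = true
  · have hl' : A.filter (!·.leaf) = [] := by
      simp only [merge, decide_eq_true_eq] at hl; exact hl.2
    have h1 := meets_sum_le T (A.map cov)
    rw [← h.cov_merge, List.map_map] at h1
    have h2 : (A.map (pot T)).sum = (A.map fun e => 4 * meets T e.cov).sum :=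
      sum_map_congr fun e he => by
        have := List.filter_eq_nil_iff.1 hl' e he
        simp only [Bool.not_eq_true', Bool.not_eq_false] at this
        rw [pot, if_pos this]
    rw [h2, List.sum_map_mul_left, pot, if_pos hl]
    exact Nat.mul_le_mul_left _ h1
  · have h1 := h.num_merge T
    rw [pot, if_neg hl]
    refine h1.trans ?_
    have h2 : ((A.filter (·.leaf)).map fun e => meets T e.cov).sum =
        (A.map fun e => if e.leaf then meets T e.cov else 0).sum := by
      clear h h1 hl
      induction A with
      | nil => rfl
      | cons a A ih => by_cases ha : a.leaf = true <;> simp [ha, ih]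
    rw [h2, ← sum_map_add_eq]
    refine sum_map_le fun e he => ?_
    by_cases hle : e.leaf = true
    · have h3 := (h.valid e he).opn_eq hle
      have h4 := ((h.valid e he).leaf_case hle).2
      simp only [pot, hle, if_true, num, h3, h4, Fin.sum_univ_three, List.map_nil, List.sum_nil]
      omega
    · simp [pot, hle]

/-- Two leaves that waste `Q` together fit into one vehicle and form a leaf again; every other merge
yields a composite, with at least one full vehicle. -/
theorem valid_merge (h : Mergeable Q A) : (merge Q A).Valid Q := by
  have hx := h.merge_x_add
  have hlt := h.wasteSum_lt
  have hle := h.le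
  have h2 := h.two_le
  have hf := h.full_merge
  have hfl := filter_length A
  refine ⟨by omega, by omega, fun t => ?_, fun t => (h.mode_spec t).cls_le, fun t => ?_,
    hf ▸ h.tot_cov, fun hl => ?_, fun hl => ?_⟩
  · have : tot ((merge Q A).opn t) + wasteSum Q A ≤ 2 * Q := (h.mode_spec t).tot_le
    omega
  · rw [h.cov_merge]; exact (h.mode_spec t).cov_eq
  · simp only [merge, decide_eq_true_eq] at hl
    have hleaf : ∀ e ∈ A, e.leaf = true := fun e he => by
      simpa using List.filter_eq_nil_iff.1 hl.2 e he
    have hs : savings A = 4 := by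
      rw [hl.2, List.length_nil, hl.1] at hfl
      simp only [savings, hl.2, List.length_nil]
      omega
    refine ⟨?_, fun t => ?_⟩
    · rw [hf, sum_map_congr fun e he => ((h.valid e he).leaf_case (hleaf e he)).1]
      simp [hl.1]
    · have h3 := (h.mode_spec t).length_eq
      rw [sum_map_congr (g := fun _ => 1) fun e he => by
        rw [((h.valid e he).leaf_case (hleaf e he)).2 t]; rfl, hs] at h3
      simp only [List.map_const', List.sum_replicate, smul_eq_mul, hl.1] at h3
      rw [if_pos (by omega)] at h3
      exact List.length_eq_zero_iff.1 (show (mergeMode Q A t).2.length = 0 by omega)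
  · simp only [merge, decide_eq_false_iff_not, not_and] at hl
    have hcomp : A.length = 2 → ∃ e ∈ A, e.leaf = false := fun h3 => by
      have := hl h3
      rw [List.filter_eq_nil_iff] at this
      push Not at this
      obtain ⟨e, he, h4⟩ := this
      exact ⟨e, he, by simpa using h4⟩
    refine ⟨?_, ?_, ?_⟩
    · rw [hf]
      by_cases h3 : A.length = 2
      · obtain ⟨e, he, h4⟩ := hcomp h3
        have h5 := ((h.valid e he).comp_case h4).1
        have h6 := List.single_le_sum (l := A.map (full Q)) (fun _ _ => Nat.zero_le _) _
          (List.mem_map_of_mem (f := full Q) he)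
        omega
      · omega
    -- With `L` leaves and `C` composites the old counts are at most `4 * (sum of full) + 3 * L + 2
    -- * C`, and the merge raises `full` by `L + C - 2`. The bound `4 * full + 2` thus requires
    -- exactly `6 - L - 2 * C` savings. Only for two leaves would this exceed the three packings,
    -- and that case is excluded by `hne`.
    · have hc := h.count_merge
      have hA : (A.map count).sum ≤ 4 * (A.map (full Q)).sum +
          (3 * (A.filter (·.leaf)).length + 2 * (A.filter (!·.leaf)).length) := by
        have hv := h.valid
        clear h hx hlt hle h2 hf hfl hl hcomp hc
        induction A with
        | nil => simp
        | cons a A ih =>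
          have := ih fun e he => hv e (by simp [he])
          by_cases ha : a.leaf = true
          · have h1 := (hv a (by simp)).leaf_case ha
            have h3 : a.count = 3 := by simp [count, h1.2]
            simp only [List.map_cons, List.sum_cons, List.filter_cons, ha, if_true,
              List.length_cons, h3, h1.1, Bool.not_true, Bool.false_eq_true, if_false]
            omega
          · have h1 := ((hv a (by simp)).comp_case (by simpa using ha)).2.1
            simp only [List.map_cons, List.sum_cons, List.filter_cons, ha, if_true,
              List.length_cons, Bool.not_false, Bool.false_eq_true, if_false]
            omega
      rw [hf]
      rw [sum_indicator_lt] at hc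
      have hne : A.length = 2 → (A.filter (!·.leaf)).length ≠ 0 := fun h3 h4 =>
        hl h3 (List.length_eq_zero_iff.1 h4)
      unfold savings at hc
      omega
    · by_cases h3 : A.length = 2
      -- The composite `e` wastes less than `Q / 2`, so by minimality the total waste is below `3 *
      -- Q / 2`.
      · obtain ⟨e, he, h4⟩ := hcomp h3
        have h5 := ((h.valid e he).comp_case h4).2.2
        have h6 := h.lt e he
        have h7 := (h.valid e he).waste_add
        omega
      · rcases A with _ | ⟨a, _ | ⟨b, _ | ⟨c, A⟩⟩⟩
        · simp at h2
        · simp at h2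
        · simp at h3
        -- Adding the three minimality inequalities gives `3 * wasteSum < 3 * Q + wasteSum`, so the
        -- total waste is again below `3 * Q / 2`.
        · have ha := h.lt a (by simp)
          have hb := h.lt b (by simp)
          have hc := h.lt c (by simp)
          simp only [wasteSum_cons] at *
          omega

end Mergeable

end CVRP

/-! ### Packing the elements at a vertex and moving them along the tree. -/

namespace CVRP

open Elem

variable {n : ℕ} {Q : ℕ}

/-! ### Packing a list of elements -/

/-- Drop an element if the others still waste the capacity of a vehicle. -/
def pruneStep (Q : ℕ) (s : ℕ × List (Elem n) × List (Elem n)) (e : Elem n) :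
    ℕ × List (Elem n) × List (Elem n) :=
  if Q ≤ s.1 - e.waste Q then (s.1 - e.waste Q, s.2.1, e :: s.2.2) else (s.1, e :: s.2.1, s.2.2)

def prune (Q : ℕ) (A : List (Elem n)) : ℕ × List (Elem n) × List (Elem n) :=
  A.foldl (pruneStep Q) (wasteSum Q A, [], [])

/-- One greedy pass suffices for minimality: the total `s.1` of kept and unseen elements only
decreases, so an element that could not be dropped when it was seen cannot be dropped later either.
-/
theorem foldl_pruneStep_spec (A : List (Elem n)) : ∀ s : ℕ × List (Elem n) × List (Elem n),
    s.1 = wasteSum Q s.2.1 + wasteSum Q A → Q ≤ s.1 → (∀ e ∈ s.2.1, s.1 < Q + e.waste Q) →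
    let r := A.foldl (pruneStep Q) s
    (r.2.1 ++ r.2.2).Perm (s.2.1 ++ s.2.2 ++ A) ∧ Q ≤ wasteSum Q r.2.1 ∧
      ∀ e ∈ r.2.1, wasteSum Q r.2.1 < Q + e.waste Q := by
  induction A with
  | nil =>
    intro s h1 h2 h3
    simp only [wasteSum, List.map_nil, List.sum_nil, add_zero] at h1
    simp only [List.foldl_nil, List.append_nil]
    exact ⟨List.Perm.refl _, by rw [wasteSum, ← h1]; exact h2,
      fun e he => by rw [wasteSum, ← h1]; exact h3 e he⟩
  | cons a A ih =>
    rintro ⟨W, k, d⟩ h1 h2 h3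
    simp only [wasteSum_cons] at h1 h2 h3
    by_cases h : Q ≤ W - a.waste Q
    · have e : pruneStep Q (W, k, d) a = (W - a.waste Q, k, a :: d) := if_pos h
      rw [List.foldl_cons, e]
      obtain ⟨i1, i2⟩ := ih (W - a.waste Q, k, a :: d) (by dsimp only; omega) h
        (fun e he => by have := h3 e he; dsimp only; omega)
      refine ⟨i1.trans ?_, i2⟩
      simp only [List.append_assoc, List.cons_append]
      refine List.Perm.append_left _ ?_
      exact List.perm_middle.symm
    · have e : pruneStep Q (W, k, d) a = (W, a :: k, d) := if_neg h
      rw [List.foldl_cons, e]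
      obtain ⟨i1, i2⟩ := ih (W, a :: k, d) (by simp only [wasteSum_cons]; omega) h2
        (fun e he => by
          rcases List.mem_cons.1 he with rfl | he
          · dsimp only; omega
          · exact h3 e he)
      refine ⟨i1.trans ?_, i2⟩
      exact (List.perm_middle (l₁ := k ++ d) (l₂ := A) (a := a)).symm

theorem prune_spec {A : List (Elem n)} (h : Q ≤ wasteSum Q A) :
    ((prune Q A).2.1 ++ (prune Q A).2.2).Perm A ∧ Q ≤ wasteSum Q (prune Q A).2.1 ∧
      ∀ e ∈ (prune Q A).2.1, wasteSum Q (prune Q A).2.1 < Q + e.waste Q := by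
  have := foldl_pruneStep_spec (Q := Q) A (wasteSum Q A, [], []) (by simp [wasteSum]) h (by simp)
  simp only [List.nil_append] at this
  exact this

/-- Add an element to a packed list. -/
def insert (Q : ℕ) (B : List (Elem n)) (z : Elem n) : List (Elem n) :=
  if wasteSum Q (z :: B) < Q then z :: B
  else merge Q (prune Q (z :: B)).2.1 :: (prune Q (z :: B)).2.2

/-- A list of elements that waste less than the capacity of a vehicle. -/
structure Packed (Q : ℕ) (B : List (Elem n)) : Prop where
  valid : ∀ e ∈ B, e.Valid Q
  lt : wasteSum Q B < Q

/-- `B` covers the same demand as `A` and is no worse. -/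
structure Improves (B A : List (Elem n)) : Prop where
  cov : (B.map cov).sum = (A.map cov).sum
  count : (B.map count).sum ≤ (A.map count).sum
  pot : ∀ T, (B.map (pot T)).sum ≤ (A.map (pot T)).sum

theorem Improves.refl (A : List (Elem n)) : Improves A A := ⟨rfl, le_rfl, fun _ => le_rfl⟩

theorem Improves.of_perm {A B : List (Elem n)} (h : B.Perm A) : Improves B A :=
  ⟨(h.map _).sum_eq, (h.map _).sum_eq.le, fun _ => (h.map _).sum_eq.le⟩

theorem Improves.trans {A B C : List (Elem n)} (h1 : Improves C B) (h2 : Improves B A) :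
    Improves C A :=
  ⟨h1.cov.trans h2.cov, h1.count.trans h2.count, fun T => (h1.pot T).trans (h2.pot T)⟩

theorem Improves.append {A B A' B' : List (Elem n)} (h1 : Improves B A) (h2 : Improves B' A') :
    Improves (B ++ B') (A ++ A') := by
  refine ⟨?_, ?_, fun T => ?_⟩ <;> rw [List.map_append, List.map_append, List.sum_append,
    List.sum_append]
  · rw [h1.cov, h2.cov]
  · exact Nat.add_le_add h1.count h2.count
  · exact Nat.add_le_add (h1.pot T) (h2.pot T)

/-- One merge is enough: `B` and `z` each waste less than `Q`, and the merge removes exactly `Q`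
from the total. -/
theorem insert_spec (hQ : 0 < Q) {B : List (Elem n)} (hB : Packed Q B) {z : Elem n}
    (hz : z.Valid Q) : Packed Q (insert Q B z) ∧ Improves (insert Q B z) (z :: B) := by
  have hv : ∀ e ∈ z :: B, e.Valid Q := fun e he => by
    rcases List.mem_cons.1 he with rfl | he
    exacts [hz, hB.valid e he]
  unfold insert
  split_ifs with h
  · exact ⟨⟨hv, h⟩, Improves.refl _⟩
  · obtain ⟨h1, h2, h3⟩ := prune_spec (Nat.le_of_not_lt h)
    set K := (prune Q (z :: B)).2.1
    set D := (prune Q (z :: B)).2.2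
    have hm : Mergeable Q K :=
      ⟨hQ, fun e he => hv e (h1.mem_iff.1 (List.mem_append_left _ he)), h2, h3⟩
    have hw := wasteSum_perm Q h1
    rw [wasteSum_append, wasteSum_cons] at hw
    have hx := hm.merge_x_add
    have hmv := hm.valid_merge
    have h4 := hmv.waste_add
    have h5 := hB.lt
    have h6 := hz.waste_add
    have h7 := hz.x_pos
    refine ⟨⟨fun e he => ?_, ?_⟩, Improves.trans ?_ (Improves.of_perm h1)⟩
    · rcases List.mem_cons.1 he with rfl | he
      exacts [hmv, hv e (h1.mem_iff.1 (List.mem_append_right _ he))]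
    · rw [wasteSum_cons]; omega
    · refine Improves.append (B := [merge Q K]) ⟨?_, ?_, fun T => ?_⟩ (Improves.refl _)
      · simpa using hm.cov_merge
      · have := hm.count_merge
        simp only [List.map_cons, List.map_nil, List.sum_cons, List.sum_nil]
        omega
      · simpa using hm.pot_merge T

def pack (Q : ℕ) (A : List (Elem n)) : List (Elem n) := A.foldl (insert Q) []

theorem pack_spec (hQ : 0 < Q) {A : List (Elem n)} (hA : ∀ e ∈ A, e.Valid Q) :
    Packed Q (pack Q A) ∧ Improves (pack Q A) A := by
  have key : ∀ (A B : List (Elem n)), (∀ e ∈ A, e.Valid Q) → Packed Q B →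
      Packed Q (A.foldl (insert Q) B) ∧ Improves (A.foldl (insert Q) B) (B ++ A) := by
    intro A
    induction A with
    | nil => intro B _ hB; exact ⟨hB, by simpa using Improves.refl B⟩
    | cons a A ih =>
      intro B hA hB
      obtain ⟨h1, h2⟩ := insert_spec hQ hB (hA a (by simp))
      obtain ⟨h3, h4⟩ := ih _ (fun e he => hA e (by simp [he])) h1
      refine ⟨h3, h4.trans ((h2.append (Improves.refl A)).trans (Improves.of_perm ?_))⟩
      exact List.perm_middle.symm
  have := key A [] hA ⟨by simp, by simpa [wasteSum] using hQ⟩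
  simpa [pack] using this

/-- Take for `N` the sum of `full + 1`. Demand plus waste equals `N * Q`, and the waste is below
`Q`, which makes `N` the rounded-up quotient. A leaf has potential at most 4, a composite at most
`count ≤ 4 * full + 2`; both are within `4 * (full + 1)`. -/
theorem Packed.pot_le {B : List (Elem n)} (hB : Packed Q B) (T : Finset (Fin n)) :
    ∃ N, (B.map (pot T)).sum ≤ 4 * N ∧ tot (B.map cov).sum ≤ N * Q ∧
      N * Q < tot (B.map cov).sum + Q := by
  have h1 : tot (B.map cov).sum + wasteSum Q B = (B.map fun e => e.full Q + 1).sum * Q := by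
    have h2 : (B.map x).sum + wasteSum Q B = B.length * Q := Mergeable.sum_x_add hB.valid
    rw [tot_list_sum, List.map_map,
      sum_map_congr (f := tot ∘ cov) fun e he => (hB.valid e he).total, sum_map_add_eq,
      List.sum_map_mul_right, sum_map_add_eq, Nat.add_mul]
    simp only [List.map_const', List.sum_replicate, smul_eq_mul, mul_one]
    omega
  have h2 := hB.lt
  refine ⟨(B.map fun e => e.full Q + 1).sum, ?_, by omega, by omega⟩
  rw [← List.sum_map_mul_left]
  refine sum_map_le fun e he => ?_
  have hv := hB.valid e he
  by_cases hl : e.leaf = true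
  · rw [pot, if_pos hl]
    have := meets_le_one T e.cov
    omega
  · have h3 := (hv.comp_case (by simpa using hl)).2.1
    rw [pot, if_neg hl]
    have h4 : ∑ t, e.num T t ≤ e.count := Finset.sum_le_sum fun t _ => by
      have h5 := meets_le_one T (e.opn t)
      have h6 : ((e.cls t).map (meets T)).sum ≤ ((e.cls t).map fun _ => 1).sum :=
        sum_map_le fun u _ => meets_le_one T u
      simp only [List.map_const', List.sum_replicate, smul_eq_mul, mul_one] at h6
      simp only [num]
      omega
    omega

theorem Elem.Valid.pot_eq_zero {e : Elem n} (h : e.Valid Q) {T : Finset (Fin n)}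
    (hT : ∀ v ∈ T, e.cov v = 0) : e.pot T = 0 := by
  have h0 : meets T e.cov = 0 := if_neg fun ⟨v, hv, hne⟩ => hne (hT v hv)
  unfold pot
  split_ifs
  · rw [h0]
  · refine Finset.sum_eq_zero fun t _ => ?_
    have h1 := h.cov_eq t
    have h2 : meets T (e.opn t) ≤ 0 := h0 ▸ meets_mono T (h1 ▸ le_self_add)
    have h3 : ((e.cls t).map (meets T)).sum = 0 := by
      refine List.sum_eq_zero fun k hk => ?_
      obtain ⟨u, hu, rfl⟩ := List.mem_map.1 hk
      have h4 : u ≤ (e.cls t).sum := List.single_le_sum (fun _ _ => bot_le) _ hu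
      exact Nat.le_zero.1 (h0 ▸ meets_mono T (h4.trans (h1 ▸ le_add_self)))
    simp only [num]
    omega

/-! ### Sweeping a tree from the leaves to the depot -/

/-- The elements at a vertex. -/
def at_ (v : Fin n) (S : List (Fin n × Elem n)) : List (Elem n) :=
  (S.filter fun s => decide (s.1 = v)).map Prod.snd

/-- Pack the elements at `v` and move them to `p`. -/
def move (Q : ℕ) (S : List (Fin n × Elem n)) (v p : Fin n) : List (Fin n × Elem n) :=
  (pack Q (at_ v S)).map (fun e => (p, e)) ++ S.filter fun s => !decide (s.1 = v)

/-- The elements at the vertices cover the part of the demand `d` that `anc` assigns to them. -/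
structure Located (Q : ℕ) (d : Fin n → ℕ) (S : List (Fin n × Elem n)) (anc : Fin n → Fin n) :
    Prop where
  valid : ∀ s ∈ S, s.2.Valid Q
  cov : ∀ u, ((at_ u S).map Elem.cov).sum = fun w => if anc w = u then d w else 0

theorem perm_at_append (v : Fin n) (S : List (Fin n × Elem n)) :
    (at_ v S ++ (S.filter fun s => !decide (s.1 = v)).map Prod.snd).Perm (S.map Prod.snd) := by
  rw [at_, ← List.map_append]
  exact (List.filter_append_perm _ S).map _

theorem mem_at {v : Fin n} {S : List (Fin n × Elem n)} {e : Elem n} :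
    e ∈ at_ v S ↔ (v, e) ∈ S := by
  simp [at_]

theorem move_improves (hQ : 0 < Q) {S : List (Fin n × Elem n)} (hS : ∀ s ∈ S, s.2.Valid Q)
    (v p : Fin n) : Improves ((move Q S v p).map Prod.snd) (S.map Prod.snd) := by
  refine Improves.trans ?_ (Improves.of_perm (perm_at_append v S))
  rw [move, List.map_append, List.map_map]
  refine Improves.append ?_ (Improves.refl _)
  have : (Prod.snd ∘ fun e : Elem n => (p, e)) = id := rfl
  rw [this, List.map_id]
  exact (pack_spec hQ fun e he => hS _ (mem_at.1 he)).2

theorem move_valid (hQ : 0 < Q) {S : List (Fin n × Elem n)} (hS : ∀ s ∈ S, s.2.Valid Q)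
    (v p : Fin n) : ∀ s ∈ move Q S v p, s.2.Valid Q := by
  intro s hs
  rw [move, List.mem_append, List.mem_map] at hs
  rcases hs with ⟨e, he, rfl⟩ | hs
  · exact (pack_spec hQ fun e he => hS _ (mem_at.1 he)).1.valid e he
  · exact hS s (List.mem_of_mem_filter hs)

theorem at_move (Q : ℕ) (S : List (Fin n × Elem n)) {v p : Fin n} (hp : p ≠ v) (u : Fin n) :
    at_ u (move Q S v p) =
      (if u = p then pack Q (at_ v S) else []) ++ (if u = v then [] else at_ u S) := by
  rw [at_, move, List.filter_append, List.map_append]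
  congr 1
  · by_cases h : u = p
    · subst h; simp [List.filter_map, Function.comp_def]
    · have h' : ¬ p = u := fun h' => h h'.symm
      simp [List.filter_map, Function.comp_def, h, h']
  · rw [List.filter_filter]
    by_cases h : u = v
    · subst h; simp
    · simp only [h, if_false, at_]
      congr 1
      refine List.filter_congr fun s _ => ?_
      by_cases h1 : s.1 = u <;> simp [h1, h]

theorem Located.moved (hQ : 0 < Q) {d : Fin n → ℕ} {S : List (Fin n × Elem n)}
    {anc : Fin n → Fin n} (h : Located Q d S anc) {v p : Fin n} (hp : p ≠ v) :
    Located Q d (move Q S v p) fun w => if anc w = v then p else anc w := by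
  refine ⟨move_valid hQ h.valid v p, fun u => ?_⟩
  have hpk := (pack_spec hQ fun e he => h.valid _ (mem_at.1 he) : _ ∧ Improves (pack Q (at_ v S)) _).2
  rw [at_move Q S hp, List.map_append, List.sum_append]
  by_cases hu : u = p
  · subst hu
    rw [if_pos rfl, if_neg hp, hpk.cov, h.cov, h.cov]
    funext w
    by_cases h1 : anc w = v
    · simp [h1, hp.symm]
    · simp [h1]
  · rw [if_neg hu]
    by_cases hv : u = v
    · subst hv
      funext w
      by_cases h1 : anc w = u <;> simp [h1, hp]
    · rw [if_neg hv, h.cov]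
      funext w
      have hu' : ¬ p = u := fun h' => hu h'.symm
      by_cases h1 : anc w = v
      · have hv' : ¬ v = u := fun h' => hv h'.symm
        simp [h1, hu', hv']
      · simp [h1]

/-- When a vertex is left, the potential of the demand that was there is bounded. -/
theorem Located.pot_move (hQ : 0 < Q) {d : Fin n → ℕ} {S : List (Fin n × Elem n)}
    {anc : Fin n → Fin n} (h : Located Q d S anc) {v p : Fin n} (T : Finset (Fin n))
    (hT : ∀ w, anc w = v ↔ w ∈ T) :
    ∃ N, ((move Q S v p).map fun s => s.2.pot T).sum ≤ 4 * N ∧ ∑ w ∈ T, d w ≤ N * Q ∧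
      N * Q < ∑ w ∈ T, d w + Q := by
  have hpk := pack_spec hQ fun e he => h.valid _ (mem_at (v := v) (S := S).1 he)
  obtain ⟨N, h1, h2, h3⟩ := hpk.1.pot_le T
  have hd : tot ((pack Q (at_ v S)).map Elem.cov).sum = ∑ w ∈ T, d w := by
    rw [hpk.2.cov, h.cov, tot]
    simp only [hT]
    rw [Finset.sum_ite_mem, Finset.univ_inter]
  rw [hd] at h2 h3
  refine ⟨N, ?_, h2, h3⟩
  rw [move, List.map_append, List.sum_append, List.map_map]
  -- All demand of `T` is located at `v`, so elements elsewhere do not meet `T`.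
  have h0 : ((S.filter fun s => !decide (s.1 = v)).map fun s => s.2.pot T).sum = 0 := by
    refine List.sum_eq_zero fun k hk => ?_
    obtain ⟨⟨u, e⟩, hs, rfl⟩ := List.mem_map.1 hk
    obtain ⟨hs, hne⟩ := List.mem_filter.1 hs
    refine (h.valid _ hs).pot_eq_zero fun w hw => ?_
    have h4 : e.cov ≤ ((at_ u S).map Elem.cov).sum :=
      List.single_le_sum (fun _ _ => bot_le) _ (List.mem_map_of_mem (mem_at.2 hs))
    have h5 : e.cov w ≤ _ := h4 w
    rw [h.cov] at h5
    simp only [(hT w).2 hw] at h5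
    have hne' : ¬ v = u := fun h' => by simp [h'] at hne
    rw [if_neg hne'] at h5
    exact Nat.le_zero.1 h5
  rw [h0, add_zero]
  exact h1

end CVRP

/-! ### Paths to the depot, parents and subtrees. -/

namespace CVRP

namespace Inst

variable (I : Inst)

theorem path_isPath (u v : Fin I.n) : (I.path u v).IsPath :=
  (I.isTree.existsUnique_path u v).choose_spec.1

variable {I}

theorem eq_path {u v : Fin I.n} {p : I.G.Walk u v} (hp : p.IsPath) : p = I.path u v :=
  (I.isTree.existsUnique_path u v).choose_spec.2 p hp

/-- The vertices on the path to the depot. -/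
noncomputable def stem (I : Inst) (v : Fin I.n) : List (Fin I.n) := (I.path v I.depot).support

theorem path_cons {u v : Fin I.n} (h : I.G.Adj u v) (hu : u ∉ I.stem v) :
    I.path u I.depot = .cons h (I.path v I.depot) :=
  (eq_path ((I.path_isPath v I.depot).cons hu)).symm

theorem stem_cons {u v : Fin I.n} (h : I.G.Adj u v) (hu : u ∉ I.stem v) :
    I.stem u = u :: I.stem v := by
  rw [stem, path_cons h hu, SimpleGraph.Walk.support_cons, stem]

theorem path_depot : I.path I.depot I.depot = .nil := (eq_path SimpleGraph.Walk.IsPath.nil).symm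

theorem stem_depot : I.stem I.depot = [I.depot] := by
  rw [stem, path_depot, SimpleGraph.Walk.support_nil]

theorem parent_depot : I.parent I.depot = I.depot := by
  rw [parent, path_depot]; rfl

theorem exists_path_eq {v : Fin I.n} (hv : v ≠ I.depot) :
    ∃ h : I.G.Adj v (I.parent v), I.path v I.depot = .cons h (I.path (I.parent v) I.depot) := by
  have hp := I.path_isPath v I.depot
  rw [parent]
  generalize hq : I.path v I.depot = q at hp
  cases q with
  | nil => exact absurd rfl hv
  | cons h p =>
    rw [SimpleGraph.Walk.snd_cons]
    refine ⟨h, ?_⟩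
    rw [← eq_path (SimpleGraph.Walk.IsPath.of_cons hp)]

theorem adj_parent {v : Fin I.n} (hv : v ≠ I.depot) : I.G.Adj v (I.parent v) :=
  (exists_path_eq hv).1

theorem stem_eq {v : Fin I.n} (hv : v ≠ I.depot) : I.stem v = v :: I.stem (I.parent v) := by
  obtain ⟨h, e⟩ := exists_path_eq hv
  rw [stem, e, SimpleGraph.Walk.support_cons, stem]

theorem stem_head (v : Fin I.n) : ∃ t, I.stem v = v :: t :=
  ⟨_, (SimpleGraph.Walk.cons_tail_support _).symm⟩

theorem stem_injective : Function.Injective I.stem := fun u v h => by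
  obtain ⟨s, hs⟩ := stem_head u
  obtain ⟨t, ht⟩ := stem_head v
  rw [hs, ht] at h
  exact (List.cons.inj h).1

theorem mem_stem_self (v : Fin I.n) : v ∈ I.stem v := SimpleGraph.Walk.start_mem_support _

theorem stem_length_le (v : Fin I.n) : (I.stem v).length ≤ I.n := by
  have := (I.path_isPath v I.depot).length_lt
  rw [Fintype.card_fin] at this
  rw [stem, SimpleGraph.Walk.length_support]
  exact this

theorem stem_nodup (v : Fin I.n) : (I.stem v).Nodup := (I.path_isPath v I.depot).support_nodup

theorem stem_length_parent {v : Fin I.n} (hv : v ≠ I.depot) :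
    (I.stem v).length = (I.stem (I.parent v)).length + 1 := by
  rw [stem_eq hv, List.length_cons]

/-- Induction along the path to the depot. -/
theorem parent_induction {P : Fin I.n → Prop} (h0 : P I.depot)
    (h1 : ∀ v, v ≠ I.depot → P (I.parent v) → P v) (v : Fin I.n) : P v := by
  induction hk : (I.stem v).length generalizing v with
  | zero =>
    obtain ⟨t, ht⟩ := stem_head v
    simp [ht] at hk
  | succ k ih =>
    by_cases hv : v = I.depot
    · exact hv ▸ h0
    · exact h1 v hv (ih _ (by have := stem_length_parent hv; omega))

theorem mem_stem_iff {v w : Fin I.n} : v ∈ I.stem w ↔ ∃ k, I.parent^[k] w = v := by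
  induction w using parent_induction (I := I) with
  | h0 =>
    have : ∀ k, I.parent^[k] I.depot = I.depot := fun k => Function.iterate_fixed parent_depot k
    simp [stem_depot, this, eq_comm]
  | h1 w hw ih =>
    rw [stem_eq hw, List.mem_cons, ih]
    constructor
    · rintro (rfl | ⟨k, hk⟩)
      exacts [⟨0, rfl⟩, ⟨k + 1, by rwa [Function.iterate_succ_apply]⟩]
    · rintro ⟨_ | k, hk⟩
      exacts [Or.inl hk.symm, Or.inr ⟨k, by rwa [Function.iterate_succ_apply] at hk⟩]

theorem mem_subtree {v w : Fin I.n} : w ∈ I.subtree v ↔ v ∈ I.stem w := by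
  simp [subtree, stem]

theorem mem_subtree_iff {v w : Fin I.n} : w ∈ I.subtree v ↔ ∃ k, I.parent^[k] w = v :=
  mem_subtree.trans mem_stem_iff

theorem mem_subtree_self (v : Fin I.n) : v ∈ I.subtree v := mem_subtree.2 (mem_stem_self v)

theorem stem_length_iterate (w : Fin I.n) (k : ℕ) (h : I.parent^[k] w ≠ I.depot) :
    (I.stem w).length = (I.stem (I.parent^[k] w)).length + k := by
  induction k with
  | zero => rfl
  | succ k ih =>
    rw [Function.iterate_succ_apply'] at h ⊢
    have h1 : I.parent^[k] w ≠ I.depot := fun h2 => h (by rw [h2, parent_depot])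
    rw [ih h1, stem_length_parent h1]
    omega

/-! ### Listing the paths to the depot -/

open Classical in
/-- The extensions of a path to the depot by one edge at its other end. -/
noncomputable def ext (I : Inst) : List (Fin I.n) → List (List (Fin I.n))
  | [] => []
  | v :: t => ((List.finRange I.n).filter fun u => decide (I.G.Adj v u ∧ u ∉ v :: t)).map
      fun u => u :: v :: t

noncomputable def pathsUpTo (I : Inst) : ℕ → List (List (Fin I.n))
  | 0 => []
  | k + 1 => [I.depot] :: (I.pathsUpTo k).flatMap I.ext

/-- All paths to the depot, ordered by length. -/
noncomputable def paths (I : Inst) : List (List (Fin I.n)) := I.pathsUpTo I.n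

theorem mem_ext {l l' : List (Fin I.n)} {v : Fin I.n} (hl : l = I.stem v) :
    l' ∈ I.ext l ↔ ∃ u, I.G.Adj v u ∧ u ∉ I.stem v ∧ l' = u :: l := by
  obtain ⟨t, ht⟩ := stem_head v
  rw [hl, ht]
  simp only [ext, List.mem_map, List.mem_filter, List.mem_finRange, true_and, decide_eq_true_eq]
  constructor
  · rintro ⟨u, ⟨h1, h2⟩, rfl⟩; exact ⟨u, h1, h2, rfl⟩
  · rintro ⟨u, h1, h2, rfl⟩; exact ⟨u, ⟨h1, h2⟩, rfl⟩

theorem ext_eq {l l' : List (Fin I.n)} (h : l' ∈ I.ext l) : ∃ u, l' = u :: l := by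
  cases l with
  | nil => simp [ext] at h
  | cons v t =>
    simp only [ext, List.mem_map] at h
    obtain ⟨u, -, rfl⟩ := h
    exact ⟨u, rfl⟩

theorem mem_pathsUpTo {k : ℕ} {l : List (Fin I.n)} :
    l ∈ I.pathsUpTo k ↔ ∃ v, (I.stem v).length ≤ k ∧ l = I.stem v := by
  induction k generalizing l with
  | zero =>
    simp only [pathsUpTo, List.not_mem_nil, false_iff, not_exists]
    rintro v ⟨h, -⟩
    obtain ⟨t, ht⟩ := stem_head v
    simp [ht] at h
  | succ k ih =>
    rw [pathsUpTo, List.mem_cons, List.mem_flatMap]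
    constructor
    · rintro (rfl | ⟨l', h1, h2⟩)
      · exact ⟨I.depot, by simp [stem_depot]⟩
      · obtain ⟨v, hv, rfl⟩ := ih.1 h1
        obtain ⟨u, h3, h4, rfl⟩ := (mem_ext rfl).1 h2
        have := stem_cons h3.symm h4
        exact ⟨u, by rw [this, List.length_cons]; omega, this.symm⟩
    · rintro ⟨v, hv, rfl⟩
      by_cases h : v = I.depot
      · exact Or.inl (by rw [h, stem_depot])
      · have h1 := stem_length_parent h
        refine Or.inr ⟨_, ih.2 ⟨I.parent v, by omega, rfl⟩, (mem_ext rfl).2 ⟨v, (adj_parent h).symm,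
          ?_, stem_eq h⟩⟩
        have h2 := I.stem_nodup v
        rw [stem_eq h] at h2
        exact (List.nodup_cons.1 h2).1

theorem mem_paths (v : Fin I.n) : I.stem v ∈ I.paths := mem_pathsUpTo.2 ⟨v, stem_length_le v, rfl⟩

theorem eq_stem_of_mem {l : List (Fin I.n)} (h : l ∈ I.paths) : ∃ v, l = I.stem v :=
  (mem_pathsUpTo.1 h).imp fun _ h => h.2

theorem nodup_pathsUpTo (k : ℕ) : (I.pathsUpTo k).Nodup := by
  induction k with
  | zero => simp [pathsUpTo]
  | succ k ih =>
    rw [pathsUpTo, List.nodup_cons, List.nodup_flatMap]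
    refine ⟨fun h => ?_, fun l _ => ?_, ih.imp fun {a b} hab => ?_⟩
    · obtain ⟨l', h1, h2⟩ := List.mem_flatMap.1 h
      obtain ⟨u, hu⟩ := ext_eq h2
      obtain ⟨v, -, rfl⟩ := mem_pathsUpTo.1 h1
      obtain ⟨t, ht⟩ := stem_head v
      simp [ht] at hu
    · cases l with
      | nil => simp [ext]
      | cons v t =>
        exact ((List.nodup_finRange _).filter _).map fun a b hab => (List.cons.inj hab).1
    · intro l h1 h2
      obtain ⟨u, rfl⟩ := ext_eq h1
      obtain ⟨v, h3⟩ := ext_eq h2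
      exact hab (List.cons.inj h3).2

/-- In a tree each vertex contributes only one path, which keeps the enumeration polynomial. -/
theorem length_pathsUpTo (k : ℕ) : (I.pathsUpTo k).length ≤ I.n := by
  classical
  rw [← List.toFinset_card_of_nodup (nodup_pathsUpTo k)]
  have : (I.pathsUpTo k).toFinset ⊆ Finset.univ.image I.stem := fun l hl => by
    obtain ⟨v, -, rfl⟩ := mem_pathsUpTo.1 (List.mem_toFinset.1 hl)
    exact Finset.mem_image_of_mem _ (Finset.mem_univ v)
  refine (Finset.card_le_card this).trans (Finset.card_image_le.trans ?_)
  simp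

/-- A parent has a shorter path than its child. Read forwards the list handles parents first, as
tours need it; read backwards it handles children first, as the sweep needs it. -/
theorem pairwise_pathsUpTo (k : ℕ) :
    (I.pathsUpTo k).Pairwise fun a b => a.length ≤ b.length := by
  induction k with
  | zero => simp [pathsUpTo]
  | succ k ih =>
    rw [pathsUpTo, List.pairwise_cons, List.pairwise_flatMap]
    refine ⟨fun l hl => ?_, fun l _ => ?_, ih.imp fun {a b} hab => ?_⟩
    · obtain ⟨l', -, h2⟩ := List.mem_flatMap.1 hl
      obtain ⟨u, rfl⟩ := ext_eq h2
      simp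
    · refine List.Pairwise.imp_of_mem (R := fun _ _ => True) (fun {a b} h1 h2 _ => ?_)
        (List.pairwise_of_forall fun _ _ => trivial)
      obtain ⟨u, rfl⟩ := ext_eq h1
      obtain ⟨v, rfl⟩ := ext_eq h2
      simp
    · intro l h1 l' h2
      obtain ⟨u, rfl⟩ := ext_eq h1
      obtain ⟨v, rfl⟩ := ext_eq h2
      simpa using hab

end Inst

end CVRP

/-! ### The sweep of the remaining demand and its potential. -/

namespace CVRP

open Elem

namespace Inst

variable {I : Inst}

/-- The demand of a vertex that remains after vehicles that serve only this vertex. -/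
def rem (I : Inst) (v : Fin I.n) : ℕ := I.demand v % I.Q

/-- The element for the remaining demand of a vertex. -/
def leafElem (I : Inst) (v : Fin I.n) : Elem I.n where
  leaf := true
  x := I.rem v
  opn _ := Pi.single v (I.rem v)
  cls _ := []

/-- The elements at the start of the sweep. -/
def start (I : Inst) : List (Fin I.n × Elem I.n) :=
  ((List.finRange I.n).filter fun v => !decide (I.rem v = 0)).map fun v => (v, I.leafElem v)

/-- Leave the first vertex of a path towards the second one. -/
def sweepStep (I : Inst) (S : List (Fin I.n × Elem I.n)) :
    List (Fin I.n) → List (Fin I.n × Elem I.n)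
  | v :: p :: _ => move I.Q S v p
  | _ => S

/-- The elements that arrive at the depot. -/
noncomputable def sweep (I : Inst) : List (Fin I.n × Elem I.n) :=
  I.paths.reverse.foldl I.sweepStep I.start

theorem tot_single {n : ℕ} (v : Fin n) (k : ℕ) : tot (Pi.single v k) = k := by
  simp [tot, Finset.sum_pi_single']

theorem leafElem_cov (v : Fin I.n) : (I.leafElem v).cov = Pi.single v (I.rem v) := by
  simp [Elem.cov, leafElem]

theorem leafElem_valid {v : Fin I.n} (hv : I.rem v ≠ 0) : (I.leafElem v).Valid I.Q := by
  have hlt : I.rem v < I.Q := Nat.mod_lt _ I.Q_pos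
  have hf : (I.leafElem v).full I.Q = 0 := by
    rw [Elem.full, leafElem_cov, tot_single]
    simp [leafElem]
  refine ⟨Nat.pos_of_ne_zero hv, hlt.le, fun t => (tot_single _ _).le, fun t u hu => ?_,
    fun t => ?_, ?_, fun _ => ⟨hf, fun _ => rfl⟩, fun h => ?_⟩
  · simp [leafElem] at hu
  · rw [leafElem_cov]; simp [leafElem]
  · rw [hf, leafElem_cov, tot_single]; simp [leafElem]
  · simp [leafElem] at h

theorem start_valid : ∀ s ∈ I.start, s.2.Valid I.Q := by
  intro s hs
  simp only [start, List.mem_map, List.mem_filter] at hs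
  obtain ⟨v, ⟨-, hv⟩, rfl⟩ := hs
  exact leafElem_valid (by simpa using hv)

theorem at_start (u : Fin I.n) : at_ u I.start = if I.rem u = 0 then [] else [I.leafElem u] := by
  have h1 : (List.finRange I.n).filter (fun v => decide (v = u)) = [u] := by
    rw [List.filter_eq, List.count_eq_one_of_mem (List.nodup_finRange _) (List.mem_finRange _)]
    rfl
  rw [at_, start, List.filter_map, List.map_map, List.filter_filter]
  have h2 : (List.finRange I.n).filter (fun v => ((fun s : Fin I.n × Elem I.n => decide (s.1 = u)) ∘
      fun v => (v, I.leafElem v)) v && !decide (I.rem v = 0)) =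
      ((List.finRange I.n).filter fun v => decide (v = u)).filter fun v =>
        !decide (I.rem v = 0) := by
    rw [List.filter_filter]
    exact List.filter_congr fun v _ => by simp [Bool.and_comm]
  rw [h2, h1]
  by_cases h : I.rem u = 0 <;> simp [h]

theorem start_located : Located I.Q I.rem I.start id := by
  refine ⟨start_valid, fun u => ?_⟩
  rw [at_start]
  funext w
  by_cases h : I.rem u = 0
  · simp only [h, if_true, List.map_nil, List.sum_nil, Pi.zero_apply, id]
    split_ifs with h1
    · rw [h1, h]
    · rfl
  · simp only [h, if_false, List.map_cons, List.map_nil, List.sum_cons, List.sum_nil, add_zero,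
      leafElem_cov, id, Pi.single_apply]
    split_ifs with h1
    · rw [h1]
    · rfl

theorem sweepStep_stem {v : Fin I.n} (hv : v ≠ I.depot) (S : List (Fin I.n × Elem I.n)) :
    I.sweepStep S (I.stem v) = move I.Q S v (I.parent v) := by
  obtain ⟨t, ht⟩ := stem_head (I.parent v)
  rw [stem_eq hv, ht, sweepStep]

theorem sweepStep_depot (S : List (Fin I.n × Elem I.n)) : I.sweepStep S (I.stem I.depot) = S := by
  rw [stem_depot, sweepStep]
  simp

theorem sweepStep_valid {S : List (Fin I.n × Elem I.n)} (hS : ∀ s ∈ S, s.2.Valid I.Q)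
    (l : List (Fin I.n)) : ∀ s ∈ I.sweepStep S l, s.2.Valid I.Q := by
  rcases l with _ | ⟨v, _ | ⟨p, t⟩⟩
  exacts [hS, hS, move_valid I.Q_pos hS v p]

theorem sweepStep_improves {S : List (Fin I.n × Elem I.n)} (hS : ∀ s ∈ S, s.2.Valid I.Q)
    (l : List (Fin I.n)) : Improves ((I.sweepStep S l).map Prod.snd) (S.map Prod.snd) := by
  rcases l with _ | ⟨v, _ | ⟨p, t⟩⟩
  exacts [Improves.refl _, Improves.refl _, move_improves I.Q_pos hS v p]

theorem foldl_sweepStep_spec (o : List (List (Fin I.n))) :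
    ∀ S : List (Fin I.n × Elem I.n), (∀ s ∈ S, s.2.Valid I.Q) →
      (∀ s ∈ o.foldl I.sweepStep S, s.2.Valid I.Q) ∧
        Improves ((o.foldl I.sweepStep S).map Prod.snd) (S.map Prod.snd) := by
  induction o with
  | nil => exact fun S hS => ⟨hS, Improves.refl _⟩
  | cons l o ih =>
    intro S hS
    obtain ⟨h1, h2⟩ := ih _ (sweepStep_valid hS l)
    exact ⟨h1, h2.trans (sweepStep_improves hS l)⟩

/-- During the sweep, the demand of `w` is at the first vertex on its path that was not left. -/
structure Anchored (I : Inst) (o : List (List (Fin I.n))) (anc : Fin I.n → Fin I.n) : Prop where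
  left : ∀ w, ∃ k, I.parent^[k] w = anc w ∧ ∀ j < k, I.stem (I.parent^[j] w) ∈ o
  not_left : ∀ w, anc w = I.depot ∨ I.stem (anc w) ∉ o

/-- Compare the position `k` of the demand of `w` on its path with the position `m` of `v`. If `k <
m`, the demand waits strictly below `v`, at a vertex with a longer path, which must already have
been left. If `m < k`, then `v` itself was left before, against the absence of repetitions. -/
theorem Anchored.eq_iff {o₁ o₂ : List (List (Fin I.n))} {v : Fin I.n} (hv : v ≠ I.depot)
    (ho : I.paths.reverse = o₁ ++ I.stem v :: o₂) {anc : Fin I.n → Fin I.n}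
    (h : I.Anchored o₁ anc) (w : Fin I.n) : anc w = v ↔ w ∈ I.subtree v := by
  obtain ⟨k, hk, hj⟩ := h.left w
  rw [mem_subtree_iff]
  refine ⟨fun e => ⟨k, hk.trans e⟩, fun ⟨m, hm⟩ => ?_⟩
  have hnd : (o₁ ++ I.stem v :: o₂).Nodup := ho ▸ List.nodup_reverse.2 (nodup_pathsUpTo _)
  have hpw : (o₁ ++ I.stem v :: o₂).Pairwise fun a b => b.length ≤ a.length :=
    ho ▸ List.pairwise_reverse.2 (pairwise_pathsUpTo _)
  rcases lt_trichotomy k m with hlt | rfl | hlt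
  · exfalso
    have e : I.parent^[m - k] (anc w) = v := by
      rw [← hk, ← Function.iterate_add_apply, Nat.sub_add_cancel hlt.le, hm]
    have hd : anc w ≠ I.depot := fun h0 => hv (by
      rw [← e, h0, Function.iterate_fixed parent_depot])
    have hl := stem_length_iterate (anc w) (m - k) (by rwa [e])
    rw [e] at hl
    have hmem : I.stem (anc w) ∈ o₁ ++ I.stem v :: o₂ := ho ▸ List.mem_reverse.2 (mem_paths _)
    rcases List.mem_append.1 hmem with h1 | h1
    · exact (h.not_left w).elim hd fun h2 => h2 h1
    · rcases List.mem_cons.1 h1 with h2 | h2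
      · rw [h2] at hl; omega
      · have h3 := (List.pairwise_cons.1 (List.pairwise_append.1 hpw).2.1).1 _ h2
        omega
  · rw [← hk, hm]
  · exfalso
    have h1 := hj m hlt
    rw [hm] at h1
    exact (List.nodup_append.1 hnd).2.2 _ h1 _ List.mem_cons_self rfl

/-- Induction over the initial segments of the sweep: leaving `v` redirects all demand anchored at
`v` to its parent. -/
theorem exists_anchored (o₁ : List (List (Fin I.n))) :
    ∀ o₂, I.paths.reverse = o₁ ++ o₂ → ∃ anc, I.Anchored o₁ anc ∧
      Located I.Q I.rem (o₁.foldl I.sweepStep I.start) anc := by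
  induction o₁ using List.reverseRecOn with
  | nil => exact fun _ _ => ⟨id, ⟨fun w => ⟨0, rfl, by simp⟩, by simp⟩, start_located⟩
  | append_singleton o l ih =>
    intro o₂ ho
    rw [List.append_assoc, List.singleton_append] at ho
    obtain ⟨anc, ha, hL⟩ := ih _ ho
    obtain ⟨v, rfl⟩ := eq_stem_of_mem (List.mem_reverse.1 (ho ▸ List.mem_append_right _
      List.mem_cons_self : l ∈ I.paths.reverse))
    rw [List.foldl_append, List.foldl_cons, List.foldl_nil]
    by_cases hv : v = I.depot
    · refine ⟨anc, ⟨fun w => ?_, fun w => ?_⟩, ?_⟩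
      · obtain ⟨k, h1, h2⟩ := ha.left w
        exact ⟨k, h1, fun j hj => List.mem_append_left _ (h2 j hj)⟩
      · refine or_iff_not_imp_left.2 fun h1 h2 => ?_
        rcases List.mem_append.1 h2 with h3 | h3
        · exact (ha.not_left w).elim h1 fun h4 => h4 h3
        · exact h1 ((stem_injective (List.mem_singleton.1 h3)).trans hv)
      · rw [hv, sweepStep_depot]; exact hL
    · rw [sweepStep_stem hv]
      have hp := stem_length_parent hv
      have hne : I.parent v ≠ v := (adj_parent hv).ne'
      refine ⟨_, ⟨fun w => ?_, fun w => ?_⟩, hL.moved I.Q_pos hne⟩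
      · obtain ⟨k, h1, h2⟩ := ha.left w
        by_cases h : anc w = v
        · refine ⟨k + 1, ?_, fun j hj => ?_⟩
          · rw [Function.iterate_succ_apply', h1, h, if_pos rfl]
          · rcases Nat.lt_succ_iff_lt_or_eq.1 hj with h3 | rfl
            · exact List.mem_append_left _ (h2 j h3)
            · rw [h1, h]; simp
        · exact ⟨k, by rw [if_neg h, h1], fun j hj => List.mem_append_left _ (h2 j hj)⟩
      · split_ifs with h
        -- All vertices left so far have paths at least as long as that of `v`, hence the parent of
        -- `v` is not among them.
        · refine Or.inr fun h1 => ?_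
          have hpw : (o ++ I.stem v :: o₂).Pairwise fun a b => b.length ≤ a.length :=
            ho ▸ List.pairwise_reverse.2 (pairwise_pathsUpTo _)
          rcases List.mem_append.1 h1 with h2 | h2
          · have := (List.pairwise_append.1 hpw).2.2 _ h2 _ List.mem_cons_self
            omega
          · rw [List.mem_singleton.1 h2] at hp; omega
        · refine (ha.not_left w).imp id fun h1 h2 => ?_
          rcases List.mem_append.1 h2 with h3 | h3
          · exact h1 h3
          · exact h (stem_injective (List.mem_singleton.1 h3))

theorem sweep_valid : ∀ s ∈ I.sweep, s.2.Valid I.Q := (foldl_sweepStep_spec _ _ start_valid).1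

theorem start_cov : ((I.start.map Prod.snd).map Elem.cov).sum = I.rem := by
  have key : ∀ L : List (Fin I.n), L.Nodup →
      ((((L.filter fun v => !decide (I.rem v = 0)).map fun v => (v, I.leafElem v)).map
        Prod.snd).map Elem.cov).sum = fun w => if w ∈ L then I.rem w else 0 := by
    intro L hL
    induction L with
    | nil => rfl
    | cons a L ih =>
      obtain ⟨h1, h2⟩ := List.nodup_cons.1 hL
      have h3 := ih h2
      funext w
      by_cases ha : I.rem a = 0
      · rw [List.filter_cons_of_neg (by simp [ha]), h3]
        by_cases hw : w = a
        · subst hw; simp [h1, ha]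
        · simp [hw]
      · rw [List.filter_cons_of_pos (by simp [ha])]
        simp only [List.map_cons, List.sum_cons, h3, leafElem_cov, Pi.add_apply, Pi.single_apply]
        by_cases hw : w = a
        · subst hw; simp [h1]
        · simp [hw]
  refine (key _ (List.nodup_finRange _)).trans ?_
  simp

theorem sweep_cov : ((I.sweep.map Prod.snd).map Elem.cov).sum = I.rem :=
  (foldl_sweepStep_spec _ _ start_valid).2.cov.trans start_cov

/-- At the moment when `v` is left, exactly the demand of its subtree is there and the packed list
obeys the bound; the remaining steps of the sweep do not increase the potential. -/
theorem sweep_pot {v : Fin I.n} (hv : v ≠ I.depot) :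
    ∃ N, (I.sweep.map fun s => s.2.pot (I.subtree v)).sum ≤ 4 * N ∧
      ∑ w ∈ I.subtree v, I.rem w ≤ N * I.Q ∧ N * I.Q < ∑ w ∈ I.subtree v, I.rem w + I.Q := by
  obtain ⟨o₁, o₂, ho⟩ := List.append_of_mem (List.mem_reverse.2 (mem_paths v))
  obtain ⟨anc, ha, hL⟩ := exists_anchored o₁ _ ho
  obtain ⟨N, h1, h2⟩ := hL.pot_move I.Q_pos (p := I.parent v) (I.subtree v) (ha.eq_iff hv ho)
  refine ⟨N, ?_, h2⟩
  rw [← sweepStep_stem hv] at h1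
  have h3 := (foldl_sweepStep_spec o₂ _ (sweepStep_valid hL.valid (I.stem v))).2.pot (I.subtree v)
  rw [List.map_map, List.map_map] at h3
  rw [sweep, ho, List.foldl_append, List.foldl_cons]
  exact h3.trans h1

end Inst

end CVRP

/-! ### Tours with prescribed loads and the cost of the three schedules. -/

namespace CVRP

open Elem

namespace Inst

variable {I : Inst}

theorem paths_perm : I.paths.Perm ((List.finRange I.n).map I.stem) := by
  refine (List.perm_ext_iff_of_nodup (nodup_pathsUpTo _)
    ((List.nodup_finRange _).map stem_injective)).2 fun l => ?_
  constructor
  · intro h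
    obtain ⟨v, rfl⟩ := eq_stem_of_mem h
    exact List.mem_map_of_mem (List.mem_finRange v)
  · intro h
    obtain ⟨v, -, rfl⟩ := List.mem_map.1 h
    exact mem_paths v

theorem sum_paths (f : List (Fin I.n) → ℕ) : (I.paths.map f).sum = ∑ v, f (I.stem v) := by
  rw [(paths_perm.map f).sum_eq, List.map_map, Fin.sum_univ_def]
  rfl

/-! ### The walk of a tour -/

/-- The first visit of `p` is followed by a detour to `v`. -/
def detour {V : Type*} [DecidableEq V] (p v : V) : List V → List V
  | [] => []
  | a :: t => if a = p then p :: v :: p :: t else a :: detour p v t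

/-- The length of a walk. -/
def walkCost (I : Inst) {a b : Fin I.n} (W : I.G.Walk a b) : ℕ := (W.edges.map I.len).sum

theorem exists_detour {p v : Fin I.n} (h : I.G.Adj p v) {a b : Fin I.n} (W : I.G.Walk a b)
    (hp : p ∈ W.support) : ∃ W' : I.G.Walk a b, W'.support = detour p v W.support ∧
      I.walkCost W' = I.walkCost W + 2 * I.len s(p, v) := by
  induction W with
  | nil =>
    obtain rfl : p = _ := by simpa using hp
    refine ⟨.cons h (.cons h.symm .nil), by simp [detour], ?_⟩
    simp only [walkCost, SimpleGraph.Walk.edges_cons, SimpleGraph.Walk.edges_nil, List.map_cons,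
      List.map_nil, List.sum_cons, List.sum_nil, Sym2.eq_swap (a := v) (b := p)]
    omega
  | @cons a c b h' q ih =>
    by_cases ha : a = p
    · subst ha
      refine ⟨.cons h (.cons h.symm (.cons h' q)), by simp [detour], ?_⟩
      simp only [walkCost, SimpleGraph.Walk.edges_cons, List.map_cons, List.sum_cons,
        Sym2.eq_swap (a := v) (b := a)]
      omega
    · rw [SimpleGraph.Walk.support_cons, List.mem_cons] at hp
      obtain ⟨W', h1, h2⟩ := ih (hp.resolve_left fun e => ha e.symm)
      refine ⟨.cons h' W', by simp [detour, ha, h1], ?_⟩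
      simp only [walkCost, SimpleGraph.Walk.edges_cons, List.map_cons, List.sum_cons] at h2 ⊢
      omega

theorem mem_detour {V : Type*} [DecidableEq V] {p v a : V} {l : List V} (h : a ∈ l) :
    a ∈ detour p v l := by
  induction l with
  | nil => simp at h
  | cons b t ih =>
    rw [detour]
    split_ifs with hb
    · subst hb
      rcases List.mem_cons.1 h with rfl | h <;> simp [*]
    · rcases List.mem_cons.1 h with rfl | h
      · simp
      · exact List.mem_cons_of_mem _ (ih h)

theorem mem_detour_self {V : Type*} [DecidableEq V] {p v : V} {l : List V} (h : p ∈ l) :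
    v ∈ detour p v l := by
  induction l with
  | nil => simp at h
  | cons b t ih =>
    rw [detour]
    split_ifs with hb
    · simp
    · exact List.mem_cons_of_mem _ (ih ((List.mem_cons.1 h).resolve_left fun e => hb e.symm))

/-- Whether the load is present at the first vertex of a path. -/
def headLoaded {n : ℕ} (u : Fin n → ℕ) : List (Fin n) → Bool
  | v :: _ => !decide (u v = 0)
  | [] => false

/-- The vertices that a tour with the given load has to visit. -/
noncomputable def needed (I : Inst) (u : Fin I.n → ℕ) : List (Fin I.n) :=
  (I.paths.filter (headLoaded u)).flatMap id

theorem mem_needed {u : Fin I.n → ℕ} {v : Fin I.n} :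
    v ∈ I.needed u ↔ ∃ w ∈ I.subtree v, u w ≠ 0 := by
  simp only [needed, List.mem_flatMap, List.mem_filter, id, mem_subtree]
  constructor
  · rintro ⟨l, ⟨hl, h1⟩, h2⟩
    obtain ⟨w, rfl⟩ := eq_stem_of_mem hl
    obtain ⟨t, ht⟩ := stem_head w
    rw [ht] at h1
    exact ⟨w, h2, by simpa [headLoaded] using h1⟩
  · rintro ⟨w, h1, h2⟩
    obtain ⟨t, ht⟩ := stem_head w
    exact ⟨_, ⟨mem_paths w, by rw [ht]; simpa [headLoaded] using h2⟩, h1⟩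

theorem meets_subtree (u : Fin I.n → ℕ) (v : Fin I.n) :
    meets (I.subtree v) u = if v ∈ I.needed u then 1 else 0 := by
  rw [meets]
  exact if_congr mem_needed.symm rfl rfl

/-- Extend the walk by a detour to the first vertex of a path, if this vertex has to be visited. -/
noncomputable def tourStep (I : Inst) (u : Fin I.n → ℕ) (W : List (Fin I.n)) :
    List (Fin I.n) → List (Fin I.n)
  | v :: p :: _ => if v ∈ I.needed u then detour p v W else W
  | _ => W

/-- The vertices along the walk of a tour with the given load. -/
noncomputable def tourList (I : Inst) (u : Fin I.n → ℕ) : List (Fin I.n) :=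
  I.paths.foldl (I.tourStep u) [I.depot]

/-- What the walk pays for a vertex. -/
noncomputable def tourStepCost (I : Inst) (u : Fin I.n → ℕ) : List (Fin I.n) → ℕ
  | v :: p :: _ => if v ∈ I.needed u then 2 * I.len s(p, v) else 0
  | _ => 0

noncomputable def tourCost (I : Inst) (u : Fin I.n → ℕ) : ℕ :=
  (I.paths.map (I.tourStepCost u)).sum

/-- The needed vertices are closed under taking parents, and parents come earlier in the list. So
the parent is already on the walk when a detour to `v` has to start there, and each needed edge is
paid for exactly twice. -/
theorem exists_walk_prefix (u : Fin I.n → ℕ) (o₁ : List (List (Fin I.n))) :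
    ∀ o₂, I.paths = o₁ ++ o₂ → ∃ W : I.G.Walk I.depot I.depot,
      W.support = o₁.foldl (I.tourStep u) [I.depot] ∧
      I.walkCost W = (o₁.map (I.tourStepCost u)).sum ∧
      ∀ v, I.stem v ∈ o₁ → v ∈ I.needed u → v ∈ W.support := by
  induction o₁ using List.reverseRecOn with
  | nil => exact fun _ _ => ⟨.nil, rfl, rfl, by simp⟩
  | append_singleton o l ih =>
    intro o₂ ho
    rw [List.append_assoc, List.singleton_append] at ho
    obtain ⟨W, h1, h2, h3⟩ := ih _ ho
    obtain ⟨v, rfl⟩ := eq_stem_of_mem (ho ▸ List.mem_append_right _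
      List.mem_cons_self : l ∈ I.paths)
    rw [List.foldl_append, List.foldl_cons, List.foldl_nil, List.map_append, List.sum_append,
      ← h1, ← h2, List.map_cons, List.map_nil, List.sum_cons, List.sum_nil, add_zero]
    by_cases hv : v = I.depot
    · refine ⟨W, ?_, ?_, fun w hw hn => ?_⟩
      · rw [hv, stem_depot, tourStep]; simp
      · rw [hv, stem_depot, tourStepCost]
        · rfl
        · simp
      · rcases List.mem_append.1 hw with h4 | h4
        · exact h3 w h4 hn
        · rw [stem_injective (List.mem_singleton.1 h4), hv]
          exact SimpleGraph.Walk.start_mem_support _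
    · obtain ⟨t, ht⟩ := stem_head (I.parent v)
      rw [stem_eq hv, ht, tourStep, tourStepCost, ← ht, ← stem_eq hv]
      split_ifs with hn
      · have hp : I.parent v ∈ W.support := by
          have hpn : I.parent v ∈ I.needed u := by
            obtain ⟨w, hw, hu⟩ := mem_needed.1 hn
            obtain ⟨k, hk⟩ := mem_subtree_iff.1 hw
            exact mem_needed.2 ⟨w, mem_subtree_iff.2 ⟨k + 1, by
              rw [Function.iterate_succ_apply', hk]⟩, hu⟩
          refine h3 _ ?_ hpn
          have hl := stem_length_parent hv
          have hpw : (o ++ I.stem v :: o₂).Pairwise fun a b => a.length ≤ b.length :=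
            ho ▸ pairwise_pathsUpTo _
          have hmem : I.stem (I.parent v) ∈ o ++ I.stem v :: o₂ := ho ▸ mem_paths _
          refine (List.mem_append.1 hmem).resolve_right fun h4 => ?_
          rcases List.mem_cons.1 h4 with h5 | h5
          · rw [h5] at hl; omega
          · have := (List.pairwise_cons.1 (List.pairwise_append.1 hpw).2.1).1 _ h5
            omega
        obtain ⟨W', h4, h5⟩ := exists_detour (adj_parent hv).symm W hp
        refine ⟨W', h4, h5, fun w hw hwn => ?_⟩
        rw [h4]
        rcases List.mem_append.1 hw with h6 | h6
        · exact mem_detour (h3 w h6 hwn)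
        · rw [stem_injective (List.mem_singleton.1 h6)]
          exact mem_detour_self hp
      · refine ⟨W, rfl, rfl, fun w hw hwn => ?_⟩
        rcases List.mem_append.1 hw with h6 | h6
        · exact h3 w h6 hwn
        · exact absurd (stem_injective (List.mem_singleton.1 h6) ▸ hwn) hn

theorem exists_walk (u : Fin I.n → ℕ) : ∃ W : I.G.Walk I.depot I.depot,
    W.support = I.tourList u ∧ I.walkCost W = I.tourCost u ∧ ∀ v, u v ≠ 0 → v ∈ W.support := by
  obtain ⟨W, h1, h2, h3⟩ := exists_walk_prefix u I.paths [] (List.append_nil _).symm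
  exact ⟨W, h1, h2, fun v hv => h3 v (mem_paths v) (mem_needed.2 ⟨v, mem_subtree_self v, hv⟩)⟩

theorem tourCost_eq (u : Fin I.n → ℕ) : I.tourCost u =
    ∑ v ∈ Finset.univ.erase I.depot, 2 * I.len s(I.parent v, v) * meets (I.subtree v) u := by
  rw [tourCost, sum_paths, ← Finset.add_sum_erase _ _ (Finset.mem_univ I.depot)]
  have h0 : I.tourStepCost u (I.stem I.depot) = 0 := by
    rw [stem_depot, tourStepCost]; simp
  rw [h0, zero_add]
  refine Finset.sum_congr rfl fun v hv => ?_
  have hv' := (Finset.mem_erase.1 hv).1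
  obtain ⟨t, ht⟩ := stem_head (I.parent v)
  rw [stem_eq hv', ht, tourStepCost, meets_subtree]
  split_ifs <;> simp

/-- A tour with the given load. -/
noncomputable def mkTour (I : Inst) (u : Fin I.n → ℕ) : I.Tour where
  walk := (exists_walk u).choose
  -- The empty load is a default that makes the construction total; all loads that are used respect
  -- the capacity.
  load := if tot u ≤ I.Q then u else 0
  mem_walk v hv := (exists_walk u).choose_spec.2.2 v (by
    split_ifs at hv with h
    · exact hv
    · exact absurd rfl hv)
  load_le := by
    split_ifs with h
    · exact h
    · simp

theorem mkTour_cost (u : Fin I.n → ℕ) : (I.mkTour u).cost = I.tourCost u :=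
  (exists_walk u).choose_spec.2.1

theorem mkTour_load {u : Fin I.n → ℕ} (h : tot u ≤ I.Q) : (I.mkTour u).load = u := if_pos h

/-! ### The three schedules -/

/-- The loads of the vehicles in one packing of an element. -/
def Elem.loads {n : ℕ} (t : Fin 3) (e : Elem n) : List (Fin n → ℕ) := e.opn t :: e.cls t

/-- The loads of all vehicles that serve the remaining demand in one of the packings. -/
noncomputable def modeLoads (I : Inst) (t : Fin 3) : List (Fin I.n → ℕ) :=
  I.sweep.flatMap fun s => Elem.loads t s.2

/-- The full vehicles of a vertex form one entry with a multiplicity, since their number may be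
exponential in the input size. -/
noncomputable def modeSchedule (I : Inst) (t : Fin 3) : I.Schedule :=
  ((List.finRange I.n).map fun v => (I.demand v / I.Q, I.mkTour (Pi.single v I.Q))) ++
    (I.modeLoads t).map fun u => (1, I.mkTour u)

noncomputable def modeCost (I : Inst) (t : Fin 3) : ℕ :=
  ((List.finRange I.n).map fun v => I.demand v / I.Q * I.tourCost (Pi.single v I.Q)).sum +
    ((I.modeLoads t).map I.tourCost).sum

/-- The cheapest of the three schedules. -/
noncomputable def bestSchedule (I : Inst) : I.Schedule :=
  if I.modeCost 0 ≤ I.modeCost 1 ∧ I.modeCost 0 ≤ I.modeCost 2 then I.modeSchedule 0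
  else if I.modeCost 1 ≤ I.modeCost 2 then I.modeSchedule 1 else I.modeSchedule 2

theorem modeSchedule_cost (t : Fin 3) : (I.modeSchedule t).cost = I.modeCost t := by
  simp only [Schedule.cost, modeSchedule, modeCost, List.map_append, List.sum_append, List.map_map,
    Function.comp_def, mkTour_cost, one_mul]

theorem tot_le_of_mem_modeLoads {t : Fin 3} {u : Fin I.n → ℕ} (hu : u ∈ I.modeLoads t) :
    tot u ≤ I.Q := by
  obtain ⟨s, hs, h⟩ := List.mem_flatMap.1 hu
  have hv := sweep_valid s hs
  rcases List.mem_cons.1 h with rfl | h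
  · exact (hv.opn_le t).trans hv.x_le
  · exact hv.cls_le t u h

theorem modeLoads_sum (t : Fin 3) : (I.modeLoads t).sum = I.rem := by
  rw [← sweep_cov, modeLoads, sum_flatMap_eq, List.map_map]
  refine sum_map_congr fun s hs => ?_
  rw [Elem.loads, List.sum_cons]
  exact (sweep_valid s hs).cov_eq t

theorem sum_map_apply {n : ℕ} (l : List (Fin n → ℕ)) (v : Fin n) :
    (l.map fun u => u v).sum = l.sum v := by
  induction l with
  | nil => rfl
  | cons a l ih => simp [ih]

theorem modeSchedule_feasible (t : Fin 3) : (I.modeSchedule t).Feasible := by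
  intro v
  rw [modeSchedule, List.map_append, List.sum_append, List.map_map, List.map_map]
  have h1 : ((List.finRange I.n).map ((fun e : ℕ × I.Tour => e.1 * e.2.load v) ∘
      fun w => (I.demand w / I.Q, I.mkTour (Pi.single w I.Q)))).sum = I.demand v / I.Q * I.Q := by
    have : ((fun e : ℕ × I.Tour => e.1 * e.2.load v) ∘
        fun w => (I.demand w / I.Q, I.mkTour (Pi.single w I.Q))) =
        fun w => if w = v then I.demand v / I.Q * I.Q else 0 := by
      funext w
      simp only [Function.comp, mkTour_load (tot_single w I.Q).le]
      by_cases h : w = v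
      · subst h; simp
      · have h' : v ≠ w := fun e => h e.symm
        simp [h, h']
    rw [this, ← Fin.sum_univ_def]
    simp
  have h2 : ((I.modeLoads t).map ((fun e : ℕ × I.Tour => e.1 * e.2.load v) ∘
      fun u => (1, I.mkTour u))).sum = I.rem v := by
    rw [← modeLoads_sum t, ← sum_map_apply]
    refine sum_map_congr fun u hu => ?_
    simp only [Function.comp, one_mul, mkTour_load (tot_le_of_mem_modeLoads hu)]
  rw [h1, h2, rem]
  exact Nat.div_add_mod' _ _

theorem bestSchedule_eq : ∃ t, I.bestSchedule = I.modeSchedule t ∧ ∀ t', I.modeCost t ≤ I.modeCost t' := by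
  unfold bestSchedule
  split_ifs with h1 h2
  · refine ⟨0, rfl, fun t' => ?_⟩
    fin_cases t'
    exacts [le_rfl, h1.1, h1.2]
  · refine ⟨1, rfl, fun t' => ?_⟩
    fin_cases t'
    · show I.modeCost 1 ≤ I.modeCost 0
      omega
    exacts [le_rfl, h2]
  · refine ⟨2, rfl, fun t' => ?_⟩
    fin_cases t'
    · show I.modeCost 2 ≤ I.modeCost 0
      omega
    · show I.modeCost 2 ≤ I.modeCost 1
      omega
    · exact le_rfl

theorem bestSchedule_feasible : I.bestSchedule.Feasible := by
  obtain ⟨t, ht, -⟩ := bestSchedule_eq (I := I)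
  rw [ht]
  exact modeSchedule_feasible t

/-- Removing full vehicles lowers the demand by multiples of `Q`, so it commutes with rounding up.
-/
theorem le_traffic {v : Fin I.n} {N : ℕ}
    (h : N * I.Q < ∑ w ∈ I.subtree v, I.rem w + I.Q) :
    ∑ w ∈ I.subtree v, I.demand w / I.Q + N ≤ I.traffic v := by
  have hD : I.subtreeDemand v =
      (∑ w ∈ I.subtree v, I.demand w / I.Q) * I.Q + ∑ w ∈ I.subtree v, I.rem w := by
    rw [subtreeDemand, Finset.sum_mul, ← Finset.sum_add_distrib]
    exact Finset.sum_congr rfl fun w _ => (Nat.div_add_mod' _ _).symm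
  rcases Nat.eq_zero_or_pos (∑ w ∈ I.subtree v, I.demand w / I.Q + N) with h0 | h0
  · rw [h0]; exact Nat.zero_le _
  obtain ⟨m, hm⟩ := Nat.exists_eq_add_of_lt h0
  rw [zero_add] at hm
  rw [hm, traffic]
  refine Nat.succ_le_of_lt (Nat.lt_ceil.2 ?_)
  have hQ : (0 : ℚ) < I.Q := by exact_mod_cast I.Q_pos
  rw [lt_div_iff₀ hQ]
  have h1 : (m + 1) * I.Q < I.subtreeDemand v + I.Q := by
    rw [← hm, Nat.add_mul]; omega
  have h2 : m * I.Q < I.subtreeDemand v := by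
    rw [Nat.add_mul, one_mul] at h1; omega
  exact_mod_cast h2

theorem sum_list_tourCost (L : List (Fin I.n → ℕ)) : (L.map I.tourCost).sum =
    ∑ v ∈ Finset.univ.erase I.depot, 2 * I.len s(I.parent v, v) *
      (L.map (meets (I.subtree v))).sum := by
  induction L with
  | nil => simp
  | cons a L ih =>
    simp only [List.map_cons, List.sum_cons, ih, tourCost_eq, Nat.mul_add, Finset.sum_add_distrib]

/-- Edge by edge: each full vehicle from the subtree crosses once in each of the three schedules,
and the vehicles for remaining demand cross at most `4 * N` times in total by `sweep_pot`. With
`le_traffic` the sum is at most four times the traffic. -/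
theorem sum_modeCost_le : ∑ t, I.modeCost t ≤ 4 * I.LB := by
  have hfull : ∀ v, (∑ w, I.demand w / I.Q * meets (I.subtree v) (Pi.single w I.Q)) =
      ∑ w ∈ I.subtree v, I.demand w / I.Q := by
    intro v
    rw [← Finset.sum_filter_add_sum_filter_not Finset.univ (· ∈ I.subtree v)]
    have h0 : (∑ w ∈ Finset.univ.filter (· ∉ I.subtree v),
        I.demand w / I.Q * meets (I.subtree v) (Pi.single w I.Q)) = 0 := by
      refine Finset.sum_eq_zero fun w hw => ?_
      rw [meets, if_neg, Nat.mul_zero]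
      rintro ⟨u, hu, hne⟩
      rw [Pi.single_apply] at hne
      split_ifs at hne with h
      · exact (Finset.mem_filter.1 hw).2 (h ▸ hu)
      · exact hne rfl
    rw [h0, add_zero]
    refine Finset.sum_congr (by ext; simp) fun w hw => ?_
    rw [meets, if_pos, Nat.mul_one]
    exact ⟨w, hw, by simp [I.Q_pos.ne']⟩
  have hc : ∀ t, I.modeCost t = ∑ v ∈ Finset.univ.erase I.depot, 2 * I.len s(I.parent v, v) *
      (∑ w ∈ I.subtree v, I.demand w / I.Q +
        (I.sweep.map fun s => s.2.num (I.subtree v) t).sum) := by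
    intro t
    rw [modeCost, sum_list_tourCost, ← Fin.sum_univ_def]
    simp only [tourCost_eq, Finset.mul_sum, Nat.mul_add, Finset.sum_add_distrib]
    congr 1
    · rw [Finset.sum_comm]
      refine Finset.sum_congr rfl fun v _ => ?_
      rw [← Finset.mul_sum, ← hfull v, Finset.mul_sum]
      exact Finset.sum_congr rfl fun w _ => by ring
    · refine Finset.sum_congr rfl fun v _ => ?_
      rw [modeLoads, sum_map_flatMap_eq]
      rfl
  simp only [hc]
  rw [Finset.sum_comm, LB, Finset.mul_sum]
  refine Finset.sum_le_sum fun v hv => ?_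
  obtain ⟨N, h1, -, h3⟩ := sweep_pot (Finset.mem_erase.1 hv).1
  have h4 := le_traffic h3
  rw [← Finset.mul_sum, Finset.sum_add_distrib, sum_map_fin3 I.sweep fun t s =>
    s.2.num (I.subtree v) t]
  -- For a leaf that arrives unmerged at the depot, the unit reserved for a split is not spent: 3
  -- instead of 4.
  have h5 : (I.sweep.map fun s => ∑ t, s.2.num (I.subtree v) t).sum ≤
      (I.sweep.map fun s => s.2.pot (I.subtree v)).sum := by
    refine sum_map_le fun s hs => ?_
    have hval := sweep_valid s hs
    rw [pot]
    split_ifs with hl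
    · have h6 : ∀ t, s.2.num (I.subtree v) t = meets (I.subtree v) s.2.cov := fun t => by
        rw [num, hval.opn_eq hl, (hval.leaf_case hl).2]; simp
      simp only [h6, Finset.sum_const, Finset.card_univ, Fintype.card_fin, smul_eq_mul]
      omega
    · exact le_rfl
  rw [Finset.sum_const, Finset.card_univ, Fintype.card_fin, smul_eq_mul, mul_left_comm 4]
  refine Nat.mul_le_mul_left _ ?_
  omega

theorem bestSchedule_cost : 3 * I.bestSchedule.cost ≤ 4 * I.LB := by
  obtain ⟨t, ht, hle⟩ := bestSchedule_eq (I := I)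
  rw [ht, modeSchedule_cost]
  refine le_trans ?_ sum_modeCost_le
  rw [Fin.sum_univ_three]
  have := hle 0
  have := hle 1
  have := hle 2
  omega

end Inst

end CVRP

/-! ### The lower bound. -/

namespace CVRP

namespace Inst

variable {I : Inst}

theorem edge_mem_path {v w : Fin I.n} (hv : v ≠ I.depot) (h : v ∈ I.stem w) :
    s(I.parent v, v) ∈ (I.path w I.depot).edges := by
  induction w using parent_induction (I := I) with
  | h0 => rw [stem_depot, List.mem_singleton] at h; exact absurd h hv
  | h1 w hw ih =>
    obtain ⟨hadj, e⟩ := exists_path_eq hw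
    rw [e, SimpleGraph.Walk.edges_cons]
    rw [stem_eq hw, List.mem_cons] at h
    rcases h with rfl | h
    · rw [Sym2.eq_swap]; exact List.mem_cons_self
    · exact List.mem_cons_of_mem _ (ih h)

/-- Short-cutting any walk to the depot yields the unique path, and this path uses the edge above
`v`. -/
theorem edge_mem_walk {v w : Fin I.n} (hv : v ≠ I.depot) (h : w ∈ I.subtree v)
    (W : I.G.Walk w I.depot) : s(I.parent v, v) ∈ W.edges := by
  classical
  refine W.edges_bypass_subset_edges ?_
  rw [eq_path W.bypass_isPath]
  exact edge_mem_path hv (mem_subtree.1 h)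

theorem edge_injOn : Set.InjOn (fun v => s(I.parent v, v))
    (Finset.univ.erase I.depot : Finset (Fin I.n)) := by
  intro u hu v hv h
  simp only [Finset.coe_erase, Finset.coe_univ, Set.mem_sdiff, Set.mem_univ,
    Set.mem_singleton_iff, true_and] at hu hv
  rcases Sym2.eq_iff.1 h with ⟨-, h⟩ | ⟨h1, h2⟩
  · exact h
  · have h3 := stem_length_parent hu
    have h4 := stem_length_parent hv
    rw [h1] at h3
    rw [← h2] at h4
    omega

theorem sum_count_le {α β : Type*} [DecidableEq β] (s : Finset α) (f : α → β)
    (hf : Set.InjOn f s) (g : β → ℕ) (l : List β) :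
    ∑ v ∈ s, l.count (f v) * g (f v) ≤ (l.map g).sum := by
  rw [← Finset.sum_image (f := fun b => l.count b * g b) hf, Finset.sum_list_map_count]
  simp only [smul_eq_mul]
  refine Finset.sum_le_sum_of_ne_zero fun b _ hb => ?_
  rw [List.mem_toFinset]
  by_contra h
  exact hb (by rw [List.count_eq_zero_of_not_mem h, Nat.zero_mul])

/-- Cut the closed walk at a loaded vertex of the subtree: both parts connect it with the depot, so
each contains the edge above `v`. Different `v` give different edges by `edge_injOn`, so these
traversals may be added up. -/
theorem le_tour_cost (T : I.Tour) :
    ∑ v ∈ Finset.univ.erase I.depot, 2 * I.len s(I.parent v, v) * meets (I.subtree v) T.load ≤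
      T.cost := by
  classical
  refine le_trans (Finset.sum_le_sum fun v hv => ?_) (sum_count_le _ _ edge_injOn I.len T.walk.edges)
  rw [meets]
  split_ifs with h
  · obtain ⟨w, hw, hne⟩ := h
    have hmem := T.mem_walk w hne
    have hv' := (Finset.mem_erase.1 hv).1
    have h1 := edge_mem_walk hv' hw (T.walk.dropUntil w hmem)
    have h2 := edge_mem_walk hv' hw (T.walk.takeUntil w hmem).reverse
    rw [SimpleGraph.Walk.edges_reverse, List.mem_reverse] at h2
    have h3 : 2 ≤ T.walk.edges.count s(I.parent v, v) := by
      rw [← T.walk.take_spec hmem, SimpleGraph.Walk.edges_append, List.count_append]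
      have := List.count_pos_iff.2 h1
      have := List.count_pos_iff.2 h2
      omega
    rw [Nat.mul_one]
    exact Nat.mul_le_mul_right _ h3
  · simp

theorem le_schedule_cost (S : I.Schedule) :
    ∑ v ∈ Finset.univ.erase I.depot, 2 * I.len s(I.parent v, v) *
      (S.map fun e => e.1 * meets (I.subtree v) e.2.load).sum ≤ S.cost := by
  induction S with
  | nil => simp
  | cons e S ih =>
    rw [Schedule.cost, List.map_cons, List.sum_cons]
    refine le_trans (le_of_eq ?_) (Nat.add_le_add (Nat.mul_le_mul_left _ (le_tour_cost e.2)) ih)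
    simp only [List.map_cons, List.sum_cons, Nat.mul_add, Finset.sum_add_distrib, Finset.mul_sum]
    congr 1
    exact Finset.sum_congr rfl fun v _ => by ring

/-- A tour delivers at most `Q` to the subtree, and nothing if its load does not meet it. -/
theorem traffic_le {S : I.Schedule} (hS : S.Feasible) (v : Fin I.n) :
    I.traffic v ≤ (S.map fun e => e.1 * meets (I.subtree v) e.2.load).sum := by
  have hQ : (0 : ℚ) < I.Q := by exact_mod_cast I.Q_pos
  rw [traffic, Nat.ceil_le, div_le_iff₀ hQ]
  norm_cast
  rw [subtreeDemand, Finset.sum_congr rfl fun w _ => (hS w).symm]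
  clear hS
  induction S with
  | nil => simp
  | cons e S ih =>
    simp only [List.map_cons, List.sum_cons, Finset.sum_add_distrib, Nat.add_mul]
    refine Nat.add_le_add ?_ ih
    rw [← Finset.mul_sum, Nat.mul_assoc]
    refine Nat.mul_le_mul_left _ ?_
    rw [meets]
    split_ifs with h
    · rw [Nat.one_mul]
      exact (Finset.sum_le_sum_of_subset (Finset.subset_univ _)).trans e.2.load_le
    · rw [Finset.sum_eq_zero fun w hw => by_contra fun hne => h ⟨w, hw, hne⟩]
      exact Nat.zero_le _

theorem LB_le_cost {S : I.Schedule} (hS : S.Feasible) : I.LB ≤ S.cost :=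
  (Finset.sum_le_sum fun v _ => Nat.mul_le_mul_left _ (traffic_le hS v)).trans (le_schedule_cost S)

theorem exists_opt : ∃ S : I.Schedule, S.Feasible ∧ S.cost = I.opt :=
  Nat.sInf_mem (s := {c | ∃ S : I.Schedule, S.Feasible ∧ S.cost = c})
    ⟨_, _, bestSchedule_feasible, rfl⟩

theorem LB_le_opt : I.LB ≤ I.opt := by
  obtain ⟨S, hS, h⟩ := exists_opt (I := I)
  exact h ▸ LB_le_cost hS

end Inst

end CVRP

/-! ### Tightness of the ratio on stars. -/

namespace CVRP

namespace Inst

/-- Stars with unit edge lengths, with the depot at an end, in which every other end has a demand of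
slightly more than half of the capacity. -/
structure IsStar (I : Inst) (c : Fin I.n) (k : ℕ) : Prop where
  ne : c ≠ I.depot
  card : I.n = 2 * (k + 1) + 2
  adj : ∀ {v}, v ≠ c → I.G.Adj v c
  len : ∀ e, I.len e = 1
  demand_zero : ∀ {v}, (v = c ∨ v = I.depot) → I.demand v = 0
  demand : ∀ {v}, ¬(v = c ∨ v = I.depot) → I.demand v = k + 2
  Q : I.Q = 2 * (k + 1)

/-- The ends of a star other than the depot. -/
def ends (I : Inst) (c : Fin I.n) : Finset (Fin I.n) := (Finset.univ.erase I.depot).erase c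

variable {I : Inst} {c : Fin I.n} {k : ℕ}

theorem mem_ends {v : Fin I.n} : v ∈ I.ends c ↔ v ≠ c ∧ v ≠ I.depot := by
  simp [ends]

namespace IsStar

theorem card_ends (h : IsStar I c k) : (I.ends c).card = 2 * (k + 1) := by
  rw [ends, Finset.card_erase_of_mem, Finset.card_erase_of_mem (Finset.mem_univ _),
    Finset.card_univ, Fintype.card_fin, h.card]
  · rfl
  · exact Finset.mem_erase.2 ⟨h.ne, Finset.mem_univ _⟩

theorem sum_eq (h : IsStar I c k) (f : Fin I.n → ℕ) :
    ∑ v ∈ Finset.univ.erase I.depot, f v = f c + ∑ v ∈ I.ends c, f v := by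
  rw [ends, Finset.add_sum_erase]
  exact Finset.mem_erase.2 ⟨h.ne, Finset.mem_univ _⟩

theorem stem_center (h : IsStar I c k) : I.stem c = [c, I.depot] := by
  rw [stem_cons (h.adj h.ne.symm).symm, stem_depot]
  rw [stem_depot, List.mem_singleton]
  exact h.ne

theorem stem_end (h : IsStar I c k) {v : Fin I.n} (hv : v ∈ I.ends c) :
    I.stem v = [v, c, I.depot] := by
  obtain ⟨h0, h1⟩ := mem_ends.1 hv
  rw [stem_cons (h.adj h0), h.stem_center]
  rw [h.stem_center]
  simp [h0, h1]

theorem subtree_end (h : IsStar I c k) {v : Fin I.n} (hv : v ∈ I.ends c) : I.subtree v = {v} := by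
  obtain ⟨h0, h1⟩ := mem_ends.1 hv
  refine Finset.Subset.antisymm (fun w hw => ?_)
    (Finset.singleton_subset_iff.2 (mem_subtree_self v))
  rw [mem_subtree] at hw
  refine Finset.mem_singleton.2 ?_
  by_cases hw0 : w = c
  · rw [hw0, h.stem_center] at hw
    simp [h0, h1] at hw
  by_cases hw1 : w = I.depot
  · rw [hw1, stem_depot] at hw
    exact absurd (List.mem_singleton.1 hw) h1
  rw [h.stem_end (mem_ends.2 ⟨hw0, hw1⟩)] at hw
  simp only [List.mem_cons, h0, h1, List.not_mem_nil, or_false] at hw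
  exact hw.symm

theorem demand_end (h : IsStar I c k) {v : Fin I.n} (hv : v ∈ I.ends c) : I.demand v = k + 2 :=
  h.demand (by have := mem_ends.1 hv; tauto)

theorem traffic_end (h : IsStar I c k) {v : Fin I.n} (hv : v ∈ I.ends c) : I.traffic v = 1 := by
  rw [traffic, subtreeDemand, h.subtree_end hv, Finset.sum_singleton, h.demand_end hv, h.Q,
    Nat.ceil_eq_iff one_ne_zero]
  push_cast
  constructor
  · positivity
  · rw [div_le_one (by positivity)]
    have : (0 : ℚ) ≤ k := by positivity
    linarith

theorem sum_demand (h : IsStar I c k) : ∑ v, I.demand v = 2 * (k + 1) * (k + 2) := by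
  rw [← Finset.add_sum_erase _ _ (Finset.mem_univ I.depot), h.sum_eq,
    Finset.sum_congr rfl fun v hv => h.demand_end hv, Finset.sum_const, h.card_ends,
    h.demand_zero (Or.inl rfl), h.demand_zero (Or.inr rfl)]
  simp

theorem traffic_center (h : IsStar I c k) : I.traffic c ≤ k + 2 := by
  rw [traffic, Nat.ceil_le, h.Q, div_le_iff₀ (by positivity)]
  norm_cast
  rw [Nat.mul_comm, ← h.sum_demand]
  exact Finset.sum_le_sum_of_subset (Finset.subset_univ _)

theorem LB_eq (h : IsStar I c k) : I.LB = 2 * I.traffic c + 4 * (k + 1) := by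
  rw [LB, h.sum_eq]
  simp only [h.len]
  rw [Finset.sum_congr rfl fun v hv => by rw [h.traffic_end hv], Finset.sum_const,
    h.card_ends, smul_eq_mul]
  omega

end IsStar

/-- What a tour contributes to a client: 2 if it serves the client completely, and 1 if it serves
a part of the demand. -/
def contribution (D x : ℕ) : ℕ := (if 0 < x then 1 else 0) + if D ≤ x then 1 else 0

/-- The edge of a served client pays for the first unit of its contribution. Since `2 * (k + 2)`
exceeds the capacity, at most one client is served completely, and the edge between centre and depot
pays for this extra unit. -/
theorem IsStar.two_mul_contribution_le (h : IsStar I c k) (T : I.Tour) :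
    2 * ∑ v ∈ I.ends c, contribution (k + 2) (T.load v) ≤ T.cost := by
  refine le_trans ?_ (le_tour_cost T)
  rw [h.sum_eq]
  simp only [h.len, contribution, Nat.mul_one, ← Finset.mul_sum, ← Nat.mul_add]
  refine Nat.mul_le_mul_left _ ?_
  rw [Finset.sum_add_distrib, Nat.add_comm]
  refine Nat.add_le_add ?_ (Finset.sum_le_sum fun v hv => ?_)
  · rw [← Finset.card_filter]
    set F := (I.ends c).filter fun v => k + 2 ≤ T.load v with hF
    have h1 : F.card * (k + 2) ≤ 2 * (k + 1) := by
      refine le_trans (Finset.card_nsmul_le_sum F T.load (k + 2) fun v hv => ?_)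
        ((Finset.sum_le_sum_of_subset (Finset.subset_univ _)).trans (T.load_le.trans_eq h.Q))
      exact (Finset.mem_filter.1 hv).2
    have h2 : F.card ≤ 1 := by
      by_contra hc
      have : 2 * (k + 2) ≤ F.card * (k + 2) := Nat.mul_le_mul_right _ (by omega)
      omega
    rcases F.eq_empty_or_nonempty with hF0 | ⟨v, hv⟩
    · rw [hF0]; exact Nat.zero_le _
    · rw [meets, if_pos]
      · exact h2
      · obtain ⟨h3, h4⟩ := Finset.mem_filter.1 hv
        refine ⟨v, mem_subtree.2 ?_, by omega⟩
        rw [h.stem_end h3]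
        simp
  · rw [meets]
    split_ifs with h1 h2
    · exact le_rfl
    · exact absurd ⟨v, mem_subtree_self v, by omega⟩ h2
    · exact Nat.zero_le _
    · exact le_rfl

/-- If the contributions total at most 1, nobody serves the client completely, so each unit of
contribution stands for at most `D` units of demand. A client with demand `D + 1` therefore receives
contributions of at least 2. -/
theorem sum_le_mul_contribution {α : Type*} (D : ℕ) (m x : α → ℕ) (l : List α)
    (h : (l.map fun e => m e * contribution (D + 1) (x e)).sum ≤ 1) :
    (l.map fun e => m e * x e).sum ≤
      D * (l.map fun e => m e * contribution (D + 1) (x e)).sum := by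
  induction l with
  | nil => simp
  | cons e l ih =>
    simp only [List.map_cons, List.sum_cons, Nat.mul_add] at h ⊢
    refine Nat.add_le_add ?_ (ih (by omega))
    rcases Nat.eq_zero_or_pos (m e) with h0 | h0
    · simp [h0]
    · have h1 : contribution (D + 1) (x e) ≤ 1 := by
        have := Nat.le_mul_of_pos_left (contribution (D + 1) (x e)) h0
        omega
      rw [Nat.mul_left_comm]
      refine Nat.mul_le_mul_left _ ?_
      unfold contribution at h1 ⊢
      split_ifs at h1 ⊢ <;> omega

/-- Each of the `2 * (k + 1)` clients collects contributions of at least 2, from one complete or two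
partial services, and each unit of contribution costs 2. -/
theorem IsStar.le_cost (h : IsStar I c k) {S : I.Schedule} (hS : S.Feasible) : 8 * (k + 1) ≤ S.cost := by
  have h1 : ∀ v ∈ I.ends c,
      2 ≤ (S.map fun e => e.1 * contribution (k + 2) (e.2.load v)).sum := by
    intro v hv
    by_contra hlt
    have h2 := sum_le_mul_contribution (k + 1) (fun e : ℕ × I.Tour => e.1)
      (fun e => e.2.load v) S (Nat.le_of_lt_succ (not_le.1 hlt))
    rw [hS v, h.demand_end hv] at h2
    have h3 : (k + 1) * (S.map fun e => e.1 * contribution (k + 2) (e.2.load v)).sum ≤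
        (k + 1) * 1 := Nat.mul_le_mul_left _ (Nat.le_of_lt_succ (not_le.1 hlt))
    have := h2.trans h3
    omega
  have h2 : 2 * ∑ v ∈ I.ends c,
      (S.map fun e => e.1 * contribution (k + 2) (e.2.load v)).sum ≤ S.cost := by
    clear hS h1
    induction S with
    | nil => simp
    | cons e S ih =>
      simp only [Schedule.cost, List.map_cons, List.sum_cons, Finset.sum_add_distrib,
        Nat.mul_add] at ih ⊢
      refine Nat.add_le_add ?_ ih
      rw [← Finset.mul_sum, Nat.mul_left_comm]
      exact Nat.mul_le_mul_left _ (h.two_mul_contribution_le e.2)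
  have h3 := Finset.card_nsmul_le_sum _ _ 2 h1
  rw [h.card_ends, smul_eq_mul] at h3
  omega

/-- A star with `2 * k + 4` vertices. -/
def star (k : ℕ) : Inst where
  n := 2 * (k + 1) + 2
  G := SimpleGraph.starGraph 0
  isTree := SimpleGraph.isTree_starGraph 0
  depot := 1
  len _ := 1
  demand v := if v = 0 ∨ v = 1 then 0 else k + 2
  Q := 2 * (k + 1)
  Q_pos := by omega

theorem isStar_star (k : ℕ) : IsStar (star k) (0 : Fin (2 * (k + 1) + 2)) k where
  ne := show (0 : Fin (2 * (k + 1) + 2)) ≠ 1 by simp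
  card := rfl
  adj h := SimpleGraph.starGraph_center_adj' (Ne.symm h)
  len _ := rfl
  demand_zero h := if_pos h
  demand h := if_neg h
  Q := rfl

theorem exists_ratio_gt {α : ℝ} (hα : α < 4 / 3) :
    ∃ I : Inst, 0 < I.LB ∧ α * (I.LB : ℝ) < (I.opt : ℝ) := by
  -- From `LB ≤ 6 * k + 8` one gets `4 / 3 * LB ≤ opt + 8 / 3`. From `4 * (k + 1) ≤ LB` and this
  -- choice of `k`, `(4 / 3 - α) * LB` exceeds 4, which outweighs the error.
  obtain ⟨k, hk⟩ := exists_nat_gt (1 / (4 / 3 - α))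
  have hpos : 0 < 4 / 3 - α := by linarith
  rw [div_lt_iff₀ hpos] at hk
  have hLB := (isStar_star k).LB_eq
  have hlow : 0 < (star k).LB := by omega
  refine ⟨star k, hlow, ?_⟩
  have hup : (star k).LB ≤ 6 * k + 8 := by
    have := (isStar_star k).traffic_center
    omega
  obtain ⟨S, hS, hc⟩ := exists_opt
  have hopt : 8 * (k + 1) ≤ (star k).opt := hc ▸ (isStar_star k).le_cost hS
  have h1 : ((star k).LB : ℝ) ≤ 6 * k + 8 := by exact_mod_cast hup
  have h2 : (8 : ℝ) * (k + 1) ≤ (star k).opt := by exact_mod_cast hopt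
  have h3 : (0 : ℝ) < (star k).LB := by exact_mod_cast hlow
  have h4 : (4 : ℝ) * (k + 1) ≤ (star k).LB := by
    have : 4 * (k + 1) ≤ (star k).LB := by omega
    exact_mod_cast this
  nlinarith

end Inst

end CVRP

/-! ### Computing with loads and elements. -/

namespace CVRP

open Data

/-- The vertices as a datum. -/
def finData (n : ℕ) : Data := ofList ((List.finRange n).map fun v : Fin n => nat v)

/-- A load as a datum. -/
def vec {n : ℕ} (u : Fin n → ℕ) : Data := ofList ((List.finRange n).map fun v => nat (u v))

theorem vec_eq_ofFn {n : ℕ} (u : Fin n → ℕ) : vec u = ofList (List.ofFn fun v => nat (u v)) := by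
  rw [vec, List.ofFn_eq_map]

namespace PT

variable {ι : Type*} {x y z : ι → Data}

/-! ### Case distinction on lists -/

variable {α : ι → Type*}

theorem uncons {L l : ∀ i, List (α i)} {p : ∀ i, α i} {ea : ∀ i, α i → Data}
    (hL : PT x fun i => ofList ((L i).map (ea i))) (h : ∀ i, L i = p i :: l i) :
    (PT x fun i => ea i (p i)) ∧ PT x fun i => ofList ((l i).map (ea i)) := by
  have h1 : PT x fun i => .pair (ea i (p i)) (ofList ((l i).map (ea i))) :=
    hL.congr fun i => by rw [h i]; rfl
  exact ⟨h1.fst, h1.snd⟩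

/-- In the second case the index carries head and tail together with the equation, so that the
pieces from `uncons` can be named in the branch. -/
theorem cases_list {L : ∀ i, List (α i)} {ea : ∀ i, α i → Data}
    (hL : PT x fun i => ofList ((L i).map (ea i)))
    (hnil : PT (fun i : {i // L i = []} => x i) fun i => y i)
    (hcons : PT (fun j : {j : Σ i, α i × List (α i) // L j.1 = j.2.1 :: j.2.2} => x j.1.1)
      fun j => y j.1.1) : PT x y := by
  classical
  have hc : PT x fun i => ofBool (decide (L i = [])) := hL.isNil.congr fun i => by simp
  refine (PT.ite hc hnil ?_).congr fun i => ite_self _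
  have h : ∀ i : {i // ¬ L i = []}, ∃ p : α i × List (α i), L i = p.1 :: p.2 := fun i => by
    obtain ⟨a, l, e⟩ := List.exists_cons_of_ne_nil i.2
    exact ⟨(a, l), e⟩
  choose p hp using h
  exact hcons.reindex fun i : {i // ¬ L i = []} => ⟨⟨i.1, p i⟩, hp i⟩

/-! ### Loads -/

variable {n : ι → ℕ}

theorem finMap (hF : PT x fun i => finData (n i)) {g : ∀ i, Fin (n i) → Data}
    (hg : PT (fun j : Σ i, Fin (n i) => Data.pair (x j.1) (nat j.2)) fun j => g j.1 j.2) :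
    PT x fun i => ofList ((List.finRange (n i)).map (g i)) :=
  map (α := fun i => Fin (n i)) (l := fun i => List.finRange (n i)) (ea := fun _ v => nat v) hF
    (hg.reindex fun j : Σ i, {a // a ∈ List.finRange (n i)} => ⟨j.1, j.2.1⟩)

theorem finSum (hF : PT x fun i => finData (n i)) {g : ∀ i, Fin (n i) → ℕ}
    (hg : PT (fun j : Σ i, Fin (n i) => Data.pair (x j.1) (nat j.2)) fun j => nat (g j.1 j.2)) :
    PT x fun i => nat (∑ v, g i v) :=
  (sum (l := fun i => (List.finRange (n i)).map (g i))
    ((finMap hF hg).congr fun i => by rw [List.map_map])).congr fun i => by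
      rw [← Fin.sum_univ_def]

theorem vec_apply {u : ∀ i, Fin (n i) → ℕ} {v : ∀ i, Fin (n i)} (hu : PT x fun i => vec (u i))
    (hv : PT x fun i => nat (v i)) : PT x fun i => nat (u i (v i)) :=
  (getElem (k := fun i => (v i : ℕ)) hu hv fun i => by simp).congr fun i => by simp

theorem index {κ : Type*} {x : κ → Data} {a : κ → ℕ} :
    PT (fun j => Data.pair (x j) (nat (a j))) fun j => nat (a j) := (refl _).snd

section

theorem vec_weaken {u : ∀ i, Fin (n i) → ℕ} (hu : PT x fun i => vec (u i)) :
    PT (fun j : Σ i, Fin (n i) => Data.pair (x j.1) (nat j.2)) fun j => nat (u j.1 j.2) :=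
  vec_apply (n := fun j : Σ i, Fin (n i) => n j.1) hu.weaken index

theorem vec_zero (hF : PT x fun i => finData (n i)) :
    PT x fun i => vec (0 : Fin (n i) → ℕ) := finMap hF (nat_const 0)

theorem vec_single (hF : PT x fun i => finData (n i)) {v : ∀ i, Fin (n i)} {k : ι → ℕ}
    (hv : PT x fun i => nat (v i)) (hk : PT x fun i => nat (k i)) :
    PT x fun i => vec (Pi.single (v i) (k i) : Fin (n i) → ℕ) :=
  (finMap hF (g := fun i w => nat (if (w : ℕ) = v i then k i else 0))
    (bool_ite (nat_eq index hv.weaken) hk.weaken (nat_const 0))).congr fun i => by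
      simp only [vec, Pi.single_apply, Fin.ext_iff]

theorem vec_add (hF : PT x fun i => finData (n i)) {u v : ∀ i, Fin (n i) → ℕ}
    (hu : PT x fun i => vec (u i)) (hv : PT x fun i => vec (v i)) :
    PT x fun i => vec (u i + v i) :=
  finMap hF ((vec_weaken hu).add (vec_weaken hv))

theorem vec_sub (hF : PT x fun i => finData (n i)) {u v : ∀ i, Fin (n i) → ℕ}
    (hu : PT x fun i => vec (u i)) (hv : PT x fun i => vec (v i)) :
    PT x fun i => vec (u i - v i) :=
  finMap hF ((vec_weaken hu).sub (vec_weaken hv))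

theorem vec_tot {u : ∀ i, Fin (n i) → ℕ} (hu : PT x fun i => vec (u i)) :
    PT x fun i => nat (tot (u i)) :=
  (sum (l := fun i => (List.finRange (n i)).map (u i)) (hu.congr fun i => by
    rw [List.map_map]; rfl)).congr fun i => by rw [tot, Fin.sum_univ_def]

theorem vec_pre (hF : PT x fun i => finData (n i)) {u : ∀ i, Fin (n i) → ℕ} {k : ι → ℕ}
    (hu : PT x fun i => vec (u i)) (hk : PT x fun i => nat (k i)) :
    PT x fun i => nat (pre (u i) (k i)) :=
  finSum hF (bool_ite (index.lt hk.weaken) (vec_weaken hu) (nat_const 0))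

theorem vec_fill (hF : PT x fun i => finData (n i)) {u : ∀ i, Fin (n i) → ℕ} {c : ι → ℕ}
    (hu : PT x fun i => vec (u i)) (hc : PT x fun i => nat (c i)) :
    PT x fun i => vec (fill (c i) (u i)) :=
  finMap hF ((hc.weaken.min (vec_pre (n := fun j : Σ i, Fin (n i) => n j.1) hF.weaken hu.weaken
    (index.add (nat_const 1)))).sub (hc.weaken.min
      (vec_pre (n := fun j : Σ i, Fin (n i) => n j.1) hF.weaken hu.weaken index)))

end

end PT

/-- A list of loads as a datum. -/
def vecs {n : ℕ} (l : List (Fin n → ℕ)) : Data := ofList (l.map vec)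

/-- An open vehicle and a list of closed vehicles as a datum. -/
def fleet {n : ℕ} (s : (Fin n → ℕ) × List (Fin n → ℕ)) : Data := .pair (vec s.1) (vecs s.2)

namespace Elem

variable {n : ℕ}

def mode (e : Elem n) (t : Fin 3) : (Fin n → ℕ) × List (Fin n → ℕ) := (e.opn t, e.cls t)

def encode (e : Elem n) : Data :=
  .pair (ofBool e.leaf) (.pair (nat e.x)
    (.pair (fleet (e.mode 0)) (.pair (fleet (e.mode 1)) (fleet (e.mode 2)))))

end Elem

/-- A list of elements as a datum. -/
def elems {n : ℕ} (l : List (Elem n)) : Data := ofList (l.map Elem.encode)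

namespace PT

variable {ι : Type*} {x y z : ι → Data} {n : ι → ℕ}

section

variable {e : ∀ i, Elem (n i)}

theorem elem_leaf (h : PT x fun i => (e i).encode) : PT x fun i => ofBool (e i).leaf := h.fst

theorem elem_x (h : PT x fun i => (e i).encode) : PT x fun i => nat (e i).x := h.snd.fst

theorem elem_mode (h : PT x fun i => (e i).encode) (t : Fin 3) :
    PT x fun i => fleet ((e i).mode t) := by
  fin_cases t
  exacts [h.snd.snd.fst, h.snd.snd.snd.fst, h.snd.snd.snd.snd]

theorem elem_opn (h : PT x fun i => (e i).encode) (t : Fin 3) : PT x fun i => vec ((e i).opn t) :=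
  (elem_mode h t).fst

theorem elem_cls (h : PT x fun i => (e i).encode) (t : Fin 3) : PT x fun i => vecs ((e i).cls t) :=
  (elem_mode h t).snd

theorem elem_mk {leaf : ι → Bool} {k : ι → ℕ} {f : ∀ i, Fin 3 → (Fin (n i) → ℕ) × List (Fin (n i) → ℕ)}
    (h1 : PT x fun i => ofBool (leaf i)) (h2 : PT x fun i => nat (k i))
    (h3 : ∀ t, PT x fun i => fleet (f i t)) :
    PT x fun i => (Elem.mk (leaf i) (k i) (fun t => (f i t).1) fun t => (f i t).2).encode :=
  h1.pair (h2.pair ((h3 0).pair ((h3 1).pair (h3 2))))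

end

end PT

end CVRP

/-! ### Computing a merge and an insertion. -/

namespace CVRP

open Data Elem

namespace PT

variable {ι : Type*} {x y z : ι → Data}

/-- The loop runs over `l` itself, with a counter and the remaining list as its state, and removes
an entry while the counter is below `k`; so a large `k` costs nothing extra. -/
theorem drop {l : ι → List Data} {k : ι → ℕ} (hl : PT x fun i => ofList (l i))
    (hk : PT x fun i => nat (k i)) : PT x fun i => ofList ((l i).drop (k i)) := by
  obtain ⟨P, hP⟩ := hl.size_le
  refine snd (y := fun i => nat (l i).length) ?_
  refine (foldlData (s := fun i m => .pair (nat m) (ofList ((l i).drop (Min.min m (k i))))) hl ?_ ?_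
    (P + P + 3) fun i m hm => ?_).congr fun i => ?_
  · exact ((nat_const 0).pair hl).congr fun i => by simp
  · have hm : PT (fun j : Σ i, Fin (l i).length => Data.pair (x j.1) (.pair (.pair (nat j.2)
      (ofList ((l j.1).drop (Min.min j.2 (k j.1))))) (l j.1)[j.2])) fun j => nat j.2 :=
        (refl _).snd.fst.fst
    have hs : PT (fun j : Σ i, Fin (l i).length => Data.pair (x j.1) (.pair (.pair (nat j.2)
      (ofList ((l j.1).drop (Min.min j.2 (k j.1))))) (l j.1)[j.2]))
        fun j => ofList ((l j.1).drop (Min.min j.2 (k j.1))) := (refl _).snd.fst.snd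
    refine ((hm.add (nat_const 1)).pair (ite (c := fun j => (j.2 : ℕ) < k j.1) (hm.lt hk.weaken)
      (z := fun j => ofList ((l j.1).drop (Min.min j.2 (k j.1))))
      (y := fun j => ofList ((l j.1).drop (Min.min (j.2 + 1) (k j.1)))) ?_
      (hs.reindex _))).congr fun j => ?_
    · refine snd (y := fun j => (l j.1.1)[j.1.2]) ((hs.reindex _).congr fun j => ?_)
      have h1 := j.2
      have h2 := j.1.2.2
      rw [min_eq_left h1.le, min_eq_left h1, List.drop_eq_getElem_cons h2]
      rfl
    · congr 1
      split_ifs with h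
      · rfl
      · rw [min_eq_right (by omega), min_eq_right (by omega)]
  · have h1 := hP i
    have h2 := length_lt_size (l i)
    have h3 := size_nat_le_self m
    have h4 := size_ofList_drop (l i) (Min.min m (k i))
    simp only [Data.size.eq_2, Polynomial.eval_add, Polynomial.eval_ofNat]
    omega
  · congr 2
    rcases le_total (l i).length (k i) with h | h
    · rw [min_eq_left h, List.drop_length, List.drop_eq_nil_of_le h]
    · rw [min_eq_right h]

theorem take {l : ι → List Data} {k : ι → ℕ} (hl : PT x fun i => ofList (l i))
    (hk : PT x fun i => nat (k i)) : PT x fun i => ofList ((l i).take (k i)) :=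
  (drop hl.reverse (hl.length.sub hk)).reverse.congr fun i => by
    rw [List.drop_reverse, List.reverse_reverse]
    congr 1
    rcases le_total (l i).length (k i) with h | h
    · rw [Nat.sub_eq_zero_of_le h, Nat.sub_zero, List.take_of_length_le h, List.take_length]
    · rw [Nat.sub_sub_self h]

variable {n Q : ι → ℕ}

theorem elems_length {A : ∀ i, List (Elem (n i))} (h : PT x fun i => elems (A i)) :
    PT x fun i => nat (A i).length :=
  (length h).congr fun i => by rw [List.length_map]

theorem elems_isNil {A : ∀ i, List (Elem (n i))} (h : PT x fun i => elems (A i)) :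
    PT x fun i => ofBool (decide (A i = [])) :=
  (isNil h).congr fun i => by simp

theorem vecs_append {l l' : ∀ i, List (Fin (n i) → ℕ)} (h : PT x fun i => vecs (l i))
    (h' : PT x fun i => vecs (l' i)) : PT x fun i => vecs (l i ++ l' i) :=
  (append h h').congr fun i => by rw [vecs, List.map_append]

theorem elems_append {l l' : ∀ i, List (Elem (n i))} (h : PT x fun i => elems (l i))
    (h' : PT x fun i => elems (l' i)) : PT x fun i => elems (l i ++ l' i) :=
  (append h h').congr fun i => by rw [elems, List.map_append]

theorem elems_leaves {A : ∀ i, List (Elem (n i))} (h : PT x fun i => elems (A i)) :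
    PT x fun i => elems ((A i).filter (·.leaf)) :=
  filter h (elem_leaf (refl _).snd)

theorem elems_nonleaves {A : ∀ i, List (Elem (n i))} (h : PT x fun i => elems (A i)) :
    PT x fun i => elems ((A i).filter (!·.leaf)) :=
  filter h ((bool_eq_true (elem_leaf (refl _).snd)).not.congr fun j => by simp)

theorem elems_savings {A : ∀ i, List (Elem (n i))} (h : PT x fun i => elems (A i)) :
    PT x fun i => nat (savings (A i)) :=
  ((nat_const 6).sub (elems_length (elems_leaves h))).sub
    ((nat_const 2).mul (elems_length (elems_nonleaves h)))

theorem elems_mergeOrder {A : ∀ i, List (Elem (n i))} (h : PT x fun i => elems (A i)) (t : ℕ) :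
    PT x fun i => elems (mergeOrder (A i) t) := by
  have hk := (nat_const (x := x) t).mul ((elems_length h).sub (nat_const 2))
  refine elems_append (elems_nonleaves h) (elems_append ?_ ?_)
  · exact (drop (elems_leaves h) hk).congr fun i => by rw [elems, List.map_drop]
  · exact (take (elems_leaves h) hk).congr fun i => by rw [elems, List.map_take]

theorem elems_map_opn {A : ∀ i, List (Elem (n i))} (h : PT x fun i => elems (A i)) (t : Fin 3) :
    PT x fun i => vecs ((A i).map (·.opn t)) :=
  (map h (g := fun _ e => vec (e.opn t)) (elem_opn (refl _).snd t)).congr fun i => by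
    rw [vecs, List.map_map]; rfl

theorem elems_flatMap_cls {A : ∀ i, List (Elem (n i))} (h : PT x fun i => elems (A i))
    (t : Fin 3) : PT x fun i => vecs ((A i).flatMap (·.cls t)) :=
  (flatMap h (g := fun _ e => (e.cls t).map vec) (elem_cls (refl _).snd t)).congr fun i => by
    rw [vecs, List.map_flatMap]

theorem chainStep_comp (hF : PT x fun i => finData (n i)) (hQ : PT x fun i => nat (Q i))
    {s : ∀ i, (Fin (n i) → ℕ) × List (Fin (n i) → ℕ)} {l : ∀ i, Fin (n i) → ℕ}
    (hs : PT x fun i => fleet (s i)) (hl : PT x fun i => vec (l i)) :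
    PT x fun i => fleet (chainStep (Q i) (s i) (l i)) := by
  have hf := vec_fill hF hl (hQ.sub (vec_tot hs.fst))
  exact (vec_sub hF hl hf).pair ((vec_add hF hs.fst hf).cons hs.snd)

theorem chain_cons (hF : PT x fun i => finData (n i)) (hQ : PT x fun i => nat (Q i)) (t : Fin 3)
    {c : ∀ i, List (Fin (n i) → ℕ)} {p q : ∀ i, Elem (n i)} {l : ∀ i, List (Elem (n i))}
    (hc : PT x fun i => vecs (c i)) (hp : PT x fun i => (p i).encode)
    (hq : PT x fun i => (q i).encode) (hl : PT x fun i => elems (l i))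
    (hK : ∀ i, (l i).length ≤ 3) :
    PT x fun i => fleet (chain (Q i) t (c i) (p i :: q i :: l i)) := by
  have hs := foldl_of_length_le (β := fun i => (Fin (n i) → ℕ) × List (Fin (n i) → ℕ)) 3
    (fun i => (l i).map (·.opn t)) (fun _ => vec) (fun _ => fleet)
    (fun i => chainStep (Q i)) (fun i => ((p i).opn t, c i)) (elems_map_opn hl t)
    ((elem_opn hp t).pair hc) (fun i => by simpa using hK i)
    (chainStep_comp hF.weaken hQ.weaken (refl _).snd.fst (refl _).snd.snd)
  exact (vec_add hF hs.fst (elem_opn hq t)).pair hs.snd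

theorem chain_comp (hF : PT x fun i => finData (n i)) (hQ : PT x fun i => nat (Q i)) (t : Fin 3)
    {c : ∀ i, List (Fin (n i) → ℕ)} {A : ∀ i, List (Elem (n i))}
    (hc : PT x fun i => vecs (c i)) (hA : PT x fun i => elems (A i))
    (hK : ∀ i, (A i).length ≤ 5) : PT x fun i => fleet (chain (Q i) t (c i) (A i)) := by
  refine cases_list hA ?_ ?_
  · refine (((vec_zero hF).pair hc).reindex fun i : {i // A i = []} => i.1).congr fun i => ?_
    rw [i.2]; rfl
  · obtain ⟨hp, hl⟩ := uncons (p := fun j => j.1.2.1) (l := fun j => j.1.2.2) (hA.reindex fun j :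
      {j : Σ i, Elem (n i) × List (Elem (n i)) // A j.1 = j.2.1 :: j.2.2} => j.1.1) fun j => j.2
    refine cases_list hl ?_ ?_
    · refine (((vec_zero hF).pair hc).reindex fun i : {i : {j : Σ i, Elem (n i) × List (Elem (n i))
        // A j.1 = j.2.1 :: j.2.2} // i.1.2.2 = []} => i.1.1.1).congr fun i => ?_
      rw [i.1.2, i.2]; rfl
    · obtain ⟨hq, hl'⟩ := uncons (p := fun j => j.1.2.1) (l := fun j => j.1.2.2) (hl.reindex fun j :
        {j : Σ i : {j : Σ i, Elem (n i) × List (Elem (n i)) // A j.1 = j.2.1 :: j.2.2},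
          Elem (n i.1.1) × List (Elem (n i.1.1)) // j.1.1.2.2 = j.2.1 :: j.2.2} => j.1.1)
        fun j => j.2
      refine (chain_cons (hF.reindex _) (hQ.reindex _) t (hc.reindex _) (hp.reindex _) hq hl'
        fun j => ?_).congr fun j => ?_
      · have h1 := hK j.1.1.1.1
        rw [j.1.1.2, j.2] at h1
        simp only [List.length_cons] at h1
        omega
      · rw [j.1.1.2, j.2]

theorem unify_comp (hF : PT x fun i => finData (n i)) (t : Fin 3)
    {c : ∀ i, List (Fin (n i) → ℕ)} {A : ∀ i, List (Elem (n i))}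
    (hc : PT x fun i => vecs (c i)) (hA : PT x fun i => elems (A i)) :
    PT x fun i => fleet (unify t (c i) (A i)) := by
  refine cases_list hA ?_ ?_
  · refine (((vec_zero hF).pair hc).reindex fun i : {i // A i = []} => i.1).congr fun i => ?_
    rw [i.2]; rfl
  · obtain ⟨hp, hl⟩ := uncons (p := fun j => j.1.2.1) (l := fun j => j.1.2.2) (hA.reindex fun j :
      {j : Σ i, Elem (n i) × List (Elem (n i)) // A j.1 = j.2.1 :: j.2.2} => j.1.1) fun j => j.2
    refine ((elem_opn hp t).pair (vecs_append (hc.reindex _) (elems_map_opn hl t))).congr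
      fun j => ?_
    rw [j.2]; rfl

theorem mergeMode_comp (hF : PT x fun i => finData (n i)) (hQ : PT x fun i => nat (Q i))
    {A : ∀ i, List (Elem (n i))} (hA : PT x fun i => elems (A i)) (t : Fin 3) :
    PT x fun i => fleet (mergeMode (Q i) (A i) t) := by
  refine (ite (c := fun i => (t : ℕ) < savings (A i))
    (y := fun i => fleet (chain (Q i) t ((A i).flatMap (·.cls t)) (mergeOrder (A i) t)))
    (z := fun i => fleet (unify t ((A i).flatMap (·.cls t)) (A i))) ((nat_const _).lt (elems_savings hA))
    (chain_comp (hF.reindex _) (hQ.reindex _) t ((elems_flatMap_cls hA t).reindex _)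
      ((elems_mergeOrder hA t).reindex _) fun i => ?_)
    ((unify_comp hF t (elems_flatMap_cls hA t) hA).reindex _)).congr fun i => ?_
  -- A positive saving means fewer than six elements, which makes the chain a fold of bounded
  -- length.
  · have h1 := i.2
    have h2 := Mergeable.filter_length (A i.1)
    rw [(mergeOrder_perm _ _).length_eq]
    unfold savings at h1
    omega
  · rw [mergeMode]; split_ifs <;> rfl

theorem merge_comp (hF : PT x fun i => finData (n i)) (hQ : PT x fun i => nat (Q i))
    {A : ∀ i, List (Elem (n i))} (hA : PT x fun i => elems (A i)) :
    PT x fun i => (merge (Q i) (A i)).encode := by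
  refine elem_mk (((elems_length hA).nat_eq (nat_const 2)).and (elems_isNil (elems_nonleaves hA)))
    (((sum ?_).sub (((elems_length hA).sub (nat_const 2)).mul hQ))) fun t => mergeMode_comp hF hQ hA t
  exact (map hA (g := fun _ e => nat e.x) (elem_x (refl _).snd)).congr fun i => by
    rw [List.map_map]; rfl

theorem waste_comp (hQ : PT x fun i => nat (Q i)) {e : ∀ i, Elem (n i)}
    (he : PT x fun i => (e i).encode) : PT x fun i => nat ((e i).waste (Q i)) :=
  hQ.sub (elem_x he)

theorem wasteSum_comp (hQ : PT x fun i => nat (Q i)) {A : ∀ i, List (Elem (n i))}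
    (hA : PT x fun i => elems (A i)) : PT x fun i => nat (wasteSum (Q i) (A i)) :=
  sum ((map hA (g := fun i e => nat (e.waste (Q i)))
    (waste_comp hQ.weaken (refl _).snd)).congr fun i => by rw [List.map_map]; rfl)

/-- The state in the course of pruning as a datum. -/
def pruneData {n : ℕ} (s : ℕ × List (Elem n) × List (Elem n)) : Data :=
  .pair (nat s.1) (.pair (elems s.2.1) (elems s.2.2))

theorem pruneStep_comp (hQ : PT x fun i => nat (Q i))
    {s : ∀ i, ℕ × List (Elem (n i)) × List (Elem (n i))} {e : ∀ i, Elem (n i)}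
    (hs : PT x fun i => pruneData (s i)) (he : PT x fun i => (e i).encode) :
    PT x fun i => pruneData (pruneStep (Q i) (s i) (e i)) := by
  have hw := PT.sub (m := fun i => (s i).1) hs.fst (waste_comp hQ he)
  refine (ite' (c := fun i => Q i ≤ (s i).1 - (e i).waste (Q i)) (hQ.le hw)
    (hw.pair (hs.snd.fst.pair (he.cons hs.snd.snd)))
    (hs.fst.pair ((he.cons hs.snd.fst).pair hs.snd.snd))).congr fun i => ?_
  rw [pruneStep]; split_ifs <;> rfl

/-- Pruning merely distributes the elements over two lists, so its states stay small, also for lists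
that do not waste a whole vehicle. -/
theorem foldl_pruneStep_le {n : ℕ} (Q : ℕ) (A : List (Elem n)) :
    ∀ s : ℕ × List (Elem n) × List (Elem n), (A.foldl (pruneStep Q) s).1 ≤ s.1 ∧
      ((A.foldl (pruneStep Q) s).2.1 ++ (A.foldl (pruneStep Q) s).2.2).Perm
        (s.2.1 ++ s.2.2 ++ A) := by
  induction A with
  | nil => intro s; simp
  | cons a A ih =>
    rintro ⟨W, k, d⟩
    obtain ⟨h1, h2⟩ := ih (pruneStep Q (W, k, d) a)
    rw [List.foldl_cons]
    unfold pruneStep at h1 h2 ⊢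
    dsimp only at h1 h2 ⊢
    split_ifs at h1 h2 ⊢
    · refine ⟨by dsimp only at h1; omega, h2.trans ?_⟩
      simp only [List.append_assoc, List.cons_append]
      exact List.Perm.append_left _ List.perm_middle.symm
    · refine ⟨h1, h2.trans ?_⟩
      exact (List.perm_middle (l₁ := k ++ d) (l₂ := A) (a := a)).symm

theorem prune_comp (hQ : PT x fun i => nat (Q i)) {A : ∀ i, List (Elem (n i))}
    (hA : PT x fun i => elems (A i)) : PT x fun i => pruneData (prune (Q i) (A i)) := by
  have hw := wasteSum_comp hQ hA
  obtain ⟨P, hP⟩ := hA.size_le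
  obtain ⟨R, hR⟩ := hw.size_le
  refine foldl (β := fun i => ℕ × List (Elem (n i)) × List (Elem (n i))) A (fun _ => Elem.encode)
    (fun _ => pruneData) (fun i => pruneStep (Q i)) (fun i => (wasteSum (Q i) (A i), [], [])) hA
    (hw.pair (nil.pair nil)) (pruneStep_comp hQ.weaken (refl _).snd.fst (refl _).snd.snd)
    (P + R + 10) fun i k _ => ?_
  obtain ⟨h1, h2⟩ := foldl_pruneStep_le (Q i) ((A i).take k) (wasteSum (Q i) (A i), [], [])
  set r := ((A i).take k).foldl (pruneStep (Q i)) (wasteSum (Q i) (A i), [], [])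
  have h3 := size_nat_le h1
  have h4 := size_ofList_perm (h2.map Elem.encode)
  simp only [List.nil_append] at h4
  have h5 := size_ofList_sublist ((List.take_sublist k (A i)).map Elem.encode)
  rw [List.map_append] at h4
  have h6 := size_ofList_append (r.2.1.map Elem.encode) (r.2.2.map Elem.encode)
  have h7 := hP i
  have h8 := hR i
  simp only [elems] at h7
  simp only [pruneData, elems, Data.size.eq_2, Polynomial.eval_add, Polynomial.eval_ofNat]
  dsimp only at h3
  omega

theorem insert_comp (hF : PT x fun i => finData (n i)) (hQ : PT x fun i => nat (Q i))
    {B : ∀ i, List (Elem (n i))} {e : ∀ i, Elem (n i)} (hB : PT x fun i => elems (B i))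
    (he : PT x fun i => (e i).encode) : PT x fun i => elems (insert (Q i) (B i) (e i)) := by
  have hA : PT x fun i => elems (e i :: B i) := he.cons hB
  have hp := prune_comp hQ hA
  refine (ite' (c := fun i => wasteSum (Q i) (e i :: B i) < Q i) ((wasteSum_comp hQ hA).lt hQ) hA
    (cons (merge_comp hF hQ hp.snd.fst) hp.snd.snd)).congr fun i => ?_
  rw [insert]; split_ifs <;> rfl

end PT

end CVRP

/-! ### Size bounds, and computing packings and the sweep. -/

namespace CVRP

open Data Elem

/-! ### Sizes -/

theorem size_vec_le {n Q : ℕ} {u : Fin n → ℕ} (hu : tot u ≤ Q) :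
    (vec u).size ≤ n * (Nat.size Q + 2) + 1 := by
  have h : ∀ d ∈ (List.finRange n).map fun v => nat (u v), d.size ≤ Nat.size Q + 1 := by
    intro d hd
    obtain ⟨v, -, rfl⟩ := List.mem_map.1 hd
    have h1 : u v ≤ tot u := Finset.single_le_sum (fun _ _ => Nat.zero_le _) (Finset.mem_univ v)
    simpa [Data.size] using Nat.size_le_size (h1.trans hu)
  have := PT.size_ofList_le h
  rwa [List.length_map, List.length_finRange] at this

theorem size_vecs_le {n B : ℕ} {l : List (Fin n → ℕ)} (h : ∀ u ∈ l, (vec u).size ≤ B) :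
    (vecs l).size ≤ l.length * (B + 1) + 1 := by
  have := PT.size_ofList_le (l := l.map vec) (B := B) fun d hd => by
    obtain ⟨u, hu, rfl⟩ := List.mem_map.1 hd
    exact h u hu
  rwa [List.length_map] at this

/-- Every vehicle carries at most `Q`, so its load has `n` entries of at most `Nat.size Q` bits; the
number of vehicles is the only quantity left to control. -/
theorem Elem.Valid.size_le {n Q : ℕ} {e : Elem n} (h : e.Valid Q) :
    e.encode.size ≤ e.count * (n * (Nat.size Q + 2) + Nat.size Q + 12) := by
  have hx : (nat e.x).size ≤ Nat.size Q + 1 := by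
    simpa [Data.size] using Nat.size_le_size h.x_le
  have hl := PT.size_ofBool e.leaf
  have hm : ∀ t, (fleet (e.mode t)).size ≤
      ((e.cls t).length + 1) * (n * (Nat.size Q + 2) + 2) + 1 := by
    intro t
    have h1 := size_vec_le ((h.opn_le t).trans h.x_le)
    have h2 := size_vecs_le fun u hu => size_vec_le (h.cls_le t u hu)
    simp only [fleet, Elem.mode, Data.size]
    rw [Nat.add_mul]
    rw [show n * (Nat.size Q + 2) + 1 + 1 = n * (Nat.size Q + 2) + 2 from rfl] at h2
    omega
  have h0 := hm 0
  have h1 := hm 1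
  have h2 := hm 2
  have hc : 3 ≤ e.count := by
    rw [count, Fin.sum_univ_three]; omega
  have h3 : 3 * (Nat.size Q + 10) ≤ e.count * (Nat.size Q + 10) := Nat.mul_le_mul_right _ hc
  have h4 : e.count * (n * (Nat.size Q + 2) + Nat.size Q + 12) =
      e.count * (n * (Nat.size Q + 2) + 2) + e.count * (Nat.size Q + 10) := by ring
  have h5 : e.count * (n * (Nat.size Q + 2) + 2) = ((e.cls 0).length + 1) *
      (n * (Nat.size Q + 2) + 2) + ((e.cls 1).length + 1) * (n * (Nat.size Q + 2) + 2) +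
      ((e.cls 2).length + 1) * (n * (Nat.size Q + 2) + 2) := by
    rw [count, Fin.sum_univ_three]; ring
  simp only [Elem.encode, Data.size.eq_2]
  omega

theorem Elem.count_le_size {n : ℕ} (e : Elem n) : e.count ≤ e.encode.size := by
  have hm : ∀ t, (e.cls t).length + 1 ≤ (fleet (e.mode t)).size := by
    intro t
    have := PT.length_lt_size ((e.cls t).map vec)
    rw [List.length_map] at this
    simp only [fleet, Elem.mode, vecs, Data.size]
    omega
  have h0 := hm 0
  have h1 := hm 1
  have h2 := hm 2
  rw [count, Fin.sum_univ_three]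
  simp only [Elem.encode, Data.size.eq_2]
  omega

theorem sum_count_le_size {n : ℕ} (A : List (Elem n)) : (A.map count).sum ≤ (elems A).size := by
  induction A with
  | nil => simp
  | cons e A ih =>
    have := e.count_le_size
    simp only [elems, List.map_cons, List.sum_cons, ofList, Data.size] at ih ⊢
    omega

theorem size_elems_le {n Q : ℕ} {A : List (Elem n)} (h : ∀ e ∈ A, e.Valid Q) :
    (elems A).size ≤ (A.map count).sum * (n * (Nat.size Q + 2) + Nat.size Q + 13) + 1 := by
  induction A with
  | nil => simp [elems, ofList, Data.size]
  | cons e A ih =>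
    have h1 := (h e (by simp)).size_le
    have h2 := ih fun e he => h e (by simp [he])
    have hc : 1 ≤ e.count := by
      rw [count, Fin.sum_univ_three]; omega
    simp only [elems, List.map_cons, List.sum_cons, ofList, Data.size, Nat.add_mul] at h2 ⊢
    have h3 : e.count * (n * (Nat.size Q + 2) + Nat.size Q + 13) =
      e.count * (n * (Nat.size Q + 2) + Nat.size Q + 12) + e.count := by ring
    omega

/-- An element at a vertex as a datum. -/
def tagged {n : ℕ} (s : Fin n × Elem n) : Data := .pair (nat s.1) s.2.encode

theorem size_tagged_le {n : ℕ} (S : List (Fin n × Elem n)) :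
    (ofList (S.map tagged)).size ≤ (elems (S.map Prod.snd)).size * (n + 2) := by
  induction S with
  | nil => simp [elems, ofList, Data.size]
  | cons s S ih =>
    have h1 := PT.size_nat_le_self s.1
    have h2 := s.1.2
    simp only [elems, List.map_cons, ofList, Data.size.eq_2, tagged, Nat.add_mul] at ih ⊢
    have h3 : s.2.encode.size ≤ s.2.encode.size * (n + 2) := Nat.le_mul_of_pos_right _ (by omega)
    omega

namespace PT

variable {ι : Type*} {x y z : ι → Data} {n Q : ι → ℕ}

theorem exists_bound_fin (hF : PT x fun i => finData (n i)) :
    ∃ P : Polynomial ℕ, ∀ i, n i ≤ P.eval (x i).size := by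
  obtain ⟨P, hP⟩ := hF.size_le
  refine ⟨P, fun i => ?_⟩
  have h1 := length_lt_size ((List.finRange (n i)).map fun v : Fin (n i) => nat v)
  rw [List.length_map, List.length_finRange] at h1
  exact h1.le.trans (hP i)

theorem exists_bound_nat {m : ι → ℕ} (hm : PT x fun i => nat (m i)) :
    ∃ P : Polynomial ℕ, ∀ i, Nat.size (m i) ≤ P.eval (x i).size := by
  obtain ⟨P, hP⟩ := hm.size_le
  refine ⟨P, fun i => ?_⟩
  have := hP i
  simp only [Data.size] at this
  omega

/-- Intermediate lists have no more vehicles than the elements they were made from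
(`Improves.count`), which bounds the states of the fold. -/
theorem pack_comp (hF : PT x fun i => finData (n i)) (hQ : PT x fun i => nat (Q i))
    {A : ∀ i, List (Elem (n i))} (hA : PT x fun i => elems (A i)) (hpos : ∀ i, 0 < Q i)
    (hv : ∀ i, ∀ e ∈ A i, e.Valid (Q i)) : PT x fun i => elems (pack (Q i) (A i)) := by
  obtain ⟨N, hN⟩ := exists_bound_fin hF
  obtain ⟨R, hR⟩ := exists_bound_nat hQ
  obtain ⟨P, hP⟩ := hA.size_le
  refine foldl (β := fun i => List (Elem (n i))) A (fun _ => Elem.encode)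
    (fun _ => elems) (fun i => insert (Q i)) (fun i => []) hA nil
    (insert_comp hF.weaken hQ.weaken (refl _).snd.fst (refl _).snd.snd)
    (P * (N * (R + 2) + R + 13) + 1) fun i k _ => ?_
  obtain ⟨h1, h2⟩ := pack_spec (hpos i) (A := (A i).take k)
    fun e he => hv i e (List.mem_of_mem_take he)
  refine (size_elems_le h1.valid).trans ?_
  have h3 : ((pack (Q i) ((A i).take k)).map count).sum ≤ P.eval (x i).size := by
    refine h2.count.trans ((sum_count_le_size _).trans (le_trans ?_ (hP i)))
    exact size_ofList_sublist ((List.take_sublist k (A i)).map Elem.encode)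
  simp only [Polynomial.eval_add, Polynomial.eval_mul, Polynomial.eval_one, Polynomial.eval_ofNat]
  have := hN i
  have := hR i
  gcongr

theorem at_comp {S : ∀ i, List (Fin (n i) × Elem (n i))} {v : ∀ i, Fin (n i)}
    (hS : PT x fun i => ofList ((S i).map tagged)) (hv : PT x fun i => nat (v i)) :
    PT x fun i => elems (at_ (v i) (S i)) := by
  refine (map (g := fun _ s => s.2.encode) (filter (p := fun i s => decide (s.1 = v i)) hS ?_)
    (refl _).snd.snd).congr fun i => ?_
  · exact ((refl _).snd.fst.nat_eq hv.weaken).congr fun j => by simp [Fin.ext_iff]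
  · rw [elems, at_, List.map_map]; rfl

theorem move_comp (hF : PT x fun i => finData (n i)) (hQ : PT x fun i => nat (Q i))
    {S : ∀ i, List (Fin (n i) × Elem (n i))} {v p : ∀ i, Fin (n i)}
    (hS : PT x fun i => ofList ((S i).map tagged)) (hv : PT x fun i => nat (v i))
    (hp : PT x fun i => nat (p i)) (hpos : ∀ i, 0 < Q i)
    (hval : ∀ i, ∀ s ∈ S i, s.2.Valid (Q i)) :
    PT x fun i => ofList ((move (Q i) (S i) (v i) (p i)).map tagged) := by
  have h1 := pack_comp hF hQ (at_comp hS hv) hpos fun i e he => hval i _ (mem_at.1 he)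
  have h2 := map (g := fun i e => tagged (p i, e)) h1 (hp.weaken.pair (refl _).snd)
  have h3 := filter (p := fun i s => !decide (s.1 = v i)) hS
    (((refl _).snd.fst.nat_eq hv.weaken).not.congr fun j => by simp [Fin.ext_iff])
  refine (append h2 h3).congr fun i => ?_
  rw [move, List.map_append, List.map_map]
  rfl

end PT

/-- A path as a datum. -/
def pathData {n : ℕ} (l : List (Fin n)) : Data := ofList (l.map fun v : Fin n => nat v)

namespace PT

universe w

variable {ι : Type w} {x y z : ι → Data} {I : ι → Inst}

/-- The steps of the sweep and of a tour act only on paths with at least two vertices, and use only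
the first two. -/
theorem cases_path {n : ι → ℕ} {L : ∀ i, List (Fin (n i))}
    (hL : PT x fun i => pathData (L i))
    (hnil : PT (fun i : {i // ∀ v p l, L i ≠ v :: p :: l} => x i) fun i => y i)
    (hcons : ∀ {κ : Type w} (g : κ → ι) (v p : ∀ j, Fin (n (g j))) (l : ∀ j, List (Fin (n (g j)))),
      (∀ j, L (g j) = v j :: p j :: l j) → PT (fun j => x (g j)) (fun j => nat (v j)) →
      PT (fun j => x (g j)) (fun j => nat (p j)) → PT (fun j => x (g j)) fun j => y (g j)) :
    PT x y := by
  refine cases_list hL ?_ ?_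
  · exact hnil.reindex fun i : {i // L i = []} => ⟨i.1, by simp [i.2]⟩
  · obtain ⟨hp, hl⟩ := uncons (p := fun j => j.1.2.1) (l := fun j => j.1.2.2) (hL.reindex fun j :
      {j : Σ i, Fin (n i) × List (Fin (n i)) // L j.1 = j.2.1 :: j.2.2} => j.1.1) fun j => j.2
    refine cases_list hl ?_ ?_
    · refine hnil.reindex fun i : {i : {j : Σ i, Fin (n i) × List (Fin (n i))
        // L j.1 = j.2.1 :: j.2.2} // i.1.2.2 = []} => ⟨i.1.1.1, by simp [i.1.2, i.2]⟩
    · obtain ⟨hq, hl'⟩ := uncons (p := fun j => j.1.2.1) (l := fun j => j.1.2.2) (hl.reindex fun j :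
        {j : Σ i : {j : Σ i, Fin (n i) × List (Fin (n i)) // L j.1 = j.2.1 :: j.2.2},
          Fin (n i.1.1) × List (Fin (n i.1.1)) // j.1.1.2.2 = j.2.1 :: j.2.2} => j.1.1)
        fun j => j.2
      exact hcons (κ := {j : Σ i : {j : Σ i, Fin (n i) × List (Fin (n i)) //
          L j.1 = j.2.1 :: j.2.2}, Fin (n i.1.1) × List (Fin (n i.1.1)) //
            j.1.1.2.2 = j.2.1 :: j.2.2}) (fun j => j.1.1.1.1) (fun j => j.1.1.1.2.1) (fun j => j.1.2.1)
        (fun j => j.1.2.2) (fun j => by rw [j.1.1.2, j.2]) (hp.reindex _) hq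

theorem sweepStep_comp (hF : PT x fun i => finData (I i).n) (hQ : PT x fun i => nat (I i).Q)
    {S : ∀ i, List (Fin (I i).n × Elem (I i).n)} {l : ∀ i, List (Fin (I i).n)}
    (hS : PT x fun i => ofList ((S i).map tagged)) (hl : PT x fun i => pathData (l i))
    (hval : ∀ i, ∀ s ∈ S i, s.2.Valid (I i).Q) :
    PT x fun i => ofList (((I i).sweepStep (S i) (l i)).map tagged) := by
  refine cases_path hl ?_ fun g v p l' h hv hp => ?_
  · refine (hS.reindex _).congr fun i => ?_
    obtain ⟨i, hi⟩ := i
    dsimp only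
    unfold Inst.sweepStep
    split
    · next h => exact absurd h (hi _ _ _)
    · rfl
  · refine (move_comp (hF.reindex g) (hQ.reindex g) (hS.reindex g) hv hp
      (fun j => (I (g j)).Q_pos) fun j => hval _).congr fun j => ?_
    rw [h j, Inst.sweepStep]

theorem start_comp (hF : PT x fun i => finData (I i).n) (hQ : PT x fun i => nat (I i).Q)
    (hD : PT x fun i => vec (I i).demand) :
    PT x fun i => ofList ((I i).start.map tagged) := by
  have hr : ∀ {κ : Type w} (g : κ → ι) (v : ∀ j, Fin (I (g j)).n) {x' : κ → Data},
      PT x' (fun j => x (g j)) → PT x' (fun j => nat (v j)) →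
      PT x' (fun j => nat ((I (g j)).rem (v j))) := fun g v x' h1 h2 =>
    (vec_apply (n := fun j => (I (g j)).n) (h1.trans (hD.reindex g)) h2).mod
      (h1.trans (hQ.reindex g))
  have h1 := filter (α := fun i => Fin (I i).n) (l := fun i => List.finRange (I i).n)
    (ea := fun _ v => nat v) (p := fun i v => !decide ((I i).rem v = 0)) hF
    (((hr _ _ (refl _).fst (refl _).snd).nat_eq (nat_const 0)).not.congr fun j => by simp)
  refine (map (g := fun i v => tagged (v, (I i).leafElem v)) h1 ?_).congr fun i => by
    rw [Inst.start, List.map_map]; rfl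
  have hrem := hr (fun j : Σ i, {a // a ∈ (List.finRange (I i).n).filter fun v =>
    !decide ((I i).rem v = 0)} => j.1) (fun j => j.2.1)
      (x' := fun j => Data.pair (x j.1) (nat j.2.1)) (refl _).fst (refl _).snd
  refine PT.pair (refl _).snd (elem_mk (leaf := fun _ => true)
    (f := fun j _ => (Pi.single j.2.1 ((I j.1).rem j.2.1), [])) (const _ _) hrem fun t => ?_)
  exact (vec_single (n := fun j : Σ i, {a // a ∈ (List.finRange (I i).n).filter fun v =>
    !decide ((I i).rem v = 0)} => (I j.1).n) hF.weaken (refl _).snd hrem).pair nil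

theorem sweep_comp (hF : PT x fun i => finData (I i).n) (hQ : PT x fun i => nat (I i).Q)
    (hD : PT x fun i => vec (I i).demand)
    (hP : PT x fun i => ofList ((I i).paths.map pathData)) :
    PT x fun i => ofList ((I i).sweep.map tagged) := by
  obtain ⟨N, hN⟩ := exists_bound_fin hF
  obtain ⟨R, hR⟩ := exists_bound_nat hQ
  refine foldl (β := fun i => List (Fin (I i).n × Elem (I i).n)) (fun i => (I i).paths.reverse)
    (fun _ => pathData) (fun _ S => ofList (S.map tagged)) (fun i => (I i).sweepStep)
    (fun i => (I i).start) (hP.reverse.congr fun i => by rw [List.map_reverse])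
    (start_comp hF hQ hD)
    (sweepStep_comp hF.weaken hQ.weaken (refl _).snd.fst (refl _).snd.snd
      fun j => (Inst.foldl_sweepStep_spec _ _ Inst.start_valid).1)
    ((3 * N * (N * (R + 2) + R + 13) + 1) * (N + 2)) fun i k _ => ?_
  obtain ⟨h1, h2⟩ := Inst.foldl_sweepStep_spec ((I i).paths.reverse.take k) _
    (Inst.start_valid (I := I i))
  refine (size_tagged_le _).trans ?_
  have h3 := size_elems_le (A := (((I i).paths.reverse.take k).foldl (I i).sweepStep
    (I i).start).map Prod.snd) fun e he => by
      obtain ⟨s, hs, rfl⟩ := List.mem_map.1 he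
      exact h1 s hs
  -- Every initial leaf is one vehicle in each of three packings, and this total never increases,
  -- however long the sweep runs.
  have h4 : (((I i).start.map Prod.snd).map count).sum ≤ 3 * (I i).n := by
    have h5 : ((I i).start.map Prod.snd).map count = ((List.finRange (I i).n).filter fun v =>
        !decide ((I i).rem v = 0)).map fun _ => 3 := by
      rw [Inst.start, List.map_map, List.map_map]
      refine List.map_congr_left fun v _ => ?_
      simp [count, Inst.leafElem]
    rw [h5, List.map_const', List.sum_replicate, smul_eq_mul, Nat.mul_comm]
    refine Nat.mul_le_mul_left _ ((List.length_filter_le _ _).trans ?_)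
    rw [List.length_finRange]
  have h5 := h2.count.trans h4
  simp only [Polynomial.eval_add, Polynomial.eval_mul, Polynomial.eval_one, Polynomial.eval_ofNat]
  have := hN i
  have := hR i
  refine Nat.mul_le_mul (h3.trans ?_) (by omega)
  have h6 : (((((I i).paths.reverse.take k).foldl (I i).sweepStep (I i).start).map
      Prod.snd).map count).sum ≤ 3 * N.eval (x i).size := by omega
  gcongr

end PT

end CVRP

/-! ### Reading an instance, listing its paths, and building detours. -/

namespace CVRP

open Data Elem Inst

namespace PT

universe w

variable {ι : Type w} {x y z : ι → Data} {I : ι → Inst}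

/-! ### Reading an instance -/

section

theorem inst_parts (h : PT x fun i => (I i).encode) :
    PT x fun i => .pair (nat (I i).n) (.pair (nat (I i).depot) (.pair (nat (I i).Q)
      (.pair (vec (I i).demand) (.pair (ofList ((List.finRange (I i).n).map fun u =>
        ofList ((List.finRange (I i).n).map fun v => (I i).encodeEntry u v))) (nat 0))))) :=
  h.congr fun i => by
    simp only [Inst.encode, ofList, vec_eq_ofFn, List.ofFn_eq_map]

theorem inst_depot (h : PT x fun i => (I i).encode) : PT x fun i => nat (I i).depot :=
  (inst_parts h).snd.fst

theorem inst_Q (h : PT x fun i => (I i).encode) : PT x fun i => nat (I i).Q :=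
  (inst_parts h).snd.snd.fst

theorem inst_demand (h : PT x fun i => (I i).encode) : PT x fun i => vec (I i).demand :=
  (inst_parts h).snd.snd.snd.fst

/-- The vertices are the positions in the list of demands, whose length is bounded by the input
size. -/
theorem inst_fin (h : PT x fun i => (I i).encode) : PT x fun i => finData (I i).n :=
  (range (inst_demand h)).congr fun i => by
    rw [finData, List.length_map, List.length_finRange]
    congr 1
    refine List.ext_getElem (by simp) fun k h1 h2 => by simp

theorem inst_entry (h : PT x fun i => (I i).encode) {u v : ∀ i, Fin (I i).n}
    (hu : PT x fun i => nat (u i)) (hv : PT x fun i => nat (v i)) :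
    PT x fun i => (I i).encodeEntry (u i) (v i) := by
  have h1 := getElem (k := fun i => (u i : ℕ)) (inst_parts h).snd.snd.snd.snd.fst hu
    fun _ => by simp
  have h2 : PT x fun i => ofList ((List.finRange (I i).n).map fun w =>
      (I i).encodeEntry (u i) w) := h1.congr fun i => by simp
  exact (getElem (k := fun i => (v i : ℕ)) h2 hv fun _ => by simp).congr fun i => by simp

open Classical in
theorem inst_adj (h : PT x fun i => (I i).encode) {u v : ∀ i, Fin (I i).n}
    (hu : PT x fun i => nat (u i)) (hv : PT x fun i => nat (v i)) :
    PT x fun i => ofBool (decide ((I i).G.Adj (u i) (v i))) :=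
  (inst_entry h hu hv).isPair (fun _ hi => ⟨_, _, if_pos hi⟩) fun _ hi => ⟨_, if_neg hi⟩

theorem inst_len (h : PT x fun i => (I i).encode) {u v : ∀ i, Fin (I i).n}
    (hu : PT x fun i => nat (u i)) (hv : PT x fun i => nat (v i))
    (hadj : ∀ i, (I i).G.Adj (u i) (v i)) : PT x fun i => nat ((I i).len s(u i, v i)) :=
  fst (z := fun _ => nat 0) ((inst_entry h hu hv).congr fun i => if_pos (hadj i))

end

/-! ### Paths -/

theorem mem_path {n : ι → ℕ} {l : ∀ i, List (Fin (n i))} {v : ∀ i, Fin (n i)}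
    (hl : PT x fun i => pathData (l i)) (hv : PT x fun i => nat (v i)) :
    PT x fun i => ofBool (decide (v i ∈ l i)) :=
  any (p := fun i w => w = v i) hl (((refl _).snd.nat_eq hv.weaken).congr fun j => by
    simp [Fin.ext_iff]) fun i => by simp

theorem ext_cons_comp (h : PT x fun i => (I i).encode) {v : ∀ i, Fin (I i).n}
    {l : ∀ i, List (Fin (I i).n)} (hv : PT x fun i => nat (v i))
    (hl : PT x fun i => pathData (v i :: l i)) :
    PT x fun i => ofList (((I i).ext (v i :: l i)).map pathData) := by
  classical
  have hadj : PT (fun j : Σ i, {a // a ∈ List.finRange (I i).n} =>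
      Data.pair (x j.1) (nat j.2.1)) fun j => ofBool (decide ((I j.1).G.Adj (v j.1) j.2.1)) :=
    inst_adj (I := fun j : Σ i, {a // a ∈ List.finRange (I i).n} => I j.1) h.weaken hv.weaken
      (refl _).snd
  have hmem : PT (fun j : Σ i, {a // a ∈ List.finRange (I i).n} =>
      Data.pair (x j.1) (nat j.2.1)) fun j => ofBool (decide (j.2.1 ∈ v j.1 :: l j.1)) :=
    mem_path (n := fun j : Σ i, {a // a ∈ List.finRange (I i).n} => (I j.1).n) hl.weaken
      (refl _).snd
  refine (map (g := fun i u => pathData (u :: v i :: l i)) (filter (α := fun i => Fin (I i).n)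
    (l := fun i => List.finRange (I i).n) (ea := fun _ u => nat u)
    (p := fun i u => decide ((I i).G.Adj (v i) u ∧ u ∉ v i :: l i)) (inst_fin h)
    (hadj.and hmem.not)) (PT.cons (refl _).snd hl.weaken)).congr fun i => ?_
  rw [Inst.ext, List.map_map]
  rfl

theorem ext_comp (h : PT x fun i => (I i).encode) {l : ∀ i, List (Fin (I i).n)}
    (hl : PT x fun i => pathData (l i)) :
    PT x fun i => ofList (((I i).ext (l i)).map pathData) := by
  refine cases_list hl ?_ ?_
  · refine (nil (x := fun i : {i // l i = []} => x i)).congr fun i => ?_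
    rw [i.2]; rfl
  · obtain ⟨hp, -⟩ := uncons (p := fun j => j.1.2.1) (l := fun j => j.1.2.2) (hl.reindex fun j :
      {j : Σ i, Fin (I i).n × List (Fin (I i).n) // l j.1 = j.2.1 :: j.2.2} => j.1.1) fun j => j.2
    exact (ext_cons_comp (h.reindex fun j : {j : Σ i, Fin (I i).n × List (Fin (I i).n) //
      l j.1 = j.2.1 :: j.2.2} => j.1.1) hp ((hl.reindex _).congr fun j => by
        rw [j.2])).congr fun j => by rw [j.2]

theorem flatMap_ext_comp (h : PT x fun i => (I i).encode) {P : ∀ i, List (List (Fin (I i).n))}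
    (hP : PT x fun i => ofList ((P i).map pathData)) :
    PT x fun i => ofList (((P i).flatMap (I i).ext).map pathData) :=
  (flatMap (g := fun i l => ((I i).ext l).map pathData) hP
    (ext_comp (I := fun j : Σ i, {a // a ∈ P i} => I j.1) (l := fun j => j.2.1)
      h.weaken (refl _).snd)).congr fun i => by rw [List.map_flatMap]

theorem size_pathData_le {n : ℕ} (l : List (Fin n)) : (pathData l).size ≤ l.length * (n + 2) + 1 := by
  have := size_ofList_le (l := l.map fun v : Fin n => nat v) (B := n + 1) fun d hd => by
    obtain ⟨v, -, rfl⟩ := List.mem_map.1 hd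
    exact (size_nat_le_self v).trans (by omega)
  rwa [List.length_map] at this

theorem paths_comp (h : PT x fun i => (I i).encode) :
    PT x fun i => ofList ((I i).paths.map pathData) := by
  obtain ⟨N, hN⟩ := exists_bound_fin (inst_fin h)
  have hF : PT x fun i => ofList ((List.finRange (I i).n).map fun v : Fin (I i).n => nat v) :=
    inst_fin h
  refine (foldlData (s := fun i k => ofList (((I i).pathsUpTo k).map pathData)) hF nil ?_
    (N * (N * (N + 2) + 2) + 1) fun i k _ => ?_).congr fun i => by simp [Inst.paths]
  · have hprev : PT (fun j : Σ i, Fin ((List.finRange (I i).n).map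
      fun v : Fin (I i).n => nat v).length =>
      Data.pair (x j.1) (.pair (ofList (((I j.1).pathsUpTo j.2).map pathData))
        ((List.finRange (I j.1).n).map fun v : Fin (I j.1).n => nat v)[j.2])) fun j =>
          ofList (((I j.1).pathsUpTo j.2).map pathData) := (refl _).snd.fst
    have h1 := flatMap_ext_comp (I := fun j : Σ i, Fin ((List.finRange (I i).n).map
      fun v : Fin (I i).n => nat v).length => I j.1) h.weaken hprev
    exact PT.cons (PT.cons (inst_depot h).weaken nil) h1
  -- At most `n` paths with at most `n` vertices each, every vertex being a number below `n`.
  · have h1 := Inst.length_pathsUpTo (I := I i) k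
    have h2 := size_ofList_le (l := ((I i).pathsUpTo k).map pathData)
      (B := (I i).n * ((I i).n + 2) + 1) fun d hd => by
        obtain ⟨l, hl, rfl⟩ := List.mem_map.1 hd
        obtain ⟨v, -, rfl⟩ := Inst.mem_pathsUpTo.1 hl
        refine (size_pathData_le _).trans ?_
        have := Inst.stem_length_le v
        gcongr
    rw [List.length_map] at h2
    refine h2.trans ?_
    have := hN i
    simp only [Polynomial.eval_add, Polynomial.eval_mul, Polynomial.eval_one,
      Polynomial.eval_ofNat]
    refine Nat.add_le_add_right (Nat.mul_le_mul (h1.trans this) ?_) 1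
    have h3 : (I i).n * ((I i).n + 2) ≤ N.eval (x i).size * (N.eval (x i).size + 2) := by gcongr
    omega

end PT

/-! ### Tours -/

/-- The state in building a detour: whether it has been inserted, and the vertices so far in reverse
order. -/
def detourStep {V : Type*} [DecidableEq V] (p v : V) (s : Bool × List V) (a : V) : Bool × List V :=
  if s.1 = false ∧ a = p then (true, p :: v :: p :: s.2) else (s.1, a :: s.2)

theorem foldl_detourStep {V : Type*} [DecidableEq V] (p v : V) (l : List V) :
    ∀ s : Bool × List V, (l.foldl (detourStep p v) s).2.reverse =
      s.2.reverse ++ if s.1 then l else detour p v l := by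
  induction l with
  | nil => intro s; simp [detour]
  | cons a l ih =>
    rintro ⟨b, o⟩
    rw [List.foldl_cons, ih]
    cases b <;> by_cases ha : a = p <;> simp [detourStep, detour, ha]

/-- The two extra vertices are inserted at most once; the conditional term records whether this
allowance has been used. -/
theorem length_foldl_detourStep {V : Type*} [DecidableEq V] (p v : V) (l : List V) :
    ∀ s : Bool × List V, (l.foldl (detourStep p v) s).2.length + (if s.1 then 2 else 0) ≤
      s.2.length + l.length + 2 := by
  induction l with
  | nil => rintro ⟨_ | _, o⟩ <;> simp
  | cons a l ih =>
    rintro ⟨b, o⟩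
    have := ih (detourStep p v (b, o) a)
    rw [List.foldl_cons]
    revert this
    cases b <;> by_cases ha : a = p <;> simp [detourStep, ha] <;> omega

theorem length_detour_le {V : Type*} [DecidableEq V] (p v : V) (l : List V) :
    (detour p v l).length ≤ l.length + 2 := by
  induction l with
  | nil => simp [detour]
  | cons a l ih =>
    rw [detour]
    split_ifs <;> simp only [List.length_cons] <;> omega

namespace PT

universe w

variable {ι : Type w} {x y z : ι → Data} {I : ι → Inst}

theorem detour_comp {n : ι → ℕ} (hF : PT x fun i => finData (n i)) {p v : ∀ i, Fin (n i)}
    {l : ∀ i, List (Fin (n i))} (hp : PT x fun i => nat (p i)) (hv : PT x fun i => nat (v i))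
    (hl : PT x fun i => pathData (l i)) :
    PT x fun i => pathData (detour (p i) (v i) (l i)) := by
  obtain ⟨N, hN⟩ := exists_bound_fin hF
  obtain ⟨P, hP⟩ := hl.size_le
  have h1 := foldl (β := fun i => Bool × List (Fin (n i))) l (fun _ v => nat v)
    (fun _ s => .pair (ofBool s.1) (pathData s.2)) (fun i => detourStep (p i) (v i))
    (fun i => (false, [])) hl ((const _ _).pair nil) ?_ ((P + 2) * (N + 2) + 10) fun i k _ => ?_
  · exact h1.snd.reverse.congr fun i => by
      rw [← List.map_reverse, foldl_detourStep]; rfl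
  · have hs : PT (fun j : Σ i, Fin (l i).length => Data.pair (x j.1) (.pair
      (Data.pair (ofBool (((l j.1).take j.2).foldl (detourStep (p j.1) (v j.1)) (false, [])).1)
        (pathData (((l j.1).take j.2).foldl (detourStep (p j.1) (v j.1)) (false, [])).2))
      (nat (l j.1)[j.2]))) fun j => Data.pair
        (ofBool (((l j.1).take j.2).foldl (detourStep (p j.1) (v j.1)) (false, [])).1)
        (pathData (((l j.1).take j.2).foldl (detourStep (p j.1) (v j.1)) (false, [])).2) :=
        (refl _).snd.fst
    have ha : PT (fun j : Σ i, Fin (l i).length => Data.pair (x j.1) (.pair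
      (Data.pair (ofBool (((l j.1).take j.2).foldl (detourStep (p j.1) (v j.1)) (false, [])).1)
        (pathData (((l j.1).take j.2).foldl (detourStep (p j.1) (v j.1)) (false, [])).2))
      (nat (l j.1)[j.2]))) fun j => nat (l j.1)[j.2] := (refl _).snd.snd
    refine (ite' (c := fun j => (((l j.1).take j.2).foldl (detourStep (p j.1) (v j.1))
        (false, [])).1 = false ∧ (l j.1)[j.2] = p j.1)
      (((bool_eq_true hs.fst).not.congr fun j => by simp).and
        ((ha.nat_eq hp.weaken).congr fun j => by simp [Fin.ext_iff]))
      ((const _ (ofBool true)).pair (hp.weaken.cons (hv.weaken.cons (hp.weaken.cons hs.snd))))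
      (hs.fst.pair (ha.cons hs.snd))).congr fun j => ?_
    rw [detourStep]
    split_ifs <;> rfl
  · have h2 := length_foldl_detourStep (p i) (v i) ((l i).take k) (false, [])
    have h3 := length_lt_size ((l i).map fun v : Fin (n i) => nat v)
    have h4 := hP i
    have h5 := hN i
    have h6 : ((l i).take k).length ≤ (l i).length := by simp
    set s := ((l i).take k).foldl (detourStep (p i) (v i)) (false, [])
    have h7 := size_pathData_le s.2
    have h8 := size_ofBool s.1
    rw [List.length_map] at h3
    simp only [List.length_nil, Bool.false_eq_true, if_false] at h2
    simp only [pathData] at h4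
    have h9 : s.2.length * (n i + 2) ≤ (P.eval (x i).size + 2) * (N.eval (x i).size + 2) :=
      Nat.mul_le_mul (by omega) (by omega)
    simp only [Data.size.eq_2, Polynomial.eval_add, Polynomial.eval_mul, Polynomial.eval_ofNat]
    omega

end PT

end CVRP

/-! ### Computing tours, costs and the best schedule. -/

namespace CVRP

open Data Elem Inst

namespace Inst

variable {I : Inst}

/-- The input contains lengths of edges only, so the cost of a step can be read off only where the
two vertices are adjacent. -/
theorem adj_of_mem_paths {v p : Fin I.n} {l : List (Fin I.n)} (h : v :: p :: l ∈ I.paths) :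
    I.G.Adj p v := by
  obtain ⟨w, hw⟩ := eq_stem_of_mem h
  by_cases hd : w = I.depot
  · rw [hd, stem_depot] at hw; simp at hw
  · obtain ⟨t, ht⟩ := stem_head (I.parent w)
    rw [stem_eq hd, ht] at hw
    simp only [List.cons.injEq] at hw
    rw [hw.1, hw.2.1]
    exact (adj_parent hd).symm

theorem length_tourStep_le (u : Fin I.n → ℕ) (W l : List (Fin I.n)) :
    (I.tourStep u W l).length ≤ W.length + 2 := by
  rcases l with _ | ⟨v, _ | ⟨p, t⟩⟩
  · simp [tourStep]
  · simp [tourStep]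
  · rw [tourStep]
    split_ifs
    · exact length_detour_le _ _ _
    · omega

theorem length_foldl_tourStep_le (u : Fin I.n → ℕ) (o : List (List (Fin I.n))) :
    ∀ W : List (Fin I.n), (o.foldl (I.tourStep u) W).length ≤ W.length + 2 * o.length := by
  induction o with
  | nil => intro W; simp
  | cons l o ih =>
    intro W
    have h1 := ih (I.tourStep u W l)
    have h2 := length_tourStep_le u W l
    simp only [List.foldl_cons, List.length_cons]
    omega

end Inst

namespace PT

universe w

variable {ι : Type w} {x y z : ι → Data} {I : ι → Inst}

theorem headLoaded_comp {n : ι → ℕ} {u : ∀ i, Fin (n i) → ℕ} {l : ∀ i, List (Fin (n i))}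
    (hu : PT x fun i => vec (u i)) (hl : PT x fun i => pathData (l i)) :
    PT x fun i => ofBool (headLoaded (u i) (l i)) := by
  refine cases_list hl ?_ ?_
  · exact (const _ (ofBool false)).congr fun i => by rw [i.2]; rfl
  · obtain ⟨hp, -⟩ := uncons (p := fun j => j.1.2.1) (l := fun j => j.1.2.2) (hl.reindex fun j :
      {j : Σ i, Fin (n i) × List (Fin (n i)) // l j.1 = j.2.1 :: j.2.2} => j.1.1) fun j => j.2
    exact ((vec_apply (n := fun j : {j : Σ i, Fin (n i) × List (Fin (n i)) //
      l j.1 = j.2.1 :: j.2.2} => n j.1.1) (hu.reindex _) hp).nat_eq (nat_const 0)).not.congr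
        fun j => by rw [j.2, headLoaded, decide_not]

section

variable {u : ∀ i, Fin (I i).n → ℕ}

theorem needed_comp (hP : PT x fun i => ofList ((I i).paths.map pathData))
    (hu : PT x fun i => vec (u i)) : PT x fun i => pathData ((I i).needed (u i)) := by
  refine (flatMap (g := fun i (l : List (Fin (I i).n)) => l.map fun v : Fin (I i).n => nat v)
    (filter (p := fun i l => headLoaded (u i) l) hP
      (headLoaded_comp (n := fun j : Σ i, {a // a ∈ (I i).paths} => (I j.1).n)
        (l := fun j => j.2.1) hu.weaken (refl _).snd)) (refl _).snd).congr fun i => ?_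
  rw [Inst.needed, pathData, List.map_flatMap]
  rfl

theorem tourStep_comp (hF : PT x fun i => finData (I i).n)
    (hN : PT x fun i => pathData ((I i).needed (u i))) {W l : ∀ i, List (Fin (I i).n)}
    (hW : PT x fun i => pathData (W i)) (hl : PT x fun i => pathData (l i)) :
    PT x fun i => pathData ((I i).tourStep (u i) (W i) (l i)) := by
  refine cases_path hl ?_ fun g v p l' h hv hp => ?_
  · refine (hW.reindex _).congr fun i => ?_
    obtain ⟨i, hi⟩ := i
    dsimp only
    unfold Inst.tourStep
    split
    · next h => exact absurd h (hi _ _ _)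
    · rfl
  · refine (ite' (mem_path (hN.reindex g) hv)
      (detour_comp (hF.reindex g) hp hv (hW.reindex g)) (hW.reindex g)).congr fun j => ?_
    rw [h j, Inst.tourStep]
    split_ifs <;> rfl

theorem tourStepCost_comp (hI : PT x fun i => (I i).encode)
    (hN : PT x fun i => pathData ((I i).needed (u i))) {l : ∀ i, List (Fin (I i).n)}
    (hl : PT x fun i => pathData (l i)) (hmem : ∀ i, l i ∈ (I i).paths) :
    PT x fun i => nat ((I i).tourStepCost (u i) (l i)) := by
  refine cases_path hl ?_ fun g v p l' h hv hp => ?_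
  · refine (nat_const 0).congr fun i => ?_
    obtain ⟨i, hi⟩ := i
    dsimp only
    unfold Inst.tourStepCost
    split
    · next h => exact absurd h (hi _ _ _)
    · rfl
  · refine (bool_ite (mem_path (hN.reindex g) hv) ((nat_const 2).mul
      (inst_len (I := fun j => I (g j)) (hI.reindex g) hp hv fun j =>
        adj_of_mem_paths (h j ▸ hmem (g j)))) (nat_const 0)).congr fun j => ?_
    rw [h j, Inst.tourStepCost]

theorem tourList_comp (hI : PT x fun i => (I i).encode) (hu : PT x fun i => vec (u i)) :
    PT x fun i => pathData ((I i).tourList (u i)) := by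
  obtain ⟨N, hN⟩ := exists_bound_fin (inst_fin hI)
  have hP := paths_comp hI
  refine foldl (β := fun i => List (Fin (I i).n)) (fun i => (I i).paths) (fun _ => pathData)
    (fun _ => pathData) (fun i => (I i).tourStep (u i)) (fun i => [(I i).depot]) hP
    (cons (inst_depot hI) nil)
    (tourStep_comp (I := fun j : Σ i, Fin (I i).paths.length => I j.1) (u := fun j => u j.1)
      (inst_fin hI).weaken (needed_comp hP hu).weaken (refl _).snd.fst (refl _).snd.snd)
    ((1 + 2 * N) * (N + 2) + 1) fun i k hk => ?_
  have h1 := length_foldl_tourStep_le (u i) ((I i).paths.take k) [(I i).depot]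
  have h2 : ((I i).paths.take k).length ≤ (I i).n :=
    (List.length_take_le' _ _).trans (length_pathsUpTo _)
  refine (size_pathData_le _).trans ?_
  have := hN i
  simp only [List.length_singleton] at h1
  simp only [Polynomial.eval_add, Polynomial.eval_mul, Polynomial.eval_one, Polynomial.eval_ofNat]
  exact Nat.add_le_add_right (Nat.mul_le_mul (by omega) (by omega)) 1

theorem tourCost_comp (hI : PT x fun i => (I i).encode) (hu : PT x fun i => vec (u i)) :
    PT x fun i => nat ((I i).tourCost (u i)) := by
  have hP := paths_comp hI
  exact sum ((map (g := fun i l => nat ((I i).tourStepCost (u i) l)) hP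
    (tourStepCost_comp (I := fun j : Σ i, {a // a ∈ (I i).paths} => I j.1)
      (u := fun j => u j.1) (l := fun j => j.2.1) hI.weaken (needed_comp hP hu).weaken
      (refl _).snd fun j => j.2.2)).congr fun i => by rw [List.map_map]; rfl)

theorem mkTour_comp (hI : PT x fun i => (I i).encode) (hu : PT x fun i => vec (u i)) :
    PT x fun i => ((I i).mkTour (u i)).encode := by
  refine (pair (tourList_comp hI hu) (ite' (c := fun i => tot (u i) ≤ (I i).Q)
    ((vec_tot hu).le (inst_Q hI)) hu (vec_zero (inst_fin hI)))).congr fun i => ?_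
  rw [Inst.Tour.encode, ← vec_eq_ofFn]
  have h1 : ((I i).mkTour (u i)).walk.support = (I i).tourList (u i) :=
    (exists_walk (u i)).choose_spec.1
  -- In the encoding of a walk, the coercion of vertices to numbers is a monadic bind over the whole
  -- list; this turns it into an ordinary map.
  have h2 : ∀ l : List (Fin (I i).n), List.map nat (l >>= fun v => pure (v : ℕ)) =
      l.map fun v : Fin (I i).n => nat v := fun l => by
    simp only [List.bind_eq_flatMap, List.pure_def, ← List.map_eq_flatMap, List.map_map]
    rfl
  rw [h1, h2]
  simp only [Inst.mkTour]
  split_ifs <;> rfl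

end

theorem modeLoads_comp (hI : PT x fun i => (I i).encode) (t : Fin 3) :
    PT x fun i => vecs ((I i).modeLoads t) :=
  (flatMap (g := fun i s => (Inst.Elem.loads t s.2).map vec)
    (sweep_comp (inst_fin hI) (inst_Q hI) (inst_demand hI) (paths_comp hI))
    (PT.cons (elem_opn (refl _).snd.snd t) (elem_cls (refl _).snd.snd t))).congr fun i => by
      rw [Inst.modeLoads, vecs, List.map_flatMap]

theorem full_comp (hI : PT x fun i => (I i).encode) :
    (PT (fun j : Σ i, Fin (I i).n => Data.pair (x j.1) (nat j.2))
      fun j => nat ((I j.1).demand j.2 / (I j.1).Q)) ∧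
    PT (fun j : Σ i, Fin (I i).n => Data.pair (x j.1) (nat j.2))
      fun j => vec (Pi.single j.2 (I j.1).Q : Fin (I j.1).n → ℕ) :=
  ⟨(vec_weaken (inst_demand hI)).div (inst_Q hI).weaken,
    vec_single (n := fun j : Σ i, Fin (I i).n => (I j.1).n) (inst_fin hI).weaken index
      (inst_Q hI).weaken⟩

theorem modeCost_comp (hI : PT x fun i => (I i).encode) (t : Fin 3) :
    PT x fun i => nat ((I i).modeCost t) := by
  obtain ⟨h1, h2⟩ := full_comp hI
  refine add (sum ?_) (sum ?_)
  · exact (finMap (inst_fin hI) (h1.mul (tourCost_comp (I := fun j : Σ i, Fin (I i).n => I j.1)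
      hI.weaken h2))).congr fun i => by rw [List.map_map]
  · exact (map (g := fun i u => nat ((I i).tourCost u)) (modeLoads_comp hI t)
      (tourCost_comp (I := fun j : Σ i, {a // a ∈ (I i).modeLoads t} => I j.1)
        (u := fun j => j.2.1) hI.weaken (refl _).snd)).congr fun i => by rw [List.map_map]; rfl

theorem modeSchedule_comp (hI : PT x fun i => (I i).encode) (t : Fin 3) :
    PT x fun i => ((I i).modeSchedule t).encode := by
  obtain ⟨h1, h2⟩ := full_comp hI
  refine (append (finMap (g := fun i v => .pair (nat ((I i).demand v / (I i).Q))
    ((I i).mkTour (Pi.single v (I i).Q)).encode) (inst_fin hI) (h1.pair (mkTour_comp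
    (I := fun j : Σ i, Fin (I i).n => I j.1) hI.weaken h2)))
    (map (g := fun i u => .pair (nat 1) ((I i).mkTour u).encode) (modeLoads_comp hI t)
      ((nat_const 1).pair (mkTour_comp (I := fun j : Σ i, {a // a ∈ (I i).modeLoads t} => I j.1)
        (u := fun j => j.2.1) hI.weaken (refl _).snd)))).congr fun i => ?_
  rw [Inst.Schedule.encode, Inst.modeSchedule, List.map_append, List.map_map, List.map_map]
  rfl

theorem bestSchedule_comp : PT Inst.encode fun I => I.bestSchedule.encode := by
  have h := modeCost_comp (I := fun I => I) (refl Inst.encode)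
  have hs := modeSchedule_comp (I := fun I => I) (refl Inst.encode)
  refine (ite' (((h 0).le (h 1)).and ((h 0).le (h 2))) (hs 0)
    (ite' ((h 1).le (h 2)) (hs 1) (hs 2))).congr fun I => ?_
  rw [Inst.bestSchedule]
  split_ifs <;> rfl

end PT

end CVRP

theorem theorem1 :
    (∃ (p : CVRP.Prog) (P : Polynomial ℕ), ∀ I : CVRP.Inst, ∃ (S : I.Schedule) (t : ℕ),
      p.Runs I.encode S.encode t ∧ t ≤ P.eval I.encode.size ∧ S.Feasible ∧
      (S.cost : ℝ) ≤ 4 / 3 * (I.LB : ℝ) ∧ (S.cost : ℝ) ≤ 4 / 3 * (I.opt : ℝ)) ∧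
    (∀ I : CVRP.Inst, I.LB ≤ I.opt) ∧
    (∀ α : ℝ, α < 4 / 3 → ∃ I : CVRP.Inst, 0 < I.LB ∧ α * (I.LB : ℝ) < (I.opt : ℝ)) := by
  refine ⟨?_, fun I => CVRP.Inst.LB_le_opt, fun α hα => CVRP.Inst.exists_ratio_gt hα⟩
  obtain ⟨p, P, h⟩ := CVRP.PT.bestSchedule_comp
  refine ⟨p, P, fun I => ?_⟩
  obtain ⟨t, ht, hP⟩ := h I
  have h1 : (3 : ℝ) * I.bestSchedule.cost ≤ 4 * I.LB := by
    exact_mod_cast I.bestSchedule_cost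
  have h2 : (I.LB : ℝ) ≤ I.opt := by exact_mod_cast I.LB_le_opt
  exact ⟨I.bestSchedule, t, ht, hP, CVRP.Inst.bestSchedule_feasible, by linarith, by linarith⟩
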